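/- A sequence $(M_p)_{p\in\mathbb N}$ of positive reals is called a weight sequence if $M_p/M_{p-1}\to\infty$. Consider the conditions $(M.1)$: $M_p^2\le M_{p-1}M_{p+1}$ for $p\ge 1$; and $(M.2)'$: there are $C_0,H\ge 1$ with $M_{p+1}\le C_0H^pM_p$ for all $p$. For a multi-index $\alpha\in\mathbb N^d$ write $M_\alpha=M_{|\alpha|}$. The associated function of a weight sequence $A_p$ is $A(t)=\sup_{p}\log(t^pA_0/A_p)$ for $t>0$, $A(0)=0$, and $A(x)=A(|x|)$ for $x\in\mathbb R^d$. A measurable function $\omega:\mathbb R^d\to(0,\infty)$ is called a weight function if $\omega$ and $\omega^{-1}$ are locally bounded; it is $(A_p)$-admissible (resp. $\{A_p\}$-admissible) if for some $\lambda>0$ (resp. for all $\lambda>0$) there is $C>0$ such that $\omega(x+t)\le C\,\omega(x)e^{A(\lambda t)}$ for all $x,t\in\mathbb R^d$. Let $\mathcal S^{(M_p)}_{(A_p)}(\mathbb R^d)$ be the space of all $\varphi\in C^\infty(\mathbb R^d)$ with $\sup_{\alpha,x}|\varphi^{(\alpha)}(x)|e^{A(x/\ell)}/(\ell^{|\alpha|}M_\alpha)<\infty$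 for all $\ell>0$. For $\ell>0$ let $\mathcal D^{M_p,\ell}_{L^1_\omega}$ be the Banach space of all $\varphi\in C^\infty(\mathbb R^d)$ such that $$\|\varphi\|_{\ell}:=\sup_{\alpha\in\mathbb N^d}\frac{1}{\ell^{|\alpha|}M_\alpha}\int_{\mathbb R^d}|\varphi^{(\alpha)}(x)|\,\omega(x)\,dx<\infty,$$ and set $\mathcal D^{(M_p)}_{L^1_\omega}=\varprojlim_{\ell\to0^+}\mathcal D^{M_p,\ell}_{L^1_\omega}$ and $\mathcal D^{\{M_p\}}_{L^1_\omega}=\varinjlim_{\ell\to\infty}\mathcal D^{M_p,\ell}_{L^1_\omega}$ (limits of locally convex spaces). Let $\mathcal B'^{(M_p)}_\omega$ and $\mathcal B'^{\{M_p\}}_\omega$ be their strong duals, and let $\dot{\mathcal B}'^{(M_p)}_\omega$ and $\dot{\mathcal B}'^{\{M_p\}}_\omega$ be the closures in $\mathcal B'^{(M_p)}_\omega$ and $\mathcal B'^{\{M_p\}}_\omega$, respectively, of the space of compactly supported continuous functions $f$ on $\mathbb R^d$, where $f$ acts by $\varphi\mapsto\int_{\mathbb R^d} f(x)\varphi(x)\,dx$.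 All functions other than weights are complex-valued. **Corollary 3.9.** Let $M_p$ be a weight sequence satisfying $(M.1)$ and $(M.2)'$, and let $\omega$ be a weight function on $\mathbb R^d$. 1. If there is a weight sequence $A_p$ satisfying $(M.1)$ and $(M.2)'$ such that $\omega$ is $(A_p)$-admissible and $\mathcal S^{(M_p)}_{(A_p)}(\mathbb R^d)\ne\{0\}$, then $\dot{\mathcal B}'^{(M_p)}_\omega$ is complete and is an $(LB)$-space, i.e. a Hausdorff locally convex space that is the locally convex inductive limit of an increasing sequence of Banach spaces with continuous inclusions. 2. If there is a weight sequence $A_p$ satisfying $(M.1)$ and $(M.2)'$ such that $\omega$ is $\{A_p\}$-admissible and $\mathcal S^{(M_p)}_{(A_p)}(\mathbb R^d)\ne\{0\}$, then $\dot{\mathcal B}'^{\{M_p\}}_\omega$ is a Fréchet space and is quasinormable, i.e. for every neighbourhood $U$ of $0$ there is a neighbourhood $V$ of $0$ such that for every $\varepsilon>0$ there is a bounded set $B$ with $V\subseteq B+\varepsilon U$. -/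

import Mathlib

open MeasureTheory Filter Topology

noncomputable section

namespace Ultra

/-! ### Notions from the theory of locally convex spaces -/

universe u

/-- `E` is an `(LB)`-space: a Hausdorff locally convex space which is the locally convex inductive
limit of an increasing sequence of Banach spaces with continuous inclusions `X n → X (n + 1)`.
The last clause says that the topology of the locally convex space `E` is the finest locally convex
topology for which all the inclusions `X n → E` are continuous. -/
structure IsLBSpace (E : Type u) [AddCommGroup E] [Module ℂ E] [TopologicalSpace E] : Prop where
  isTopologicalAddGroup : IsTopologicalAddGroup E
  continuousSMul : ContinuousSMul ℂ E
  t2Space : T2Space E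
  locallyConvexSpace : LocallyConvexSpace ℝ E
  exists_steps : ∃ (X : ℕ → Type u) (_ : ∀ n, NormedAddCommGroup (X n))
    (_ : ∀ n, NormedSpace ℂ (X n)) (_ : ∀ n, CompleteSpace (X n))
    (j : ∀ n, X n →L[ℂ] X (n + 1)) (ι : ∀ n, X n →ₗ[ℂ] E),
    (∀ n, Function.Injective (ι n)) ∧
    (∀ n x, ι (n + 1) (j n x) = ι n x) ∧
    (∀ e : E, ∃ n x, ι n x = e) ∧
    ∀ p : Seminorm ℂ E, Continuous p ↔ ∀ n, Continuous fun x : X n => p (ι n x)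

/-- `E` is a Fréchet space: a complete metrizable locally convex space. -/
structure IsFrechetSpace (E : Type*) [AddCommGroup E] [Module ℂ E] [UniformSpace E] : Prop where
  isUniformAddGroup : IsUniformAddGroup E
  continuousSMul : ContinuousSMul ℂ E
  locallyConvexSpace : LocallyConvexSpace ℝ E
  metrizableSpace : TopologicalSpace.MetrizableSpace E
  completeSpace : CompleteSpace E

/-- `E` is quasinormable: for every neighbourhood `U` of zero there is a neighbourhood `V` of zero
such that for all `ε > 0` there is a bounded set `B` with `V ⊆ B + ε U`. -/
def IsQuasinormable (E : Type*) [AddCommGroup E] [Module ℂ E] [TopologicalSpace E] : Prop :=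
  ∀ U ∈ 𝓝 (0 : E), ∃ V ∈ 𝓝 (0 : E), ∀ ε : ℝ, 0 < ε →
    ∃ B : Set E, Bornology.IsVonNBounded ℂ B ∧
      ∀ v ∈ V, ∃ b ∈ B, ∃ u ∈ U, v = b + (ε : ℂ) • u

/-! ### Weight sequences and weight functions -/

/-- Weight sequences: positive sequences with `M p / M (p - 1) → ∞`. -/
structure IsWeightSequence (M : ℕ → ℝ) : Prop where
  pos : ∀ p, 0 < M p
  tendsto : Tendsto (fun p => M (p + 1) / M p) atTop atTop

/-- Condition `(M.1)`. -/
def CondM1 (M : ℕ → ℝ) : Prop := ∀ p, 1 ≤ p → M p ^ 2 ≤ M (p - 1) * M (p + 1)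

/-- Condition `(M.2)'`. -/
def CondM2' (M : ℕ → ℝ) : Prop :=
  ∃ C₀ H : ℝ, 1 ≤ C₀ ∧ 1 ≤ H ∧ ∀ p, M (p + 1) ≤ C₀ * H ^ p * M p

/-- The associated function of `M`; for a weight sequence the supremum is finite. -/
def assocFun (M : ℕ → ℝ) (t : ℝ) : ℝ :=
  if 0 < t then ⨆ p : ℕ, Real.log (t ^ p * M 0 / M p) else 0

variable {d : ℕ}

/-- Weight functions on `ℝ^d`: (Lebesgue) measurable positive functions such that `ω` and `ω⁻¹` are
locally bounded. -/
structure IsWeightFunction (ω : EuclideanSpace ℝ (Fin d) → ℝ) : Prop where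
  aemeasurable : AEMeasurable ω volume
  pos : ∀ x, 0 < ω x
  locallyBounded : ∀ K : Set (EuclideanSpace ℝ (Fin d)), IsCompact K →
    ∃ C : ℝ, ∀ x ∈ K, ω x ≤ C ∧ (ω x)⁻¹ ≤ C

/-- `(A_p)`-admissibility. -/
def BeurlingAdmissible (A : ℕ → ℝ) (ω : EuclideanSpace ℝ (Fin d) → ℝ) : Prop :=
  ∃ l : ℝ, 0 < l ∧ ∃ C : ℝ, 0 < C ∧
    ∀ x t, ω (x + t) ≤ C * ω x * Real.exp (assocFun A (l * ‖t‖))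

/-- `{A_p}`-admissibility. -/
def RoumieuAdmissible (A : ℕ → ℝ) (ω : EuclideanSpace ℝ (Fin d) → ℝ) : Prop :=
  ∀ l : ℝ, 0 < l → ∃ C : ℝ, 0 < C ∧
    ∀ x t, ω (x + t) ≤ C * ω x * Real.exp (assocFun A (l * ‖t‖))

/-! ### Smooth functions and their partial derivatives -/

variable (d) in
/-- `C^∞(ℝ^d)`, complex-valued. -/
def Smooth : Submodule ℂ (EuclideanSpace ℝ (Fin d) → ℂ) where
  carrier := {φ | ContDiff ℝ (⊤ : ℕ∞) φ}
  add_mem' := fun {f g} (hf : ContDiff ℝ (⊤ : ℕ∞) f) (hg : ContDiff ℝ (⊤ : ℕ∞) g) => hf.add hg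
  zero_mem' := show ContDiff ℝ (⊤ : ℕ∞) fun _ => (0 : ℂ) from contDiff_zero_fun
  smul_mem' := fun c f (hf : ContDiff ℝ (⊤ : ℕ∞) f) => hf.const_smul c

theorem smooth_contDiff (φ : Smooth d) : ContDiff ℝ (⊤ : ℕ∞) φ.1 := φ.2

theorem smooth_differentiable (φ : Smooth d) : Differentiable ℝ φ.1 :=
  (smooth_contDiff φ).differentiable (by simp)

/-- The partial derivative `∂_i` on `C^∞(ℝ^d)`. -/
def pderiv (i : Fin d) : Module.End ℂ (Smooth d) where
  toFun φ := ⟨fun x => fderiv ℝ φ.1 x (EuclideanSpace.single i 1),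
    ((smooth_contDiff φ).fderiv_right (m := ((⊤ : ℕ∞) : WithTop ℕ∞)) (by simp)).clm_apply contDiff_const⟩
  map_add' φ ψ := by
    ext x
    simp [fderiv_add (smooth_differentiable φ x) (smooth_differentiable ψ x)]
  map_smul' c φ := by
    ext x
    simp [fderiv_const_smul (smooth_differentiable φ x) c]

/-- The derivative `∂^α = ∂_1^{α_1} ⋯ ∂_d^{α_d}` on `C^∞(ℝ^d)`. -/
def mderiv (α : Fin d → ℕ) : Module.End ℂ (Smooth d) :=
  (List.ofFn fun i => pderiv i ^ α i).prod

/-- The length `|α|` of a multi-index. -/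
def mlen (α : Fin d → ℕ) : ℕ := ∑ i, α i

/-! ### The Gelfand–Shilov space of Beurling type and the standing assumptions -/

/-- `φ` belongs to the Gelfand–Shilov space `S^{(M_p)}_{(A_p)}(ℝ^d)`. -/
def MemGelfandShilov (M A : ℕ → ℝ) (φ : Smooth d) : Prop :=
  ∀ l : ℝ, 0 < l → ∃ C : ℝ, ∀ (α : Fin d → ℕ) (x : EuclideanSpace ℝ (Fin d)),
    ‖(mderiv α φ).1 x‖ * Real.exp (assocFun A (‖x‖ / l)) / (l ^ mlen α * M (mlen α)) ≤ C

/-- The standing assumption on `M` and `ω` in the Beurling case. -/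
def BeurlingAssumption (M : ℕ → ℝ) (ω : EuclideanSpace ℝ (Fin d) → ℝ) : Prop :=
  ∃ A : ℕ → ℝ, IsWeightSequence A ∧ CondM1 A ∧ CondM2' A ∧ BeurlingAdmissible A ω ∧
    ∃ φ : Smooth d, MemGelfandShilov M A φ ∧ φ ≠ 0

/-- The standing assumption on `M` and `ω` in the Roumieu case. -/
def RoumieuAssumption (M : ℕ → ℝ) (ω : EuclideanSpace ℝ (Fin d) → ℝ) : Prop :=
  ∃ A : ℕ → ℝ, IsWeightSequence A ∧ CondM1 A ∧ CondM2' A ∧ RoumieuAdmissible A ω ∧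
    ∃ φ : Smooth d, MemGelfandShilov M A φ ∧ φ ≠ 0

/-! ### The spaces `D^{M_p, l}_{L^1_ω}` -/

/-- The norm of `L^1_ω`. -/
def l1Norm (ω : EuclideanSpace ℝ (Fin d) → ℝ) (φ : Smooth d) : ℝ := ∫ x, ‖φ.1 x‖ * ω x

/-- The smooth function `φ` belongs to `L^1_ω`. -/
def MemL1 (ω : EuclideanSpace ℝ (Fin d) → ℝ) (φ : Smooth d) : Prop :=
  Integrable fun x => ‖φ.1 x‖ * ω x

/-- A fixed pair of a weight sequence and a weight function. -/
structure Weights (d : ℕ) where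
  M : ℕ → ℝ
  isWeightSequence : IsWeightSequence M
  ω : EuclideanSpace ℝ (Fin d) → ℝ
  isWeightFunction : IsWeightFunction ω

variable (W : Weights d)

theorem MemL1.add {φ ψ : Smooth d} (hφ : MemL1 W.ω φ) (hψ : MemL1 W.ω ψ) :
    MemL1 W.ω (φ + ψ) := by
  refine Integrable.mono' (Integrable.add hφ hψ) ?_ (Eventually.of_forall fun x => ?_)
  · exact ((smooth_contDiff (φ + ψ)).continuous.norm.aestronglyMeasurable).mul
      W.isWeightFunction.aemeasurable.aestronglyMeasurable
  · have h := (W.isWeightFunction.pos x).le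
    rw [Real.norm_of_nonneg (mul_nonneg (norm_nonneg _) h)]
    calc ‖(φ + ψ).1 x‖ * W.ω x ≤ (‖φ.1 x‖ + ‖ψ.1 x‖) * W.ω x :=
          mul_le_mul_of_nonneg_right (norm_add_le _ _) h
      _ = _ := add_mul _ _ _

theorem MemL1.smul {φ : Smooth d} (c : ℂ) (hφ : MemL1 W.ω φ) : MemL1 W.ω (c • φ) := by
  have h := Integrable.const_mul hφ ‖c‖
  refine h.congr (Eventually.of_forall fun x => ?_)
  simp [mul_assoc]

theorem l1Norm_nonneg (φ : Smooth d) : 0 ≤ l1Norm W.ω φ :=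
  integral_nonneg fun x => mul_nonneg (norm_nonneg _) (W.isWeightFunction.pos x).le

theorem l1Norm_add_le {φ ψ : Smooth d} (hφ : MemL1 W.ω φ) (hψ : MemL1 W.ω ψ) :
    l1Norm W.ω (φ + ψ) ≤ l1Norm W.ω φ + l1Norm W.ω ψ := by
  unfold l1Norm
  rw [← integral_add hφ hψ]
  refine integral_mono (MemL1.add W hφ hψ) (Integrable.add hφ hψ) fun x => ?_
  have h := (W.isWeightFunction.pos x).le
  calc ‖(φ + ψ).1 x‖ * W.ω x ≤ (‖φ.1 x‖ + ‖ψ.1 x‖) * W.ω x :=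
        mul_le_mul_of_nonneg_right (norm_add_le _ _) h
    _ = _ := add_mul _ _ _

theorem l1Norm_smul (c : ℂ) (φ : Smooth d) : l1Norm W.ω (c • φ) = ‖c‖ * l1Norm W.ω φ := by
  unfold l1Norm
  rw [← integral_const_mul]
  refine integral_congr_ae (Eventually.of_forall fun x => ?_)
  simp [mul_assoc]

/-- The quotient `‖φ^{(α)}‖_{L^1_ω} / (l^{|α|} M_α)`. -/
def quot (l : ℝ) (φ : Smooth d) (α : Fin d → ℕ) : ℝ :=
  l1Norm W.ω (mderiv α φ) / (l ^ mlen α * W.M (mlen α))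

theorem den_pos {l : ℝ} (hl : 0 < l) (n : ℕ) : 0 < l ^ n * W.M n :=
  mul_pos (pow_pos hl n) (W.isWeightSequence.pos n)

theorem quot_nonneg {l : ℝ} (hl : 0 < l) (φ : Smooth d) (α : Fin d → ℕ) : 0 ≤ quot W l φ α :=
  div_nonneg (l1Norm_nonneg W _) (den_pos W hl _).le

theorem quot_add_le {l : ℝ} (hl : 0 < l) {φ ψ : Smooth d} (hφ : ∀ α, MemL1 W.ω (mderiv α φ))
    (hψ : ∀ α, MemL1 W.ω (mderiv α ψ)) (α : Fin d → ℕ) :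
    quot W l (φ + ψ) α ≤ quot W l φ α + quot W l ψ α := by
  unfold quot
  rw [← add_div, map_add]
  exact div_le_div_of_nonneg_right (l1Norm_add_le W (hφ α) (hψ α)) (den_pos W hl _).le

theorem quot_smul (l : ℝ) (c : ℂ) (φ : Smooth d) (α : Fin d → ℕ) :
    quot W l (c • φ) α = ‖c‖ * quot W l φ α := by
  unfold quot
  rw [map_smul, l1Norm_smul, mul_div_assoc]

theorem quot_anti {l l' : ℝ} (hl : 0 < l) (h : l ≤ l') (φ : Smooth d) (α : Fin d → ℕ) :
    quot W l' φ α ≤ quot W l φ α :=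
  div_le_div_of_nonneg_left (l1Norm_nonneg W _) (den_pos W hl _)
    (mul_le_mul_of_nonneg_right (pow_le_pow_left₀ hl.le h _) (W.isWeightSequence.pos _).le)

/-- The space `D^{M_p, l}_{L^1_ω}`, `l > 0`. -/
def DStep (l : {l : ℝ // 0 < l}) : Submodule ℂ (Smooth d) where
  carrier := {φ | (∀ α, MemL1 W.ω (mderiv α φ)) ∧ BddAbove (Set.range (quot W l φ))}
  zero_mem' := by
    refine ⟨fun α => ?_, 0, ?_⟩
    · simp [MemL1]
    · rintro _ ⟨α, rfl⟩
      simp [quot, l1Norm]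
  add_mem' := by
    rintro φ ψ ⟨hφ, C, hC⟩ ⟨hψ, C', hC'⟩
    refine ⟨fun α => ?_, C + C', ?_⟩
    · rw [map_add]
      exact MemL1.add W (hφ α) (hψ α)
    · rintro _ ⟨α, rfl⟩
      exact (quot_add_le W l.2 hφ hψ α).trans (add_le_add (hC ⟨α, rfl⟩) (hC' ⟨α, rfl⟩))
  smul_mem' := by
    rintro c φ ⟨hφ, C, hC⟩
    refine ⟨fun α => ?_, ‖c‖ * C, ?_⟩
    · rw [map_smul]
      exact MemL1.smul W c (hφ α)
    · rintro _ ⟨α, rfl⟩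
      rw [quot_smul]
      exact mul_le_mul_of_nonneg_left (hC ⟨α, rfl⟩) (norm_nonneg c)

theorem DStep_mono {l l' : {l : ℝ // 0 < l}} (h : l ≤ l') : DStep W l ≤ DStep W l' := by
  rintro φ ⟨hφ, C, hC⟩
  refine ⟨hφ, C, ?_⟩
  rintro _ ⟨α, rfl⟩
  exact (quot_anti W l.2 h φ α).trans (hC ⟨α, rfl⟩)

/-- The norm `sup_α ‖φ^{(α)}‖_{L^1_ω} / (l^{|α|} M_α)` of `D^{M_p, l}_{L^1_ω}`. -/
def stepNorm (l : {l : ℝ // 0 < l}) : Seminorm ℂ (DStep W l) :=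
  Seminorm.of (fun φ => ⨆ α, quot W l φ.1 α)
    (fun φ ψ => ciSup_le fun α => (quot_add_le W l.2 φ.2.1 ψ.2.1 α).trans
      (add_le_add (le_ciSup φ.2.2 α) (le_ciSup ψ.2.2 α)))
    (fun c φ => by
      rw [Real.mul_iSup_of_nonneg (norm_nonneg c)]
      exact iSup_congr fun α => quot_smul W l c φ.1 α)

/-! ### The space `D^{(M_p)}_{L^1_ω}` as a projective limit -/

instance : Nonempty {l : ℝ // 0 < l} := ⟨⟨1, one_pos⟩⟩

/-- The underlying vector space of `D^{(M_p)}_{L^1_ω}`: the intersection of the spaces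
`D^{M_p, l}_{L^1_ω}`, `l > 0`. -/
def beurlingSubmodule : Submodule ℂ (Smooth d) := ⨅ l, DStep W l

/-- The space `D^{(M_p)}_{L^1_ω}`. A separate type, so that it does not inherit the topology of
pointwise convergence. -/
def DBeurling : Type := beurlingSubmodule W

instance : AddCommGroup (DBeurling W) := inferInstanceAs (AddCommGroup (beurlingSubmodule W))

instance : Module ℂ (DBeurling W) := inferInstanceAs (Module ℂ (beurlingSubmodule W))

/-- The inclusion of `D^{(M_p)}_{L^1_ω}` into `C^∞(ℝ^d)`. -/
def DBeurling.incl : DBeurling W →ₗ[ℂ] Smooth d := (beurlingSubmodule W).subtype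

/-- The inclusion of `D^{(M_p)}_{L^1_ω}` into `D^{M_p, l}_{L^1_ω}`. -/
def DBeurling.toStep (l : {l : ℝ // 0 < l}) : DBeurling W →ₗ[ℂ] DStep W l :=
  Submodule.inclusion (iInf_le _ l)

/-- The norms of the spaces `D^{M_p, l}_{L^1_ω}`, restricted to `D^{(M_p)}_{L^1_ω}`. -/
def beurlingSeminorms : SeminormFamily ℂ (DBeurling W) {l : ℝ // 0 < l} := fun l =>
  (stepNorm W l).comp (DBeurling.toStep W l)

/-- The projective limit topology. -/
instance : TopologicalSpace (DBeurling W) := (beurlingSeminorms W).moduleFilterBasis.topology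

theorem beurling_withSeminorms : WithSeminorms (beurlingSeminorms W) := ⟨rfl⟩

instance : IsTopologicalAddGroup (DBeurling W) :=
  (beurling_withSeminorms W).topologicalAddGroup

instance : ContinuousSMul ℂ (DBeurling W) :=
  (beurling_withSeminorms W).continuousSMul

/-! ### The space `D^{{M_p}}_{L^1_ω}` as an inductive limit -/

/-- The underlying vector space of `D^{{M_p}}_{L^1_ω}`: the union of the spaces
`D^{M_p, l}_{L^1_ω}`, `l > 0`. -/
def roumieuSubmodule : Submodule ℂ (Smooth d) where
  carrier := {φ | ∃ l, φ ∈ DStep W l}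
  zero_mem' := ⟨⟨1, one_pos⟩, zero_mem _⟩
  add_mem' := by
    rintro φ ψ ⟨l, hl⟩ ⟨l', hl'⟩
    exact ⟨max l l', add_mem (DStep_mono W (le_max_left _ _) hl)
      (DStep_mono W (le_max_right _ _) hl')⟩
  smul_mem' := by
    rintro c φ ⟨l, hl⟩
    exact ⟨l, Submodule.smul_mem _ c hl⟩

/-- The space `D^{{M_p}}_{L^1_ω}`. A separate type, so that it does not inherit the topology of
pointwise convergence. -/
def DRoumieu : Type := roumieuSubmodule W

instance : AddCommGroup (DRoumieu W) := inferInstanceAs (AddCommGroup (roumieuSubmodule W))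

instance : Module ℂ (DRoumieu W) := inferInstanceAs (Module ℂ (roumieuSubmodule W))

/-- The inclusion of `D^{{M_p}}_{L^1_ω}` into `C^∞(ℝ^d)`. -/
def DRoumieu.incl : DRoumieu W →ₗ[ℂ] Smooth d := (roumieuSubmodule W).subtype

/-- The inclusion of `D^{M_p, l}_{L^1_ω}` into `D^{{M_p}}_{L^1_ω}`. -/
def DRoumieu.ofStep (l : {l : ℝ // 0 < l}) : DStep W l →ₗ[ℂ] DRoumieu W :=
  Submodule.inclusion (show DStep W l ≤ roumieuSubmodule W from fun _ h => ⟨l, h⟩)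

/-- The seminorms on `D^{{M_p}}_{L^1_ω}` whose restriction to each `D^{M_p, l}_{L^1_ω}` is
continuous with respect to the norm of that space. -/
def RoumieuSeminorm : Type :=
  {p : Seminorm ℂ (DRoumieu W) // ∀ l, ∃ C : ℝ, ∀ φ : DStep W l,
    p (DRoumieu.ofStep W l φ) ≤ C * stepNorm W l φ}

instance : Nonempty (RoumieuSeminorm W) := ⟨⟨0, fun _ => ⟨0, fun _ => by simp⟩⟩⟩

def roumieuSeminorms : SeminormFamily ℂ (DRoumieu W) (RoumieuSeminorm W) := fun p => p.1

/-- The locally convex inductive limit topology: the finest locally convex topology for which all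
the inclusions of the spaces `D^{M_p, l}_{L^1_ω}` are continuous. -/
instance : TopologicalSpace (DRoumieu W) := (roumieuSeminorms W).moduleFilterBasis.topology

theorem roumieu_withSeminorms : WithSeminorms (roumieuSeminorms W) := ⟨rfl⟩

instance : IsTopologicalAddGroup (DRoumieu W) :=
  (roumieu_withSeminorms W).topologicalAddGroup

instance : ContinuousSMul ℂ (DRoumieu W) :=
  (roumieu_withSeminorms W).continuousSMul

/-! ### Ultradistributions vanishing at infinity -/

/-- Given a topological vector space `D` with an inclusion `incl` into `C^∞(ℝ^d)`, the space of
those elements `T` of its dual that are (given by) compactly supported continuous functions `f`,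
i.e. `⟨T, φ⟩ = ∫ f φ`. -/
def compactlySupported {D : Type*} [AddCommGroup D] [Module ℂ D] [TopologicalSpace D]
    (incl : D →ₗ[ℂ] Smooth d) : Submodule ℂ (StrongDual ℂ D) where
  carrier := {T | ∃ f : EuclideanSpace ℝ (Fin d) → ℂ, Continuous f ∧ HasCompactSupport f ∧
    ∀ φ : D, T φ = ∫ x, f x * (incl φ).1 x}
  zero_mem' := ⟨0, continuous_const, HasCompactSupport.zero, fun φ => by simp⟩
  add_mem' := by
    rintro T S ⟨f, hf, hf', hT⟩ ⟨g, hg, hg', hS⟩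
    refine ⟨f + g, hf.add hg, hf'.add hg', fun φ => ?_⟩
    have hφ := (smooth_contDiff (incl φ)).continuous
    have h₁ : Integrable fun x => f x * (incl φ).1 x :=
      (hf.mul hφ).integrable_of_hasCompactSupport hf'.mul_right
    have h₂ : Integrable fun x => g x * (incl φ).1 x :=
      (hg.mul hφ).integrable_of_hasCompactSupport hg'.mul_right
    have h : (T + S) φ = T φ + S φ := rfl
    rw [h, hT, hS, ← integral_add h₁ h₂]
    simp [add_mul]
  smul_mem' := by
    rintro c T ⟨f, hf, hf', hT⟩
    refine ⟨c • f, hf.const_smul c, hf'.smul_left (f := fun _ => c), fun φ => ?_⟩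
    have h : (c • T) φ = c * T φ := rfl
    rw [h, hT, ← integral_const_mul]
    simp [mul_assoc]

/-- `Ḃ'^{(M_p)}_ω`: the closure of the compactly supported continuous functions in the strong dual
`B'^{(M_p)}_ω` of `D^{(M_p)}_{L^1_ω}`. -/
abbrev BDotBeurling : Submodule ℂ (StrongDual ℂ (DBeurling W)) :=
  (compactlySupported (DBeurling.incl W)).topologicalClosure

/-- `Ḃ'^{{M_p}}_ω`: the closure of the compactly supported continuous functions in the strong dual
`B'^{{M_p}}_ω` of `D^{{M_p}}_{L^1_ω}`. -/
abbrev BDotRoumieu : Submodule ℂ (StrongDual ℂ (DRoumieu W)) :=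
  (compactlySupported (DRoumieu.incl W)).topologicalClosure

end Ultra

end

noncomputable section

namespace Ultra

/-! ### Partial derivatives indexed by words, and the Leibniz estimate for products -/

section

variable {d : ℕ}

/-! Everything rests on the convolution operators R_k φ = φ * χ_k with χ_k(x) = (k+1)^d χ((k+1)x).
The kernel χ is |φ₀|² scaled to integral one, φ₀ being a nonzero element of the Gelfand–Shilov
space. `Regularization` records three facts about them. (a) Smoothing (`convL_smoothing`): with all
derivatives on the kernel, R_k maps L^1_ω-bounded functions boundedly into every step. (b)
Approximation (`convL_approx`): with the derivatives on φ, the error φ - R_k φ is governed by the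
first moment of χ_k, which is O(1/(k+1)), and by one further derivative of φ. Condition (M.2)' pays
for that derivative by passing from the parameter l to H l. (c) Transposition (`convL_transpose`):
the transpose of R_k sends a compactly supported f to a function whose quotient by ω vanishes at
infinity. Cutting off makes it compactly supported up to a small error, so the transposes preserve
the closure of the compactly supported functions.

Beurling case (`IsRegularized`). The Banach steps are the closures of the compactly supported
functions in the duals of D for the n-th norm. If T in the closure is continuous for the m-th norm,
then T ∘ R_k → T in the dual for the (m+1)-st norm, so T lies in a step. For the topology, let p be
a seminorm bounded by c_n times the norm on the n-th step. Write T as T ∘ R_{k_0} plus the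
telescoping sum of T ∘ (R_{k_{n+1}} - R_{k_n}), with k_n growing fast. All terms are controlled by
the values of T on a single set B ⊆ D. This B is bounded: for each seminorm the late differences are
small by (b) and the finitely many early ones are bounded by (a). So p ≤ 3 on the polar of B, and p
is continuous. Completeness comes from the first countability of D.

Roumieu case. By Banach–Steinhaus the strong dual is, topologically, the projective limit of the
Banach duals of the steps (`glueEquiv`), hence Fréchet, and the closure is a closed subspace. For
quasinormability split T into its regularization and the rest. If T is in the unit ball of the dual
of step n+1, the regularizations fill a bounded set for fixed k, while the rest is O(1/(k+1)) in the
dual norm of step n. -/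

theorem pderiv_apply (i : Fin d) (φ : Smooth d) (x : EuclideanSpace ℝ (Fin d)) :
    (pderiv i φ).1 x = fderiv ℝ φ.1 x (EuclideanSpace.single i 1) := rfl

theorem pderiv_comm (i j : Fin d) (φ : Smooth d) :
    pderiv i (pderiv j φ) = pderiv j (pderiv i φ) := by
  apply Subtype.ext
  funext x
  have h2 : ∀ v w : EuclideanSpace ℝ (Fin d),
      fderiv ℝ (fun y => fderiv ℝ φ.1 y v) x w = fderiv ℝ (fderiv ℝ φ.1) x w v := by
    intro v w
    have hd : DifferentiableAt ℝ (fderiv ℝ φ.1) x :=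
      (((smooth_contDiff φ).fderiv_right (m := 1) (by norm_cast)).differentiable (by simp)) x
    rw [fderiv_clm_apply hd (by fun_prop)]
    simp
  have hs : IsSymmSndFDerivAt ℝ φ.1 x :=
    (smooth_contDiff φ).contDiffAt.isSymmSndFDerivAt (by
      rw [minSmoothness_of_isRCLikeNormedField]
      exact WithTop.coe_le_coe.2 (le_top : (2 : ℕ∞) ≤ ⊤))
  change fderiv ℝ (fun y => fderiv ℝ φ.1 y _) x _ = fderiv ℝ (fun y => fderiv ℝ φ.1 y _) x _
  rw [h2, h2]
  exact hs _ _

/-- A multi-index derivative is a product in a fixed order. Commutativity lets a new factor migrate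
from its slot to the front. -/
theorem prod_ofFn_pow_add_single {R : Type*} [Monoid R] :
    ∀ {n : ℕ} (f : Fin n → R) (_ : ∀ i j, Commute (f i) (f j)) (α : Fin n → ℕ) (j : Fin n),
    (List.ofFn fun i => f i ^ (α + (Pi.single j 1 : Fin n → ℕ)) i).prod
      = f j * (List.ofFn fun i => f i ^ α i).prod := by
  intro n
  induction n with
  | zero => intro f _ α j; exact j.elim0
  | succ n ih =>
    intro f hf α j
    simp only [List.ofFn_succ, List.prod_cons]
    refine Fin.cases ?_ (fun k => ?_) j
    · simp [pow_succ', mul_assoc, Fin.succ_ne_zero]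
    · have h := ih (fun i => f i.succ) (fun i j => hf _ _) (fun i => α i.succ) k
      have e : (fun i : Fin n => f i.succ ^ (α + (Pi.single k.succ 1 : Fin (n + 1) → ℕ)) i.succ)
          = fun i : Fin n => f i.succ ^ ((fun i : Fin n => α i.succ) + (Pi.single k 1 : Fin n → ℕ)) i := by
        funext i
        simp [Pi.single_apply, Fin.succ_inj]
      have e0 : (α + (Pi.single k.succ 1 : Fin (n + 1) → ℕ)) 0 = α 0 := by
        simp [(Fin.succ_ne_zero k).symm]
      rw [e, h, e0, ← mul_assoc, ← mul_assoc, ((hf 0 k.succ).pow_left (α 0)).eq]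

/-- Iterated partial derivative along a list of directions. -/
def dl (u : List (Fin d)) : Module.End ℂ (Smooth d) := (u.map pderiv).prod

@[simp] theorem dl_nil (φ : Smooth d) : dl [] φ = φ := rfl

theorem dl_cons (i : Fin d) (u : List (Fin d)) (φ : Smooth d) :
    dl (i :: u) φ = pderiv i (dl u φ) := by
  simp [dl]

theorem dl_append (u w : List (Fin d)) (φ : Smooth d) : dl (u ++ w) φ = dl u (dl w φ) := by
  simp [dl]

theorem dl_concat (i : Fin d) (u : List (Fin d)) (φ : Smooth d) :
    dl (u ++ [i]) φ = dl u (pderiv i φ) := by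
  simp [dl]

/-- Together with `exists_mderiv_eq_dl` this trades multi-indices for words of the same length, so
that estimates can be proved by peeling off one derivative at a time. -/
theorem exists_dl_eq_mderiv (α : Fin d → ℕ) :
    ∃ u : List (Fin d), u.length = mlen α ∧ ∀ φ : Smooth d, mderiv α φ = dl u φ := by
  refine ⟨(List.ofFn fun i => List.replicate (α i) i).flatten, ?_, fun φ => ?_⟩
  · simp [mlen, List.length_flatten, List.sum_ofFn, List.map_ofFn, Function.comp_def]
  · simp [mderiv, dl, List.map_flatten, List.prod_flatten, List.map_ofFn, Function.comp_def]

theorem mderiv_add_single (α : Fin d → ℕ) (i : Fin d) (φ : Smooth d) :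
    mderiv (α + Pi.single i 1) φ = pderiv i (mderiv α φ) := by
  have h := prod_ofFn_pow_add_single (fun i : Fin d => pderiv i)
    (fun i j => LinearMap.ext fun φ => pderiv_comm i j φ) α i
  exact congrArg (fun T : Module.End ℂ (Smooth d) => T φ) h

theorem mlen_add_single (α : Fin d → ℕ) (i : Fin d) : mlen (α + Pi.single i 1) = mlen α + 1 := by
  simp [mlen, Finset.sum_add_distrib]

theorem mderiv_zero (φ : Smooth d) : mderiv 0 φ = φ := by
  simp [mderiv]

theorem mlen_zero : mlen (0 : Fin d → ℕ) = 0 := by simp [mlen]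

theorem exists_mderiv_eq_dl (u : List (Fin d)) :
    ∃ α : Fin d → ℕ, mlen α = u.length ∧ ∀ φ : Smooth d, mderiv α φ = dl u φ := by
  induction u with
  | nil => exact ⟨0, mlen_zero, mderiv_zero⟩
  | cons i u ih =>
    obtain ⟨α, h1, h2⟩ := ih
    exact ⟨α + Pi.single i 1, by simp [mlen_add_single, h1],
      fun φ => by rw [mderiv_add_single, h2, dl_cons]⟩

/-! ### Weight sequences -/

/-- By log-convexity the quotients M (p+1) / M p increase, so m consecutive quotients starting at k
dominate those starting at 0. -/
theorem mul_le_of_condM1 {M : ℕ → ℝ} (hM : ∀ p, 0 < M p) (h1 : CondM1 M) (m k : ℕ) :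
    M m * M k ≤ M 0 * M (m + k) := by
  have hr : Monotone fun p => M (p + 1) / M p := by
    refine monotone_nat_of_le_succ fun p => ?_
    rw [div_le_div_iff₀ (hM _) (hM _)]
    have := h1 (p + 1) (by omega)
    simp only [Nat.add_sub_cancel] at this
    nlinarith
  induction m with
  | zero => simp
  | succ m ih =>
    have h := hr (show m ≤ m + k by omega)
    simp only at h
    have e1 : M (m + 1) = M (m + 1) / M m * M m := by field_simp [(hM m).ne']
    have e2 : M (m + 1 + k) = M (m + k + 1) / M (m + k) * M (m + k) := by
      rw [div_mul_cancel₀ _ (hM _).ne']; congr 1; omega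
    rw [e1, e2]
    have hp : 0 < M (m + 1) / M m := div_pos (hM _) (hM _)
    calc M (m + 1) / M m * M m * M k = M (m + 1) / M m * (M m * M k) := by ring
      _ ≤ M (m + k + 1) / M (m + k) * (M 0 * M (m + k)) :=
          mul_le_mul h ih (mul_pos (hM _) (hM _)).le (hp.le.trans h)
      _ = _ := by ring

/-! ### Products and conjugates of smooth functions -/

/-- The pointwise product. -/
def smul' (φ ψ : Smooth d) : Smooth d :=
  ⟨fun x => φ.1 x * ψ.1 x, (smooth_contDiff φ).mul (smooth_contDiff ψ)⟩

theorem pderiv_smul' (i : Fin d) (φ ψ : Smooth d) :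
    pderiv i (smul' φ ψ) = smul' (pderiv i φ) ψ + smul' φ (pderiv i ψ) := by
  apply Subtype.ext
  funext x
  change fderiv ℝ (fun y => φ.1 y * ψ.1 y) x _ = fderiv ℝ φ.1 x _ * ψ.1 x + φ.1 x * fderiv ℝ ψ.1 x _
  rw [fderiv_fun_mul (smooth_differentiable φ x) (smooth_differentiable ψ x)]
  simp
  ring

/-- The complex conjugate. -/
def conj' (φ : Smooth d) : Smooth d :=
  ⟨fun x => Complex.conjCLE (φ.1 x), Complex.conjCLE.contDiff.comp (smooth_contDiff φ)⟩

theorem pderiv_conj' (i : Fin d) (φ : Smooth d) : pderiv i (conj' φ) = conj' (pderiv i φ) := by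
  apply Subtype.ext
  funext x
  change fderiv ℝ (Complex.conjCLE ∘ φ.1) x _ = Complex.conjCLE (fderiv ℝ φ.1 x _)
  rw [ContinuousLinearEquiv.comp_fderiv]
  rfl

theorem dl_conj' (u : List (Fin d)) (φ : Smooth d) : dl u (conj' φ) = conj' (dl u φ) := by
  induction u with
  | nil => rfl
  | cons i u ih => rw [dl_cons, ih, pderiv_conj', dl_cons]

theorem norm_conj' (φ : Smooth d) (x : EuclideanSpace ℝ (Fin d)) :
    ‖(conj' φ).1 x‖ = ‖φ.1 x‖ := by
  simp [conj']

/-- Leibniz rule without binomial coefficients: each derivative falls on one of the two factors,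
which doubles the number of terms. The shifts m and k count the derivatives already received by each
factor, and removing the innermost derivative first keeps the hypotheses in the same form. -/
theorem norm_dl_smul'_le {M : ℕ → ℝ} (hM : ∀ p, 0 < M p) (h1 : CondM1 M) {a b h : ℝ}
    (ha : 0 ≤ a) (hb : 0 ≤ b) (hh : 0 ≤ h) (x : EuclideanSpace ℝ (Fin d)) (w : List (Fin d)) :
    ∀ (φ ψ : Smooth d) (m k : ℕ),
    (∀ u, ‖(dl u φ).1 x‖ ≤ a * (h ^ (u.length + m) * M (u.length + m))) →
    (∀ u, ‖(dl u ψ).1 x‖ ≤ b * (h ^ (u.length + k) * M (u.length + k))) →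
    ‖(dl w (smul' φ ψ)).1 x‖ ≤ a * b * M 0 * 2 ^ w.length *
      (h ^ (w.length + m + k) * M (w.length + m + k)) := by
  induction w using List.reverseRecOn with
  | nil =>
    intro φ ψ m k hφ hψ
    have h1' := hφ []
    have h2' := hψ []
    simp only [dl_nil, List.length_nil, zero_add, pow_zero, mul_one] at h1' h2' ⊢
    calc ‖φ.1 x * ψ.1 x‖ = ‖φ.1 x‖ * ‖ψ.1 x‖ := norm_mul _ _
      _ ≤ (a * (h ^ m * M m)) * (b * (h ^ k * M k)) :=
        mul_le_mul h1' h2' (norm_nonneg _)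
          (mul_nonneg ha (mul_nonneg (pow_nonneg hh _) (hM _).le))
      _ = a * b * h ^ (m + k) * (M m * M k) := by rw [pow_add]; ring
      _ ≤ a * b * h ^ (m + k) * (M 0 * M (m + k)) :=
        mul_le_mul_of_nonneg_left (mul_le_of_condM1 hM h1 m k)
          (mul_nonneg (mul_nonneg ha hb) (pow_nonneg hh _))
      _ = _ := by ring
  | append_singleton w i ih =>
    intro φ ψ m k hφ hψ
    rw [dl_concat, pderiv_smul', map_add]
    have e1 := ih (pderiv i φ) ψ (m + 1) k (fun u => by
      have := hφ (u ++ [i])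
      rw [dl_concat] at this
      simpa [add_assoc, add_comm, add_left_comm] using this) hψ
    have e2 := ih φ (pderiv i ψ) m (k + 1) hφ (fun u => by
      have := hψ (u ++ [i])
      rw [dl_concat] at this
      simpa [add_assoc, add_comm, add_left_comm] using this)
    have e3 : w.length + (m + 1) + k = (w ++ [i]).length + m + k := by simp; omega
    have e4 : w.length + m + (k + 1) = (w ++ [i]).length + m + k := by simp; omega
    rw [e3] at e1
    rw [e4] at e2
    have e5 : (2 : ℝ) ^ (w ++ [i]).length = 2 * 2 ^ w.length := by simp [pow_succ, mul_comm]
    rw [e5]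
    refine (norm_add_le _ _).trans ((add_le_add e1 e2).trans (le_of_eq ?_))
    ring

end

/-! ### A fast decaying ultradifferentiable kernel and its dilations -/

section

variable {d : ℕ}

/-! ### The associated function -/

/-- Once A (p+1) / A p ≥ t the terms no longer increase, so only finitely many of them matter. Real
suprema are meaningful only with this bound. -/
theorem bddAbove_assocFun {A : ℕ → ℝ} (hA : IsWeightSequence A) {t : ℝ} (ht : 0 < t) :
    BddAbove (Set.range fun p : ℕ => Real.log (t ^ p * A 0 / A p)) := by
  obtain ⟨N, hN⟩ := (hA.tendsto.eventually_ge_atTop t).exists_forall_of_atTop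
  have hpos : ∀ p, 0 < t ^ p * A 0 / A p := fun p =>
    div_pos (mul_pos (pow_pos ht p) (hA.pos 0)) (hA.pos p)
  have hstep : ∀ k, t ^ (N + k) * A 0 / A (N + k) ≤ t ^ N * A 0 / A N := by
    intro k
    induction k with
    | zero => simp
    | succ k ih =>
      refine le_trans ?_ ih
      have h := hN (N + k) (by omega)
      rw [le_div_iff₀ (hA.pos _)] at h
      rw [div_le_div_iff₀ (hA.pos _) (hA.pos _)]
      have h0 : 0 ≤ t ^ (N + k) * A 0 := (mul_pos (pow_pos ht _) (hA.pos 0)).le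
      calc t ^ (N + (k + 1)) * A 0 * A (N + k) = t ^ (N + k) * A 0 * (t * A (N + k)) := by
            rw [← add_assoc, pow_succ]; ring
        _ ≤ _ := mul_le_mul_of_nonneg_left h h0
  have hfin := (Finset.range (N + 1)).image (fun p : ℕ => Real.log (t ^ p * A 0 / A p))
    |>.bddAbove
  obtain ⟨C, hC⟩ := hfin
  refine ⟨C, ?_⟩
  rintro _ ⟨p, rfl⟩
  rcases le_total p N with h | h
  · exact hC (Finset.mem_coe.2 (Finset.mem_image.2 ⟨p, by simp; omega, rfl⟩))
  · obtain ⟨k, rfl⟩ := Nat.exists_eq_add_of_le h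
    exact (Real.log_le_log (hpos _) (hstep k)).trans
      (hC (Finset.mem_coe.2 (Finset.mem_image.2 ⟨N, by simp, rfl⟩)))

theorem assocFun_nonneg {A : ℕ → ℝ} (hA : IsWeightSequence A) (t : ℝ) : 0 ≤ assocFun A t := by
  unfold assocFun
  split_ifs with ht
  · refine le_trans (le_of_eq ?_) (le_ciSup (bddAbove_assocFun hA ht) 0)
    simp [(hA.pos 0).ne']
  · exact le_rfl

theorem assocFun_mono {A : ℕ → ℝ} (hA : IsWeightSequence A) : Monotone (assocFun A) := by
  intro s t hst
  by_cases hs : 0 < s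
  · have ht := hs.trans_le hst
    unfold assocFun
    rw [if_pos hs, if_pos ht]
    refine ciSup_mono (bddAbove_assocFun hA ht) fun p => ?_
    have := hA.pos 0
    have := hA.pos p
    refine Real.log_le_log (by positivity) ?_
    gcongr
  · have : assocFun A s = 0 := if_neg hs
    rw [this]
    exact assocFun_nonneg hA t

/-- The extra factor t moves the p-th term of the supremum to the (p+1)-st, and (M.2)' compares A p
with A (p+1) at the price of dilating the argument by H. -/
theorem mul_exp_assocFun_le {A : ℕ → ℝ} (hA : IsWeightSequence A) (h2 : CondM2' A) :
    ∃ C H : ℝ, 1 ≤ C ∧ 1 ≤ H ∧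
      ∀ t, 0 ≤ t → t * Real.exp (assocFun A t) ≤ C * Real.exp (assocFun A (H * t)) := by
  obtain ⟨C, H, hC, hH, h⟩ := h2
  have hC0 : 0 < C := by linarith
  refine ⟨C, H, hC, hH, fun t ht => ?_⟩
  rcases ht.eq_or_lt with rfl | ht
  · rw [zero_mul]; positivity
  have hHt : 0 < H * t := by positivity
  have key : assocFun A t ≤ Real.log C - Real.log t + assocFun A (H * t) := by
    unfold assocFun
    rw [if_pos ht, if_pos hHt]
    refine ciSup_le fun p => ?_
    have e := le_ciSup (bddAbove_assocFun hA hHt) (p + 1)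
    refine le_trans ?_ (add_le_add_right e _)
    have h0 := hA.pos 0
    have hp := hA.pos p
    have hp1 := hA.pos (p + 1)
    rw [← Real.log_div hC0.ne' ht.ne', ← Real.log_mul (by positivity) (by positivity)]
    refine Real.log_le_log (by positivity) ?_
    rw [div_mul_div_comm, div_le_div_iff₀ hp (by positivity)]
    -- The exponent is raised to match t ^ (p + 1), so that the two powers combine into (H t) ^ (p +
    -- 1).
    have hHp : H ^ p ≤ H ^ (p + 1) := pow_le_pow_right₀ hH (by omega)
    calc t ^ p * A 0 * (t * A (p + 1)) ≤ t ^ p * A 0 * (t * (C * H ^ (p + 1) * A p)) := by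
          gcongr
          exact (h p).trans (by gcongr)
      _ = _ := by rw [mul_pow, pow_succ t]; ring
  calc t * Real.exp (assocFun A t)
      ≤ t * Real.exp (Real.log C - Real.log t + assocFun A (H * t)) := by gcongr
    _ = _ := by
      rw [Real.exp_add, Real.exp_sub, Real.exp_log hC0, Real.exp_log ht]
      field_simp

theorem pow_mul_exp_assocFun_le {A : ℕ → ℝ} (hA : IsWeightSequence A) (h2 : CondM2' A) (n : ℕ) :
    ∃ C H : ℝ, 1 ≤ C ∧ 1 ≤ H ∧
      ∀ t, 0 ≤ t → (1 + t) ^ n * Real.exp (assocFun A t) ≤ C * Real.exp (assocFun A (H * t)) := by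
  induction n with
  | zero => exact ⟨1, 1, le_rfl, le_rfl, fun t _ => by simp⟩
  | succ n ih =>
    obtain ⟨C, H, hC, hH, h⟩ := ih
    obtain ⟨C', H', hC', hH', h'⟩ := mul_exp_assocFun_le hA h2
    refine ⟨C * (1 + C'), H' * H, by nlinarith, by nlinarith, fun t ht => ?_⟩
    have hHt : t ≤ H * t := le_mul_of_one_le_left ht hH
    have h1 : Real.exp (assocFun A (H * t)) ≤ Real.exp (assocFun A (H' * H * t)) :=
      Real.exp_le_exp.2 (assocFun_mono hA (by
        rw [mul_assoc]; exact le_mul_of_one_le_left (ht.trans hHt) hH'))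
    have h2 := h' (H * t) (ht.trans hHt)
    rw [← mul_assoc] at h2
    have h3 := mul_le_mul_of_nonneg_right hHt (Real.exp_pos (assocFun A (H * t))).le
    calc (1 + t) ^ (n + 1) * Real.exp (assocFun A t)
        = (1 + t) * ((1 + t) ^ n * Real.exp (assocFun A t)) := by ring
      _ ≤ (1 + t) * (C * Real.exp (assocFun A (H * t))) :=
          mul_le_mul_of_nonneg_left (h t ht) (by linarith)
      _ = C * (Real.exp (assocFun A (H * t)) + t * Real.exp (assocFun A (H * t))) := by ring
      _ ≤ C * (Real.exp (assocFun A (H' * H * t)) + C' * Real.exp (assocFun A (H' * H * t))) := by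
          refine mul_le_mul_of_nonneg_left (add_le_add h1 (h3.trans h2)) (by linarith)
      _ = _ := by ring

/-! ### Moderate weight functions and kernels -/

/-- `ω` is moderate with respect to the radially increasing function `v`. -/
structure IsModerate (ω v : EuclideanSpace ℝ (Fin d) → ℝ) : Prop where
  mono : ∀ s t, ‖s‖ ≤ ‖t‖ → v s ≤ v t
  le : ∀ x t, ω (x + t) ≤ ω x * v t
  measurable : Measurable v
  one_le : ∀ t, 1 ≤ v t

/-- Smooth functions with derivatives of a fast decay relative to `v`. -/
def IsKernel (v : EuclideanSpace ℝ (Fin d) → ℝ) (χ : Smooth d) : Prop :=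
  ∀ u, ∃ C, ∀ s, ‖(dl u χ).1 s‖ * (v s * (1 + ‖s‖) ^ (d + 2)) ≤ C

/-- Ultradifferentiable kernels. -/
def IsUltraKernel (M : ℕ → ℝ) (v : EuclideanSpace ℝ (Fin d) → ℝ) (χ : Smooth d) : Prop :=
  ∀ l : ℝ, 0 < l → ∃ C, 0 ≤ C ∧ ∀ u s,
    ‖(dl u χ).1 s‖ * (v s * (1 + ‖s‖) ^ (d + 2)) ≤ C * (l ^ u.length * M u.length)

theorem IsUltraKernel.isKernel {M : ℕ → ℝ} {v : EuclideanSpace ℝ (Fin d) → ℝ} {χ : Smooth d}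
    (h : IsUltraKernel M v χ) : IsKernel v χ := fun u => by
  obtain ⟨C, -, hC⟩ := h 1 one_pos
  exact ⟨_, hC u⟩

theorem IsKernel.pderiv {v : EuclideanSpace ℝ (Fin d) → ℝ} {χ : Smooth d}
    (h : IsKernel v χ) (i : Fin d) : IsKernel v (pderiv i χ) := fun u => by
  obtain ⟨C, hC⟩ := h (u ++ [i])
  exact ⟨C, fun s => by simpa [dl_concat] using hC s⟩

theorem IsKernel.dl {v : EuclideanSpace ℝ (Fin d) → ℝ} {χ : Smooth d}
    (h : IsKernel v χ) (w : List (Fin d)) : IsKernel v (dl w χ) := fun u => by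
  obtain ⟨C, hC⟩ := h (u ++ w)
  exact ⟨C, fun s => by simpa [dl_append] using hC s⟩

theorem integrable_one_add_norm_pow :
    Integrable fun s : EuclideanSpace ℝ (Fin d) => ((1 + ‖s‖) ^ (d + 1))⁻¹ := by
  have h := integrable_one_add_norm (E := EuclideanSpace ℝ (Fin d)) (μ := volume)
    (r := ((d + 1 : ℕ) : ℝ)) (by simp)
  refine h.congr (Eventually.of_forall fun s => ?_)
  have : 0 ≤ 1 + ‖s‖ := by positivity
  simp only
  rw [Real.rpow_neg this, Real.rpow_natCast]

variable {ω v : EuclideanSpace ℝ (Fin d) → ℝ} {χ : Smooth d}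

theorem IsKernel.norm_le (hv : IsModerate ω v) (h : IsKernel v χ) :
    ∃ C, 0 ≤ C ∧ ∀ s, ‖χ.1 s‖ * v s * (1 + ‖s‖) ^ (d + 2) ≤ C := by
  obtain ⟨C, hC⟩ := h []
  refine ⟨C, le_trans ?_ (hC 0), fun s => by rw [mul_assoc]; exact hC s⟩
  have := hv.one_le 0
  positivity

/-- Of the d + 2 powers in the decay, d + 1 secure integrability and one is left over for first
moments. -/
theorem integrable_of_decay (hv : IsModerate ω v) {f : EuclideanSpace ℝ (Fin d) → ℂ}
    (hf : Continuous f) {C : ℝ} (hC : ∀ s, ‖f s‖ * (v s * (1 + ‖s‖) ^ (d + 2)) ≤ C) :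
    Integrable (fun s => ‖f s‖ * (1 + ‖s‖) * v s) ∧
      ∫ s, ‖f s‖ * (1 + ‖s‖) * v s ≤
        C * ∫ s : EuclideanSpace ℝ (Fin d), ((1 + ‖s‖) ^ (d + 1))⁻¹ := by
  have hb : ∀ s, ‖f s‖ * (1 + ‖s‖) * v s ≤ C * ((1 + ‖s‖) ^ (d + 1))⁻¹ := fun s => by
    have h1 : 0 < 1 + ‖s‖ := by positivity
    rw [← div_eq_mul_inv, le_div_iff₀ (by positivity)]
    refine le_trans (le_of_eq ?_) (hC s)
    ring
  have h0 : ∀ s, 0 ≤ ‖f s‖ * (1 + ‖s‖) * v s := fun s => by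
    have := hv.one_le s
    positivity
  have hi : Integrable (fun s => ‖f s‖ * (1 + ‖s‖) * v s) := by
    refine Integrable.mono' (integrable_one_add_norm_pow.const_mul C) ?_
      (Eventually.of_forall fun s => ?_)
    · exact (by fun_prop : Continuous fun s => ‖f s‖ * (1 + ‖s‖)).aestronglyMeasurable.mul
        hv.measurable.aestronglyMeasurable
    · rw [Real.norm_of_nonneg (h0 s)]
      exact hb s
  refine ⟨hi, ?_⟩
  rw [← integral_const_mul]
  exact integral_mono hi (integrable_one_add_norm_pow.const_mul C) hb

theorem IsKernel.integrable (hv : IsModerate ω v) (h : IsKernel v χ) : Integrable χ.1 := by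
  obtain ⟨C, hC⟩ := h []
  refine Integrable.mono' (integrable_of_decay hv (smooth_contDiff χ).continuous hC).1
    (smooth_contDiff χ).continuous.aestronglyMeasurable (Eventually.of_forall fun s => ?_)
  have h1 := hv.one_le s
  have h2 : 1 ≤ 1 + ‖s‖ := by simp
  rw [mul_assoc]
  exact le_mul_of_one_le_right (norm_nonneg _) (one_le_mul_of_one_le_of_one_le h2 h1)

theorem isModerate_of_admissible {A : ℕ → ℝ} (hA : IsWeightSequence A) (hω : ∀ x, 0 < ω x)
    {l C : ℝ} (hl : 0 < l) (hC : 0 < C)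
    (hadm : ∀ x t, ω (x + t) ≤ C * ω x * Real.exp (assocFun A (l * ‖t‖))) :
    IsModerate ω fun t => C * Real.exp (assocFun A (l * ‖t‖)) := by
  have hmono := assocFun_mono hA
  -- Take x = t = 0 in the admissibility inequality; the associated function vanishes at 0 by
  -- convention.
  have hC1 : 1 ≤ C := by
    have := hadm 0 0
    simp only [add_zero, norm_zero, mul_zero] at this
    rw [show assocFun A 0 = 0 from if_neg (lt_irrefl _), Real.exp_zero, mul_one] at this
    exact le_of_mul_le_mul_right (by simpa using this) (hω 0)
  refine ⟨fun s t hst => ?_, fun x t => ?_, ?_, fun t => ?_⟩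
  · have := hmono (mul_le_mul_of_nonneg_left hst hl.le)
    gcongr
  · exact (hadm x t).trans (le_of_eq (by ring))
  · exact ((hmono.measurable.comp (measurable_norm.const_mul l)).exp).const_mul C
  · exact one_le_mul_of_one_le_of_one_le hC1 (Real.one_le_exp (assocFun_nonneg hA _))

theorem exists_weight_le {A : ℕ → ℝ} (hA : IsWeightSequence A) (h2 : CondM2' A) {l : ℝ}
    (hl : 0 < l) (n : ℕ) :
    ∃ C L : ℝ, 0 < C ∧ 0 < L ∧ ∀ r, 0 ≤ r →
      Real.exp (assocFun A (l * r)) * (1 + r) ^ n ≤ C * Real.exp (assocFun A (r * L)) := by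
  obtain ⟨C, H, hC, hH, h⟩ := pow_mul_exp_assocFun_le hA h2 n
  have hl1 : 0 < max l 1 := lt_max_of_lt_left hl
  refine ⟨C, H * max l 1, by linarith, by positivity, fun r hr => ?_⟩
  have hr1 : r ≤ max l 1 * r := le_mul_of_one_le_left hr (le_max_right _ _)
  have h3 : Real.exp (assocFun A (l * r)) ≤ Real.exp (assocFun A (max l 1 * r)) :=
    Real.exp_le_exp.2 (assocFun_mono hA (mul_le_mul_of_nonneg_right (le_max_left _ _) hr))
  calc Real.exp (assocFun A (l * r)) * (1 + r) ^ n
      ≤ Real.exp (assocFun A (max l 1 * r)) * (1 + max l 1 * r) ^ n := by gcongr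
    _ = (1 + max l 1 * r) ^ n * Real.exp (assocFun A (max l 1 * r)) := mul_comm _ _
    _ ≤ _ := h _ (by positivity)
    _ = _ := by congr 3; ring

/-- The factor φ supplies the decay, while for its conjugate mere boundedness of the scaled
derivatives suffices. -/
theorem isUltraKernel_smul' {M A : ℕ → ℝ} (hM : IsWeightSequence M) (h1 : CondM1 M)
    (hA : IsWeightSequence A) (h2 : CondM2' A) {l C : ℝ} (hl : 0 < l) (hC : 0 < C) {φ : Smooth d}
    (hφ : MemGelfandShilov M A φ) :
    IsUltraKernel M (fun t => C * Real.exp (assocFun A (l * ‖t‖))) (smul' φ (conj' φ)) := by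
  intro r hr
  obtain ⟨K, L, hK, hL, hKL⟩ := exists_weight_le hA h2 hl (d + 2)
  -- The bound 2h ≤ r absorbs the Leibniz factor 2^|u|; the bound L ≤ 1/h makes the decay of φ beat
  -- v and the polynomial weight.
  obtain ⟨h, hh, hhr, hhL⟩ : ∃ h, 0 < h ∧ 2 * h ≤ r ∧ L ≤ h⁻¹ := by
    refine ⟨min (r / 2) L⁻¹, by positivity, ?_, ?_⟩
    · have := min_le_left (r / 2) L⁻¹
      linarith
    · exact (le_inv_comm₀ hL (by positivity)).2 (min_le_right _ _)
  obtain ⟨N, hN⟩ := hφ h hh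
  have hM0 := hM.pos
  have hN0 : 0 ≤ N := le_trans (by have := hM0 (mlen (0 : Fin d → ℕ)); positivity) (hN 0 0)
  have hφ' : ∀ (x : EuclideanSpace ℝ (Fin d)) u, ‖(dl u φ).1 x‖ ≤
      N * (Real.exp (assocFun A (‖x‖ / h)))⁻¹ * (h ^ (u.length + 0) * M (u.length + 0)) := by
    intro x u
    obtain ⟨α, hα, hαu⟩ := exists_mderiv_eq_dl u
    have := hN α x
    rw [hα, hαu] at this
    have hp := hM0 u.length
    rw [div_le_iff₀ (by positivity)] at this
    rw [add_zero, mul_right_comm, ← div_eq_mul_inv, le_div_iff₀ (Real.exp_pos _)]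
    exact this
  have hφ'' : ∀ (x : EuclideanSpace ℝ (Fin d)) u, ‖(dl u (conj' φ)).1 x‖ ≤
      N * (h ^ (u.length + 0) * M (u.length + 0)) := by
    intro x u
    rw [dl_conj', norm_conj']
    refine (hφ' x u).trans (mul_le_mul_of_nonneg_right ?_ ?_)
    · exact mul_le_of_le_one_right hN0
        (inv_le_one_of_one_le₀ (Real.one_le_exp (assocFun_nonneg hA _)))
    · have := hM0 (u.length + 0)
      positivity
  have hM00 := hM0 0
  refine ⟨N * N * M 0 * (C * K), by positivity, fun u s => ?_⟩
  have hMu := hM0 u.length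
  have key := norm_dl_smul'_le hM0 h1 (by positivity) hN0 hh.le s u φ (conj' φ) 0 0 (hφ' s) (hφ'' s)
  simp only [add_zero] at key
  have hE : Real.exp (assocFun A (‖s‖ * L)) ≤ Real.exp (assocFun A (‖s‖ / h)) :=
    Real.exp_le_exp.2 (assocFun_mono hA (by
      rw [div_eq_mul_inv]; exact mul_le_mul_of_nonneg_left hhL (norm_nonneg _)))
  have hw : C * Real.exp (assocFun A (l * ‖s‖)) * (1 + ‖s‖) ^ (d + 2)
      ≤ C * K * Real.exp (assocFun A (‖s‖ / h)) := by
    rw [mul_assoc, mul_assoc]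
    refine mul_le_mul_of_nonneg_left ((hKL _ (norm_nonneg _)).trans ?_) hC.le
    gcongr
  calc _ ≤ N * (Real.exp (assocFun A (‖s‖ / h)))⁻¹ * N * M 0 * 2 ^ u.length *
          (h ^ u.length * M u.length) * (C * K * Real.exp (assocFun A (‖s‖ / h))) :=
        mul_le_mul key hw (by positivity) (by positivity)
    _ = N * N * M 0 * (C * K) * ((2 * h) ^ u.length * M u.length) := by
        have := Real.exp_pos (assocFun A (‖s‖ / h))
        rw [mul_pow]
        field_simp
    _ ≤ _ := by gcongr

theorem IsUltraKernel.smul {M : ℕ → ℝ} (h : IsUltraKernel M v χ) (c : ℂ) :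
    IsUltraKernel M v (c • χ) := by
  intro l hl
  obtain ⟨C, hC, h⟩ := h l hl
  refine ⟨‖c‖ * C, by positivity, fun u s => ?_⟩
  have e : (dl u (c • χ)).1 s = c * (dl u χ).1 s := by rw [map_smul]; rfl
  rw [e, norm_mul, mul_assoc, mul_assoc]
  exact mul_le_mul_of_nonneg_left (h u s) (norm_nonneg _)

/-- The integral of φ itself may vanish, whereas that of φ times its conjugate is ∫|φ|² > 0 and can
be normalized. -/
theorem exists_ultraKernel {M : ℕ → ℝ} (hM : IsWeightSequence M) (h1 : CondM1 M)
    (hω : ∀ x, 0 < ω x) (h : BeurlingAssumption M ω) :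
    ∃ v : EuclideanSpace ℝ (Fin d) → ℝ, IsModerate ω v ∧
      ∃ χ : Smooth d, IsUltraKernel M v χ ∧ ∫ s, χ.1 s = 1 := by
  obtain ⟨A, hA, -, hA2, ⟨l, hl, C, hC, hadm⟩, φ, hφ, hφ0⟩ := h
  have hv := isModerate_of_admissible hA hω hl hC hadm
  have hk := isUltraKernel_smul' hM h1 hA hA2 hl hC hφ
  refine ⟨_, hv, (∫ s, (smul' φ (conj' φ)).1 s)⁻¹ • smul' φ (conj' φ), hk.smul _, ?_⟩
  have e : ∀ c : ℂ, ∫ s, (c • smul' φ (conj' φ)).1 s = c * ∫ s, (smul' φ (conj' φ)).1 s :=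
    fun c => integral_const_mul c _
  rw [e]
  refine inv_mul_cancel₀ ?_
  have hc := (smooth_contDiff φ).continuous
  have e2 : ∀ s, (smul' φ (conj' φ)).1 s = ((‖φ.1 s‖ ^ 2 : ℝ) : ℂ) := fun s => by
    simp [smul', conj', Complex.mul_conj, Complex.normSq_eq_norm_sq]
  have hi : Integrable fun s => ‖φ.1 s‖ ^ 2 := by
    refine (hk.isKernel.integrable hv).norm.congr (Eventually.of_forall fun s => ?_)
    simp [e2]
  simp_rw [e2]
  rw [integral_complex_ofReal, Complex.ofReal_ne_zero]
  refine ne_of_gt ((integral_pos_iff_support_of_nonneg (fun s => by positivity) hi).2 ?_)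
  refine IsOpen.measure_pos _ (hc.norm.pow 2).isOpen_support ?_
  rw [Function.support_nonempty_iff]
  intro h0
  refine hφ0 (Subtype.ext (funext fun s => ?_))
  simpa using congrFun h0 s

/-! ### Dilations -/

/-- The dilation `x ↦ a^d χ(a x)`. -/
def dil (a : ℝ) (χ : Smooth d) : Smooth d :=
  ⟨fun x => ((a ^ d : ℝ) : ℂ) * χ.1 (a • x),
    contDiff_const.mul ((smooth_contDiff χ).comp (contDiff_const_smul a))⟩

theorem dil_apply (a : ℝ) (χ : Smooth d) (x : EuclideanSpace ℝ (Fin d)) :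
    (dil a χ).1 x = ((a ^ d : ℝ) : ℂ) * χ.1 (a • x) := rfl

theorem pderiv_dil (a : ℝ) (χ : Smooth d) (i : Fin d) :
    pderiv i (dil a χ) = (a : ℂ) • dil a (pderiv i χ) := by
  apply Subtype.ext
  funext x
  change fderiv ℝ (fun x => ((a ^ d : ℝ) : ℂ) * χ.1 (a • x)) x _
    = (a : ℂ) * (((a ^ d : ℝ) : ℂ) * fderiv ℝ χ.1 (a • x) _)
  have h1 : HasFDerivAt (fun x : EuclideanSpace ℝ (Fin d) => χ.1 (a • x))
      ((fderiv ℝ χ.1 (a • x)).comp (a • ContinuousLinearMap.id ℝ _)) x :=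
    HasFDerivAt.comp x (smooth_differentiable χ (a • x)).hasFDerivAt
      ((hasFDerivAt_id x).const_smul a)
  rw [(h1.const_mul _).fderiv]
  simp
  ring

theorem dl_dil (a : ℝ) (χ : Smooth d) (u : List (Fin d)) :
    dl u (dil a χ) = ((a ^ u.length : ℝ) : ℂ) • dil a (dl u χ) := by
  induction u with
  | nil => simp
  | cons i u ih =>
    rw [dl_cons, ih, map_smul, pderiv_dil, dl_cons, smul_smul]
    simp [pow_succ]

theorem norm_dil (a : ℝ) (ha : 0 ≤ a) (χ : Smooth d) (x : EuclideanSpace ℝ (Fin d)) :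
    ‖(dil a χ).1 x‖ = a ^ d * ‖χ.1 (a • x)‖ := by
  rw [dil_apply, norm_mul, Complex.norm_real, Real.norm_of_nonneg (by positivity)]

theorem norm_le_norm_smul {a : ℝ} (ha : 1 ≤ a) (x : EuclideanSpace ℝ (Fin d)) :
    ‖x‖ ≤ ‖a • x‖ := by
  rw [norm_smul, Real.norm_of_nonneg (by linarith)]
  exact le_mul_of_one_le_left (norm_nonneg _) ha

theorem IsUltraKernel.dil {M : ℕ → ℝ} (hv : IsModerate ω v) (h : IsUltraKernel M v χ) {a : ℝ}
    (ha : 1 ≤ a) : IsUltraKernel M v (dil a χ) := by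
  intro l hl
  have ha0 : 0 < a := by linarith
  -- Every derivative of the dilation produces a factor a, which the smaller parameter l / a
  -- compensates.
  obtain ⟨C, hC, h⟩ := h (l / a) (by positivity)
  refine ⟨a ^ d * C, by positivity, fun u s => ?_⟩
  have hv1 := fun s => zero_le_one.trans (hv.one_le s)
  have hs := norm_le_norm_smul ha s
  have hw : v s * (1 + ‖s‖) ^ (d + 2) ≤ v (a • s) * (1 + ‖a • s‖) ^ (d + 2) :=
    mul_le_mul (hv.mono _ _ hs) (by gcongr) (by positivity) (hv1 _)
  have e : ‖(dl u (Ultra.dil a χ)).1 s‖ = a ^ u.length * (a ^ d * ‖(dl u χ).1 (a • s)‖) := by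
    rw [dl_dil]
    change ‖((a ^ u.length : ℝ) : ℂ) * (Ultra.dil a (dl u χ)).1 s‖ = _
    rw [norm_mul, norm_dil _ ha0.le, Complex.norm_real, Real.norm_of_nonneg (by positivity)]
  rw [e]
  calc _ ≤ a ^ u.length * (a ^ d * ‖(dl u χ).1 (a • s)‖) *
        (v (a • s) * (1 + ‖a • s‖) ^ (d + 2)) := mul_le_mul_of_nonneg_left hw (by positivity)
    _ = a ^ u.length * a ^ d *
        (‖(dl u χ).1 (a • s)‖ * (v (a • s) * (1 + ‖a • s‖) ^ (d + 2))) := by ring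
    _ ≤ a ^ u.length * a ^ d * (C * ((l / a) ^ u.length * M u.length)) :=
        mul_le_mul_of_nonneg_left (h u _) (by positivity)
    _ = _ := by
        rw [div_pow]
        field_simp

theorem integral_dil {a : ℝ} (ha : 0 < a) (χ : Smooth d) :
    ∫ s, (dil a χ).1 s = ∫ s, χ.1 s := by
  simp_rw [dil_apply]
  rw [integral_const_mul, Measure.integral_comp_smul]
  simp only [finrank_euclideanSpace, Fintype.card_fin]
  rw [abs_of_pos (by positivity), Complex.real_smul, ← mul_assoc, ← Complex.ofReal_mul,
    mul_inv_cancel₀ (by positivity)]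
  simp

/-- Substituting a s for s cancels a^d and leaves 1/a from the factor ‖s‖; radial monotonicity gives
v(s) ≤ v(a s). This is the source of the rate 1/(k+1). -/
theorem exists_moment_dil_le (hv : IsModerate ω v) (h : IsKernel v χ) :
    ∃ C, 0 ≤ C ∧ ∀ a : ℝ, 1 ≤ a → ∫ s, ‖(dil a χ).1 s‖ * ‖s‖ * v s ≤ C / a := by
  obtain ⟨C, hC⟩ := h []
  have hi := (integrable_of_decay hv (smooth_contDiff χ).continuous hC).1
  have hv1 := fun s => zero_le_one.trans (hv.one_le s)
  have hi' : Integrable fun s => ‖χ.1 s‖ * ‖s‖ * v s := by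
    refine hi.mono' (((smooth_contDiff χ).continuous.norm.mul
      continuous_norm).aestronglyMeasurable.mul hv.measurable.aestronglyMeasurable)
      (Eventually.of_forall fun s => ?_)
    have := hv1 s
    rw [Real.norm_of_nonneg (by positivity)]
    gcongr
    linarith
  refine ⟨∫ s, ‖χ.1 s‖ * ‖s‖ * v s, integral_nonneg fun s => ?_, fun a ha => ?_⟩
  · have := hv1 s
    positivity
  have ha0 : 0 < a := by linarith
  have hle : ∀ s, ‖(dil a χ).1 s‖ * ‖s‖ * v s
      ≤ a ^ d / a * (‖χ.1 (a • s)‖ * ‖a • s‖ * v (a • s)) := fun s => by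
    rw [norm_dil a ha0.le, norm_smul, Real.norm_of_nonneg ha0.le]
    have e : a ^ d / a * (‖χ.1 (a • s)‖ * (a * ‖s‖) * v (a • s))
        = a ^ d * ‖χ.1 (a • s)‖ * ‖s‖ * v (a • s) := by field_simp
    rw [e]
    exact mul_le_mul_of_nonneg_left (hv.mono _ _ (norm_le_norm_smul ha s)) (by positivity)
  have hcs := Measure.integral_comp_smul (volume : Measure (EuclideanSpace ℝ (Fin d)))
    (fun s => ‖χ.1 s‖ * ‖s‖ * v s) a
  calc _ ≤ ∫ s, a ^ d / a * (‖χ.1 (a • s)‖ * ‖a • s‖ * v (a • s)) := by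
        refine integral_mono_of_nonneg (Eventually.of_forall fun s => ?_)
          ((hi'.comp_smul ha0.ne').const_mul _) (Eventually.of_forall hle)
        have := hv1 s
        simp only [Pi.zero_apply]
        positivity
    _ = _ := by
        rw [integral_const_mul, hcs]
        simp only [finrank_euclideanSpace, Fintype.card_fin]
        rw [abs_of_pos (by positivity), smul_eq_mul]
        field_simp

end

/-! ### Convolution with a kernel on weighted L^1 -/

section

variable {d : ℕ} {W : Weights d} {v : EuclideanSpace ℝ (Fin d) → ℝ} {φ χ : Smooth d}

theorem smooth_continuous (φ : Smooth d) : Continuous φ.1 := (smooth_contDiff φ).continuous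

theorem clm_eq_sum (L : EuclideanSpace ℝ (Fin d) →L[ℝ] ℂ) :
    L = ∑ i, (EuclideanSpace.proj i : EuclideanSpace ℝ (Fin d) →L[ℝ] ℝ).smulRight
      (L (EuclideanSpace.single i 1)) := by
  ext x
  conv_lhs => rw [← (EuclideanSpace.basisFun (Fin d) ℝ).sum_repr x]
  simp

theorem norm_fderiv_apply_le (φ : Smooth d) (x s : EuclideanSpace ℝ (Fin d)) :
    ‖fderiv ℝ φ.1 x s‖ ≤ ‖s‖ * ∑ i, ‖(pderiv i φ).1 x‖ := by
  rw [clm_eq_sum (fderiv ℝ φ.1 x)]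
  simp only [sum_apply, ContinuousLinearMap.smulRight_apply,
    PiLp.proj_apply]
  rw [Finset.mul_sum]
  refine (norm_sum_le _ _).trans (Finset.sum_le_sum fun i _ => ?_)
  rw [norm_smul]
  exact mul_le_mul_of_nonneg_right (PiLp.norm_apply_le s i) (norm_nonneg _)

theorem norm_fderiv_le (φ : Smooth d) (x : EuclideanSpace ℝ (Fin d)) :
    ‖fderiv ℝ φ.1 x‖ ≤ ∑ i, ‖(pderiv i φ).1 x‖ :=
  ContinuousLinearMap.opNorm_le_bound _ (Finset.sum_nonneg fun _ _ => norm_nonneg _) fun s => by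
    rw [mul_comm]; exact norm_fderiv_apply_le φ x s

/-! ### Convolution with a kernel -/

/-- Moderateness gives ω(x) ≤ ω(t) v(x - t), and the kernel decay absorbs v. The retained factor 1 +
‖x - t‖ later yields vanishing at infinity in `norm_tconv_le`. -/
theorem IsKernel.norm_sub_le (hv : IsModerate W.ω v) (h : IsKernel v χ) :
    ∃ C, 0 ≤ C ∧ ∀ x t, ‖χ.1 (x - t)‖ * (1 + ‖x - t‖) * W.ω x ≤ C * W.ω t := by
  obtain ⟨C, hC0, hC⟩ := h.norm_le hv
  refine ⟨C, hC0, fun x t => ?_⟩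
  have h1 : W.ω x ≤ W.ω t * v (x - t) := by
    simpa using hv.le t (x - t)
  have h2 := (W.isWeightFunction.pos t).le
  have h2' := (W.isWeightFunction.pos x).le
  have h3 : 0 ≤ v (x - t) := zero_le_one.trans (hv.one_le _)
  have h4 : (1 : ℝ) ≤ 1 + ‖x - t‖ := by simp
  have h5 : 1 + ‖x - t‖ ≤ (1 + ‖x - t‖) ^ (d + 2) := le_self_pow₀ h4 (by omega)
  calc ‖χ.1 (x - t)‖ * (1 + ‖x - t‖) * W.ω x
      ≤ ‖χ.1 (x - t)‖ * (1 + ‖x - t‖) ^ (d + 2) * (W.ω t * v (x - t)) := by gcongr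
    _ = (‖χ.1 (x - t)‖ * v (x - t) * (1 + ‖x - t‖) ^ (d + 2)) * W.ω t := by ring
    _ ≤ _ := mul_le_mul_of_nonneg_right (hC _) h2

theorem IsKernel.norm_sub_le' (hv : IsModerate W.ω v) (h : IsKernel v χ) :
    ∃ C, 0 ≤ C ∧ ∀ x t, ‖χ.1 (x - t)‖ ≤ C * (W.ω x)⁻¹ * W.ω t := by
  obtain ⟨C, hC0, hC⟩ := h.norm_sub_le hv
  refine ⟨C, hC0, fun x t => ?_⟩
  have hx := W.isWeightFunction.pos x
  rw [mul_right_comm, ← div_eq_mul_inv, le_div_iff₀ hx]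
  refine le_trans ?_ (hC x t)
  exact mul_le_mul_of_nonneg_right (le_mul_of_one_le_right (norm_nonneg _) (by simp)) hx.le

/-- The convolution of two functions. -/
def conv (φ χ : Smooth d) (x : EuclideanSpace ℝ (Fin d)) : ℂ := ∫ t, φ.1 t * χ.1 (x - t)

theorem integrable_conv (hv : IsModerate W.ω v) (hφ : MemL1 W.ω φ) (hχ : IsKernel v χ)
    (x : EuclideanSpace ℝ (Fin d)) : Integrable fun t => φ.1 t * χ.1 (x - t) := by
  obtain ⟨C, hC0, hC⟩ := hχ.norm_sub_le' hv
  have h1 := smooth_continuous φ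
  have h2 := smooth_continuous χ
  refine (Integrable.const_mul hφ (C * (W.ω x)⁻¹)).mono'
    (by fun_prop : Continuous fun t => φ.1 t * χ.1 (x - t)).aestronglyMeasurable
    (Eventually.of_forall fun t => ?_)
  rw [norm_mul]
  calc _ ≤ ‖φ.1 t‖ * (C * (W.ω x)⁻¹ * W.ω t) :=
        mul_le_mul_of_nonneg_left (hC x t) (norm_nonneg _)
    _ = _ := by ring

/-- Differentiation under the integral, with the derivative on the kernel. Local boundedness of 1/ω
makes the dominating function uniform on the unit ball around x. -/
theorem hasFDerivAt_conv (hv : IsModerate W.ω v) (hφ : MemL1 W.ω φ) (hχ : IsKernel v χ)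
    (x : EuclideanSpace ℝ (Fin d)) :
    HasFDerivAt (conv φ χ)
      (∑ i, (EuclideanSpace.proj i : EuclideanSpace ℝ (Fin d) →L[ℝ] ℝ).smulRight
        (conv φ (pderiv i χ) x)) x := by
  have h1 := smooth_continuous φ
  have h2 := smooth_continuous χ
  have h3 : Continuous (fderiv ℝ χ.1) := (smooth_contDiff χ).continuous_fderiv (by simp)
  choose C hC0 hC using fun i => (hχ.pderiv i).norm_sub_le' hv
  obtain ⟨K, hK⟩ := W.isWeightFunction.locallyBounded _ (isCompact_closedBall x 1)
  have hbound : ∀ t, ∀ y ∈ Metric.closedBall x 1,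
      ‖φ.1 t • fderiv ℝ χ.1 (y - t)‖ ≤ (∑ i, C i * K) * (‖φ.1 t‖ * W.ω t) := by
    intro t y hy
    have hωt := (W.isWeightFunction.pos t).le
    rw [norm_smul]
    calc _ ≤ ‖φ.1 t‖ * ∑ i, C i * K * W.ω t := by
          refine mul_le_mul_of_nonneg_left ((norm_fderiv_le χ _).trans
            (Finset.sum_le_sum fun i _ => (hC i y t).trans ?_)) (norm_nonneg _)
          have := (hK y hy).2
          have := hC0 i
          gcongr
      _ = _ := by rw [← Finset.sum_mul]; ring
  have hmeas : AEStronglyMeasurable (fun t => φ.1 t • fderiv ℝ χ.1 (x - t)) volume :=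
    (by fun_prop : Continuous fun t => φ.1 t • fderiv ℝ χ.1 (x - t)).aestronglyMeasurable
  have key := hasFDerivAt_integral_of_dominated_of_fderiv_le (𝕜 := ℝ) (μ := volume)
    (F := fun y t => φ.1 t * χ.1 (y - t)) (F' := fun y t => φ.1 t • fderiv ℝ χ.1 (y - t))
    (x₀ := x) (s := Metric.closedBall x 1) (bound := fun t => (∑ i, C i * K) * (‖φ.1 t‖ * W.ω t))
    (Metric.closedBall_mem_nhds x one_pos)
    (Eventually.of_forall fun y => (integrable_conv hv hφ hχ y).aestronglyMeasurable)
    (integrable_conv hv hφ hχ x) hmeas (Eventually.of_forall hbound)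
    (Integrable.const_mul hφ _)
    (Eventually.of_forall fun t y _ => by
      have h4 := (smooth_differentiable χ (y - t)).hasFDerivAt.comp y
        ((hasFDerivAt_id y).sub_const t)
      exact h4.const_mul (φ.1 t))
  have hint : Integrable (fun t => φ.1 t • fderiv ℝ χ.1 (x - t)) :=
    (Integrable.const_mul hφ _).mono' hmeas (Eventually.of_forall fun t =>
      hbound t x (Metric.mem_closedBall_self zero_le_one))
  refine key.congr_fderiv ?_
  rw [clm_eq_sum (∫ t, φ.1 t • fderiv ℝ χ.1 (x - t))]
  refine Finset.sum_congr rfl fun i _ => ?_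
  rw [ContinuousLinearMap.integral_apply hint]
  rfl

theorem contDiff_conv (hv : IsModerate W.ω v) (hφ : MemL1 W.ω φ) (hχ : IsKernel v χ) :
    ContDiff ℝ (⊤ : ℕ∞) (conv φ χ) := by
  rw [contDiff_infty]
  intro n
  induction n generalizing χ with
  | zero =>
    exact contDiff_zero.2
      (Differentiable.continuous fun x => (hasFDerivAt_conv hv hφ hχ x).differentiableAt)
  | succ n ih =>
    have e : fderiv ℝ (conv φ χ) = fun x =>
        ∑ i, (EuclideanSpace.proj i : EuclideanSpace ℝ (Fin d) →L[ℝ] ℝ).smulRight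
          (conv φ (pderiv i χ) x) := funext fun x => (hasFDerivAt_conv hv hφ hχ x).fderiv
    push_cast
    rw [contDiff_succ_iff_fderiv]
    refine ⟨fun x => (hasFDerivAt_conv hv hφ hχ x).differentiableAt, by simp, ?_⟩
    rw [e]
    refine ContDiff.sum fun i _ => ?_
    exact contDiff_const.smulRight (ih (hχ.pderiv i))

/-- The convolution of an integrable smooth function with a kernel. -/
def convS (hv : IsModerate W.ω v) (hφ : MemL1 W.ω φ) (hχ : IsKernel v χ) : Smooth d :=
  ⟨conv φ χ, contDiff_conv hv hφ hχ⟩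

theorem pderiv_convS (hv : IsModerate W.ω v) (hφ : MemL1 W.ω φ) (hχ : IsKernel v χ) (i : Fin d) :
    pderiv i (convS hv hφ hχ) = convS hv hφ (hχ.pderiv i) := by
  apply Subtype.ext
  funext x
  change fderiv ℝ (conv φ χ) x _ = conv φ (pderiv i χ) x
  rw [(hasFDerivAt_conv hv hφ hχ x).fderiv, sum_apply,
    Finset.sum_eq_single i]
  · simp
  · intro j _ hj
    simp [hj]
  · simp

theorem dl_convS (hv : IsModerate W.ω v) (hφ : MemL1 W.ω φ) (hχ : IsKernel v χ)
    (u : List (Fin d)) : dl u (convS hv hφ hχ) = convS hv hφ (hχ.dl u) := by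
  induction u with
  | nil => rfl
  | cons i u ih =>
    rw [dl_cons, ih, pderiv_convS]
    apply Subtype.ext
    change conv φ (pderiv i (dl u χ)) = conv φ (dl (i :: u) χ)
    rw [dl_cons]

/-- Integration by parts; there is no boundary term because all three products are integrable. -/
theorem conv_pderiv (hv : IsModerate W.ω v) (hφ : MemL1 W.ω φ) {i : Fin d}
    (hφ' : MemL1 W.ω (pderiv i φ)) (hχ : IsKernel v χ) :
    conv φ (pderiv i χ) = conv (pderiv i φ) χ := by
  funext x
  have hd : Differentiable ℝ fun t => χ.1 (x - t) :=
    (smooth_differentiable χ).comp (differentiable_const x |>.sub differentiable_id)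
  have e : ∀ t, fderiv ℝ (fun t => χ.1 (x - t)) t (EuclideanSpace.single i 1)
      = -(pderiv i χ).1 (x - t) := by
    intro t
    have h4 := (smooth_differentiable χ (x - t)).hasFDerivAt.comp t
        ((hasFDerivAt_id t).const_sub x)
    have h5 : fderiv ℝ (fun t => χ.1 (x - t)) t = _ := h4.fderiv
    rw [h5]
    simp [pderiv_apply]
  have h := integral_mul_fderiv_eq_neg_fderiv_mul_of_integrable (𝕜 := ℂ) (μ := volume)
    (f := φ.1) (g := fun t => χ.1 (x - t)) (v := EuclideanSpace.single i 1)
    (integrable_conv hv hφ' hχ x)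
    (by
      simp only [e, mul_neg]
      exact (integrable_conv hv hφ (hχ.pderiv i) x).neg)
    (integrable_conv hv hφ hχ x) (fun t _ => smooth_differentiable φ t) (fun t _ => hd t)
  simp only [e, mul_neg, integral_neg, neg_inj] at h
  exact h

/-! ### Integral estimates -/

/-- The weighted `L^1`-norm with values in `[0, ∞]`. -/
def eL1 (ω : EuclideanSpace ℝ (Fin d) → ℝ) (f : EuclideanSpace ℝ (Fin d) → ℂ) : ENNReal :=
  ∫⁻ x, ‖f x‖ₑ * ENNReal.ofReal (ω x)

theorem ofReal_norm_mul (z : ℂ) (r : ℝ) :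
    ENNReal.ofReal (‖z‖ * r) = ‖z‖ₑ * ENNReal.ofReal r := by
  rw [ENNReal.ofReal_mul (norm_nonneg _), ofReal_norm]

variable (W) in
theorem memL1_iff (φ : Smooth d) : MemL1 W.ω φ ↔ eL1 W.ω φ.1 < ⊤ := by
  have hm : AEStronglyMeasurable (fun x => ‖φ.1 x‖ * W.ω x) volume :=
    (smooth_continuous φ).norm.aestronglyMeasurable.mul
      W.isWeightFunction.aemeasurable.aestronglyMeasurable
  have h0 : 0 ≤ᵐ[volume] fun x => ‖φ.1 x‖ * W.ω x := Eventually.of_forall fun x =>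
    mul_nonneg (norm_nonneg _) (W.isWeightFunction.pos x).le
  unfold MemL1 eL1
  rw [Integrable, hasFiniteIntegral_iff_ofReal h0]
  simp only [ofReal_norm_mul, hm, true_and]

theorem eL1_eq (h : MemL1 W.ω φ) : eL1 W.ω φ.1 = ENNReal.ofReal (l1Norm W.ω φ) := by
  have h0 : 0 ≤ᵐ[volume] fun x => ‖φ.1 x‖ * W.ω x := Eventually.of_forall fun x =>
    mul_nonneg (norm_nonneg _) (W.isWeightFunction.pos x).le
  rw [l1Norm, ofReal_integral_eq_lintegral_ofReal h h0]
  simp only [ofReal_norm_mul, eL1]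

theorem memL1_and_le {C : ℝ} (hC : 0 ≤ C) (h : eL1 W.ω φ.1 ≤ ENNReal.ofReal C) :
    MemL1 W.ω φ ∧ l1Norm W.ω φ ≤ C := by
  have hm : MemL1 W.ω φ := (memL1_iff W φ).2 (h.trans_lt ENNReal.ofReal_lt_top)
  refine ⟨hm, ?_⟩
  rw [eL1_eq hm] at h
  exact (ENNReal.ofReal_le_ofReal_iff hC).1 h

/-- Minkowski's integral inequality for L^1, by Tonelli. Working in [0, ∞] makes integrability a
consequence of the later estimates instead of a prerequisite. -/
theorem lintegral_mul_weight_le {S : Type*} [MeasurableSpace S] {μ : Measure S} [SFinite μ]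
    {ω : EuclideanSpace ℝ (Fin d) → ℝ} (hω : AEMeasurable ω volume)
    {f : EuclideanSpace ℝ (Fin d) → ENNReal} {F : EuclideanSpace ℝ (Fin d) → S → ENNReal}
    (hF : Measurable (Function.uncurry F)) (hf : ∀ x, f x ≤ ∫⁻ s, F x s ∂μ) :
    ∫⁻ x, f x * ENNReal.ofReal (ω x) ≤ ∫⁻ s, (∫⁻ x, F x s * ENNReal.ofReal (ω x)) ∂μ := by
  calc _ ≤ ∫⁻ x, ∫⁻ s, F x s * ENNReal.ofReal (ω x) ∂μ := by
        refine lintegral_mono fun x => ?_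
        have hm : Measurable (F x) := hF.comp measurable_prodMk_left
        rw [lintegral_mul_const _ hm]
        exact mul_le_mul_left (hf x) _
    _ = _ := by
        refine lintegral_lintegral_swap ?_
        exact hF.aemeasurable.mul (hω.comp_fst.ennreal_ofReal)

theorem eL1_comp_sub_le (hv : IsModerate W.ω v) {f : EuclideanSpace ℝ (Fin d) → ℂ}
    (s : EuclideanSpace ℝ (Fin d)) :
    eL1 W.ω (fun x => f (x - s)) ≤ ENNReal.ofReal (v s) * eL1 W.ω f := by
  unfold eL1
  rw [← lintegral_add_right_eq_self _ s, ← lintegral_const_mul' _ _ ENNReal.ofReal_ne_top]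
  refine lintegral_mono fun x => ?_
  simp only [add_sub_cancel_right]
  rw [mul_left_comm, ← ENNReal.ofReal_mul (zero_le_one.trans (hv.one_le s)), mul_comm (v s)]
  exact mul_le_mul_right (ENNReal.ofReal_le_ofReal (hv.le x s)) _

theorem conv_eq (φ χ : Smooth d) (x : EuclideanSpace ℝ (Fin d)) :
    conv φ χ x = ∫ s, φ.1 (x - s) * χ.1 s := by
  unfold conv
  rw [← integral_sub_left_eq_self _ volume x]
  simp

theorem eL1_conv_le (hv : IsModerate W.ω v) :
    eL1 W.ω (conv φ χ) ≤ (∫⁻ s, ENNReal.ofReal (‖χ.1 s‖ * v s)) * eL1 W.ω φ.1 := by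
  have h1 := smooth_continuous φ
  have h2 := smooth_continuous χ
  refine (lintegral_mul_weight_le W.isWeightFunction.aemeasurable (μ := volume)
    (F := fun x s => ‖φ.1 (x - s) * χ.1 s‖ₑ) ?_ fun x => ?_).trans ?_
  · exact (by fun_prop : Continuous fun p : _ × _ => ‖φ.1 (p.1 - p.2) * χ.1 p.2‖ₑ).measurable
  · rw [conv_eq]
    exact enorm_integral_le_lintegral_enorm _
  · rw [← lintegral_mul_const]
    · refine lintegral_mono fun s => ?_
      rw [ofReal_norm_mul, mul_assoc]
      refine le_trans (le_of_eq ?_) (mul_le_mul_right (eL1_comp_sub_le hv s) _)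
      unfold eL1
      rw [← lintegral_const_mul' _ _ enorm_ne_top]
      refine lintegral_congr fun x => ?_
      rw [enorm_mul]
      ring
    · exact (h2.norm.measurable.mul hv.measurable).ennreal_ofReal

/-- The difference is the integral of the derivative along the segment from x - s to x. Translating
by θ s with θ ≤ 1 costs at most v(θ s) ≤ v(s). -/
theorem eL1_sub_le (hv : IsModerate W.ω v) (φ : Smooth d) (s : EuclideanSpace ℝ (Fin d)) :
    eL1 W.ω (fun x => φ.1 x - φ.1 (x - s))
      ≤ ENNReal.ofReal (‖s‖ * v s) * ∑ i, eL1 W.ω (pderiv i φ).1 := by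
  have h3 : Continuous (fderiv ℝ φ.1) := (smooth_contDiff φ).continuous_fderiv (by simp)
  have h4 := fun i => smooth_continuous (pderiv i φ)
  have hftc : ∀ x, φ.1 x - φ.1 (x - s) = ∫ θ in (0 : ℝ)..1, fderiv ℝ φ.1 (x - θ • s) s := by
    intro x
    have hder : ∀ θ ∈ Set.uIcc (0 : ℝ) 1,
        HasDerivAt (fun θ : ℝ => -φ.1 (x - θ • s)) (fderiv ℝ φ.1 (x - θ • s) s) θ := by
      intro θ _
      have h5 : HasDerivAt (fun θ : ℝ => x - θ • s) (-s) θ := by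
        simpa using ((hasDerivAt_id θ).smul_const s).const_sub x
      have h6 := ((smooth_differentiable φ (x - θ • s)).hasFDerivAt.comp_hasDerivAt θ h5).neg
      rw [map_neg, neg_neg] at h6
      exact h6
    rw [intervalIntegral.integral_eq_sub_of_hasDerivAt hder
      ((by fun_prop : Continuous fun θ : ℝ => fderiv ℝ φ.1 (x - θ • s) s).intervalIntegrable _ _)]
    simp
    ring
  refine (lintegral_mul_weight_le W.isWeightFunction.aemeasurable
    (μ := volume.restrict (Set.Ioc (0 : ℝ) 1))
    (F := fun x θ => ENNReal.ofReal ‖s‖ * ∑ i, ‖(pderiv i φ).1 (x - θ • s)‖ₑ) ?_ fun x => ?_).trans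
      ?_
  · refine Measurable.const_mul ?_ _
    exact Finset.measurable_sum _ fun i _ =>
      (by fun_prop : Continuous fun p : _ × ℝ => ‖(pderiv i φ).1 (p.1 - p.2 • s)‖ₑ).measurable
  · beta_reduce
    rw [hftc, intervalIntegral.integral_of_le zero_le_one]
    refine (enorm_integral_le_lintegral_enorm _).trans (lintegral_mono fun θ => ?_)
    rw [← ofReal_norm]
    refine (ENNReal.ofReal_le_ofReal (norm_fderiv_apply_le φ _ s)).trans (le_of_eq ?_)
    rw [ENNReal.ofReal_mul (norm_nonneg _), ENNReal.ofReal_sum_of_nonneg fun _ _ => norm_nonneg _]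
    simp only [ofReal_norm]
  · have hle : ∀ θ ∈ Set.Ioc (0 : ℝ) 1,
        ∫⁻ x, (ENNReal.ofReal ‖s‖ * ∑ i, ‖(pderiv i φ).1 (x - θ • s)‖ₑ) * ENNReal.ofReal (W.ω x)
          ≤ ENNReal.ofReal (‖s‖ * v s) * ∑ i, eL1 W.ω (pderiv i φ).1 := by
      intro θ hθ
      have hs : ‖θ • s‖ ≤ ‖s‖ := by
        rw [norm_smul, Real.norm_of_nonneg hθ.1.le]
        exact mul_le_of_le_one_left (norm_nonneg _) hθ.2
      simp only [mul_assoc]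
      rw [lintegral_const_mul' _ _ ENNReal.ofReal_ne_top, ENNReal.ofReal_mul (norm_nonneg _),
        mul_assoc]
      refine mul_le_mul_right ?_ _
      simp only [Finset.sum_mul]
      have hm : ∀ i ∈ Finset.univ, AEMeasurable (fun x =>
          ‖(pderiv i φ).1 (x - θ • s)‖ₑ * ENNReal.ofReal (W.ω x)) volume := fun i _ =>
        (by fun_prop : Continuous fun x => ‖(pderiv i φ).1 (x - θ • s)‖ₑ).measurable.aemeasurable.mul
          W.isWeightFunction.aemeasurable.ennreal_ofReal
      rw [lintegral_finsetSum' _ hm, Finset.mul_sum]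
      refine Finset.sum_le_sum fun i _ => (eL1_comp_sub_le hv (θ • s)).trans ?_
      exact mul_le_mul_left (ENNReal.ofReal_le_ofReal (hv.mono _ _ hs)) _
    refine (setLIntegral_mono' measurableSet_Ioc hle).trans ?_
    simp

/-- Since ∫ χ = 1, the error φ - φ * χ is the χ-average of the differences φ(x) - φ(x - s). -/
theorem eL1_sub_conv_le (hv : IsModerate W.ω v) (hφ : MemL1 W.ω φ) (hχ : IsKernel v χ)
    (h1 : ∫ s, χ.1 s = 1) :
    eL1 W.ω (fun x => φ.1 x - conv φ χ x)
      ≤ (∫⁻ s, ENNReal.ofReal (‖χ.1 s‖ * ‖s‖ * v s)) * ∑ i, eL1 W.ω (pderiv i φ).1 := by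
  have c1 := smooth_continuous φ
  have c2 := smooth_continuous χ
  refine (lintegral_mul_weight_le W.isWeightFunction.aemeasurable (μ := volume)
    (F := fun x s => ‖(φ.1 x - φ.1 (x - s)) * χ.1 s‖ₑ) ?_ fun x => ?_).trans ?_
  · exact (by fun_prop : Continuous fun p : _ × _ =>
      ‖(φ.1 p.1 - φ.1 (p.1 - p.2)) * χ.1 p.2‖ₑ).measurable
  · have hi : Integrable fun s => φ.1 (x - s) * χ.1 s := by
      have := (integrable_conv hv hφ hχ x).comp_sub_left x
      simpa using this
    have e : φ.1 x - conv φ χ x = ∫ s, (φ.1 x - φ.1 (x - s)) * χ.1 s := by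
      simp only [sub_mul]
      rw [integral_sub ((hχ.integrable hv).const_mul _) hi, integral_const_mul, h1, conv_eq,
        mul_one]
    beta_reduce
    rw [e]
    exact enorm_integral_le_lintegral_enorm _
  · rw [← lintegral_mul_const]
    · refine lintegral_mono fun s => ?_
      rw [mul_assoc, ofReal_norm_mul, mul_assoc]
      refine le_trans (le_of_eq ?_) (mul_le_mul_right (eL1_sub_le hv φ s) _)
      unfold eL1
      rw [← lintegral_const_mul' _ _ enorm_ne_top]
      refine lintegral_congr fun x => ?_
      rw [enorm_mul]
      ring
    · exact ((c2.norm.measurable.mul measurable_norm).mul hv.measurable).ennreal_ofReal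

end

/-! ### The regularization operators: smoothing, approximation, transposition -/

section

variable {d : ℕ} {W : Weights d} {v : EuclideanSpace ℝ (Fin d) → ℝ} {φ χ : Smooth d}

variable (W) in
/-- The smooth functions all of whose derivatives belong to `L^1_ω`. -/
def SobL1 : Submodule ℂ (Smooth d) where
  carrier := {φ | ∀ α, MemL1 W.ω (mderiv α φ)}
  zero_mem' := fun α => by simp [MemL1]
  add_mem' := fun {φ ψ} hφ hψ α => by
    rw [map_add]
    exact MemL1.add W (hφ α) (hψ α)
  smul_mem' := fun c φ hφ α => by
    rw [map_smul]
    exact MemL1.smul W c (hφ α)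

theorem SobL1.memL1_dl (h : φ ∈ SobL1 W) (u : List (Fin d)) : MemL1 W.ω (dl u φ) := by
  obtain ⟨α, -, hα⟩ := exists_mderiv_eq_dl u
  rw [← hα]
  exact h α

theorem SobL1.memL1 (h : φ ∈ SobL1 W) : MemL1 W.ω φ := SobL1.memL1_dl h []

/-- Convolution with a kernel as a linear operator. -/
def convL (hv : IsModerate W.ω v) (hχ : IsKernel v χ) : SobL1 W →ₗ[ℂ] Smooth d where
  toFun φ := convS hv (SobL1.memL1 φ.2) hχ
  map_add' φ ψ := by
    apply Subtype.ext
    funext x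
    change ∫ t, (φ.1.1 t + ψ.1.1 t) * χ.1 (x - t) = conv φ.1 χ x + conv ψ.1 χ x
    simp only [add_mul]
    exact integral_add (integrable_conv hv (SobL1.memL1 φ.2) hχ x)
      (integrable_conv hv (SobL1.memL1 ψ.2) hχ x)
  map_smul' c φ := by
    apply Subtype.ext
    funext x
    change ∫ t, (c * φ.1.1 t) * χ.1 (x - t) = c * conv φ.1 χ x
    simp only [mul_assoc]
    exact integral_const_mul c _

theorem convL_apply (hv : IsModerate W.ω v) (hχ : IsKernel v χ) (φ : SobL1 W) :
    (convL hv hχ φ).1 = conv φ.1 χ := rfl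

theorem dl_convL (hv : IsModerate W.ω v) (hχ : IsKernel v χ) (φ : SobL1 W) (u : List (Fin d)) :
    (dl u (convL hv hχ φ)).1 = conv φ.1 (dl u χ) :=
  congrArg Subtype.val (dl_convS hv (SobL1.memL1 φ.2) hχ u)

theorem dl_convL' (hv : IsModerate W.ω v) (hχ : IsKernel v χ) (φ : SobL1 W) (u : List (Fin d)) :
    (dl u (convL hv hχ φ)).1 = conv (dl u φ.1) χ := by
  suffices h : dl u (convL hv hχ φ) = convS hv (SobL1.memL1_dl φ.2 u) hχ from
    congrArg Subtype.val h
  induction u with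
  | nil => rfl
  | cons i u ih =>
    rw [dl_cons, ih, pderiv_convS]
    apply Subtype.ext
    have := SobL1.memL1_dl φ.2 (i :: u)
    rw [dl_cons] at this
    change conv (dl u φ.1) (pderiv i χ) = conv (dl (i :: u) φ.1) χ
    rw [conv_pderiv hv (SobL1.memL1_dl φ.2 u) this hχ, dl_cons]

theorem lintegral_ofReal_le {f : EuclideanSpace ℝ (Fin d) → ℝ} (h0 : ∀ x, 0 ≤ f x)
    (hi : Integrable f) {C : ℝ} (h : ∫ x, f x ≤ C) :
    ∫⁻ x, ENNReal.ofReal (f x) ≤ ENNReal.ofReal C := by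
  rw [← ofReal_integral_eq_lintegral_ofReal hi (Eventually.of_forall h0)]
  exact ENNReal.ofReal_le_ofReal h

/-- Used with g = 1 for smoothing and with g = ‖s‖ for approximation. -/
theorem integrable_mul_weight (hv : IsModerate W.ω v) {C : ℝ}
    (hC : ∀ s, ‖χ.1 s‖ * (v s * (1 + ‖s‖) ^ (d + 2)) ≤ C) {g : EuclideanSpace ℝ (Fin d) → ℝ}
    (hg : Continuous g) (hg0 : ∀ s, 0 ≤ g s) (hg1 : ∀ s, g s ≤ 1 + ‖s‖) :
    Integrable (fun s => ‖χ.1 s‖ * g s * v s) ∧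
      ∫ s, ‖χ.1 s‖ * g s * v s ≤
        C * ∫ s : EuclideanSpace ℝ (Fin d), ((1 + ‖s‖) ^ (d + 1))⁻¹ := by
  have hi := integrable_of_decay hv (smooth_continuous χ) hC
  have hv1 := fun s => zero_le_one.trans (hv.one_le s)
  have hb : ∀ s, ‖χ.1 s‖ * g s * v s ≤ ‖χ.1 s‖ * (1 + ‖s‖) * v s := fun s => by
    have := hg1 s
    have := hv1 s
    gcongr
  have hi' : Integrable (fun s => ‖χ.1 s‖ * g s * v s) := by
    refine hi.1.mono' (((smooth_continuous χ).norm.mul hg).aestronglyMeasurable.mul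
      hv.measurable.aestronglyMeasurable) (Eventually.of_forall fun s => ?_)
    rw [Real.norm_of_nonneg (mul_nonneg (mul_nonneg (norm_nonneg _) (hg0 s)) (hv1 s))]
    exact hb s
  exact ⟨hi', (integral_mono hi' hi.1 hb).trans hi.2⟩

/-- Regularization operators. -/
structure Regularization (W : Weights d) where
  R : ℕ → SobL1 W →ₗ[ℂ] Smooth d
  H : ℝ
  one_le : 1 ≤ H
  smoothing : ∀ k (l : ℝ), 0 < l → ∃ C, 0 ≤ C ∧ ∀ φ α, MemL1 W.ω (mderiv α (R k φ)) ∧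
    quot W l (R k φ) α ≤ C * l1Norm W.ω φ.1
  approx : ∀ l : ℝ, 0 < l → ∃ C, 0 ≤ C ∧ ∀ k (φ : SobL1 W) N, (∀ α, quot W l φ.1 α ≤ N) →
    ∀ α, quot W (H * l) (φ.1 - R k φ) α ≤ C / (k + 1) * N
  transpose : ∀ k (f : EuclideanSpace ℝ (Fin d) → ℂ), Continuous f → HasCompactSupport f →
    ∀ η : ℝ, 0 < η → ∃ g : EuclideanSpace ℝ (Fin d) → ℂ, Continuous g ∧ HasCompactSupport g ∧
      ∀ φ : SobL1 W, ‖(∫ x, f x * (R k φ).1 x) - ∫ x, g x * φ.1.1 x‖ ≤ η * l1Norm W.ω φ.1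

/-- All derivatives are put on the kernel, so only the L^1_ω-norm of φ itself enters. -/
theorem convL_smoothing (hv : IsModerate W.ω v) (hχ : IsUltraKernel W.M v χ) {l : ℝ}
    (hl : 0 < l) : ∃ C, 0 ≤ C ∧ ∀ φ α, MemL1 W.ω (mderiv α (convL hv hχ.isKernel φ)) ∧
      quot W l (convL hv hχ.isKernel φ) α ≤ C * l1Norm W.ω φ.1 := by
  obtain ⟨C, hC0, hC⟩ := hχ l hl
  set I := ∫ s : EuclideanSpace ℝ (Fin d), ((1 + ‖s‖) ^ (d + 1))⁻¹ with hI
  have hI0 : 0 ≤ I := integral_nonneg fun s => by positivity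
  refine ⟨C * I, by positivity, fun φ α => ?_⟩
  obtain ⟨u, hu, hα⟩ := exists_dl_eq_mderiv α
  have hden := den_pos W hl u.length
  have hk := integrable_mul_weight hv (hC u) (g := fun _ => 1)
    continuous_const (fun _ => zero_le_one) (fun s => by simp)
  simp only [mul_one] at hk
  have h0 := l1Norm_nonneg W φ.1
  have he : eL1 W.ω (mderiv α (convL hv hχ.isKernel φ)).1
      ≤ ENNReal.ofReal (C * (l ^ u.length * W.M u.length) * I * l1Norm W.ω φ.1) := by
    rw [hα, dl_convL, ENNReal.ofReal_mul (by positivity), ← eL1_eq (SobL1.memL1 φ.2)]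
    refine (eL1_conv_le hv).trans (mul_le_mul_left ?_ _)
    exact lintegral_ofReal_le (fun s => mul_nonneg (norm_nonneg _)
      (zero_le_one.trans (hv.one_le s))) hk.1 hk.2
  obtain ⟨h1, h2⟩ := memL1_and_le (by positivity) he
  refine ⟨h1, ?_⟩
  rw [quot, ← hu, div_le_iff₀ hden]
  refine h2.trans (le_of_eq ?_)
  ring

/-- Here the derivatives stay on φ. The first-moment estimate needs one more derivative in each of d
directions, and (M.2)' turns M (p+1) into H^p M p, whence the parameter H l. -/
theorem convL_approx (hv : IsModerate W.ω v) (hχ : IsKernel v χ) (h1 : ∫ s, χ.1 s = 1)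
    {C₀ H : ℝ} (hC₀ : 0 ≤ C₀) (hM2 : ∀ p, W.M (p + 1) ≤ C₀ * H ^ p * W.M p) (hH : 1 ≤ H)
    {m l N : ℝ} (hm0 : 0 ≤ m) (hm : ∫ s, ‖χ.1 s‖ * ‖s‖ * v s ≤ m) (hl : 0 < l) (φ : SobL1 W)
    (hN : ∀ α, quot W l φ.1 α ≤ N) (α : Fin d → ℕ) :
    quot W (H * l) (φ.1 - convL hv hχ φ) α ≤ m * (d * (C₀ * l)) * N := by
  obtain ⟨u, hu, hα⟩ := exists_dl_eq_mderiv α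
  have hH0 : 0 < H := by linarith
  have hN0 : 0 ≤ N := (quot_nonneg W hl φ.1 0).trans (hN 0)
  have hden := den_pos W (mul_pos hH0 hl) u.length
  have hMu := W.isWeightSequence.pos u.length
  obtain ⟨K, hK⟩ := hχ []
  have hk := integrable_mul_weight hv hK (g := fun s => ‖s‖)
    continuous_norm (fun _ => norm_nonneg _) (fun s => by simp)
  have hder : ∀ i, eL1 W.ω (pderiv i (dl u φ.1)).1
      ≤ ENNReal.ofReal (C₀ * l * ((H * l) ^ u.length * W.M u.length) * N) := by
    intro i
    rw [← hα, ← mderiv_add_single, eL1_eq (φ.2 _)]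
    refine ENNReal.ofReal_le_ofReal ?_
    have h := hN (α + Pi.single i 1)
    rw [quot, mlen_add_single, ← hu, div_le_iff₀ (den_pos W hl _)] at h
    refine h.trans ?_
    calc N * (l ^ (u.length + 1) * W.M (u.length + 1))
        ≤ N * (l ^ (u.length + 1) * (C₀ * H ^ u.length * W.M u.length)) := by
          have := hM2 u.length
          gcongr
      _ = _ := by rw [mul_pow]; ring
  have he : eL1 W.ω (mderiv α (φ.1 - convL hv hχ φ)).1
      ≤ ENNReal.ofReal (m * (d * (C₀ * l * ((H * l) ^ u.length * W.M u.length) * N))) := by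
    have e : (mderiv α (φ.1 - convL hv hχ φ)).1
        = fun x => (dl u φ.1).1 x - conv (dl u φ.1) χ x := by
      rw [hα, map_sub, ← dl_convL' hv hχ]
      rfl
    rw [e, ENNReal.ofReal_mul hm0]
    refine (eL1_sub_conv_le hv (SobL1.memL1_dl φ.2 u) hχ h1).trans (mul_le_mul' ?_ ?_)
    · exact lintegral_ofReal_le (fun s => mul_nonneg (by positivity)
        (zero_le_one.trans (hv.one_le s))) hk.1 hm
    · refine (Finset.sum_le_sum fun i _ => hder i).trans (le_of_eq ?_)
      rw [Finset.sum_const, Finset.card_univ, Fintype.card_fin, nsmul_eq_mul,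
        ENNReal.ofReal_mul (Nat.cast_nonneg d), ENNReal.ofReal_natCast]
  obtain ⟨-, h2⟩ := memL1_and_le (by positivity) he
  rw [quot, ← hu, div_le_iff₀ hden]
  refine h2.trans (le_of_eq ?_)
  ring

/-- A continuous cutoff function. -/
def cutoff (r : ℝ) (x : EuclideanSpace ℝ (Fin d)) : ℝ := max 0 (min 1 (r + 1 - ‖x‖))

theorem cutoff_of_le {r : ℝ} {x : EuclideanSpace ℝ (Fin d)} (h : ‖x‖ ≤ r) : cutoff r x = 1 := by
  rw [cutoff, min_eq_left (by linarith), max_eq_right zero_le_one]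

theorem cutoff_mem (r : ℝ) (x : EuclideanSpace ℝ (Fin d)) : 0 ≤ cutoff r x ∧ cutoff r x ≤ 1 :=
  ⟨le_max_left _ _, max_le zero_le_one (min_le_left _ _)⟩

theorem continuous_cutoff (r : ℝ) : Continuous (cutoff r : EuclideanSpace ℝ (Fin d) → ℝ) := by
  unfold cutoff
  fun_prop

theorem hasCompactSupport_cutoff (r : ℝ) :
    HasCompactSupport (cutoff r : EuclideanSpace ℝ (Fin d) → ℝ) := by
  refine HasCompactSupport.of_support_subset_isCompact (isCompact_closedBall 0 (r + 1)) ?_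
  intro x hx
  by_contra h
  simp only [Metric.mem_closedBall, dist_zero_right, not_le] at h
  exact hx (by rw [cutoff, min_eq_right (by linarith), max_eq_left (by linarith)])

theorem exists_inv_weight_le (W : Weights d) {f : EuclideanSpace ℝ (Fin d) → ℂ}
    (hf : Continuous f) (hf' : HasCompactSupport f) : ∃ C, 0 ≤ C ∧ ∀ x, ‖f x‖ ≤ C * W.ω x := by
  obtain ⟨K, hK⟩ := W.isWeightFunction.locallyBounded _ hf'
  obtain ⟨B, hB⟩ := hf'.exists_bound_of_continuous hf
  have hB0 : 0 ≤ B := (norm_nonneg _).trans (hB 0)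
  refine ⟨B * |K|, by positivity, fun x => ?_⟩
  have hx := W.isWeightFunction.pos x
  by_cases h : x ∈ tsupport f
  · have h1 := ((hK x h).2).trans (le_abs_self K)
    rw [inv_le_iff_one_le_mul₀ hx] at h1
    calc ‖f x‖ ≤ B * 1 := by rw [mul_one]; exact hB x
      _ ≤ B * (|K| * W.ω x) := by gcongr
      _ = _ := by ring
  · rw [image_eq_zero_of_notMem_tsupport h, norm_zero]
    positivity

theorem norm_integral_mul_le {f : EuclideanSpace ℝ (Fin d) → ℂ} {C : ℝ}
    (hf : ∀ x, ‖f x‖ ≤ C * W.ω x) (hφ : MemL1 W.ω φ) :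
    ‖∫ x, f x * φ.1 x‖ ≤ C * l1Norm W.ω φ := by
  rw [l1Norm, ← integral_const_mul]
  refine norm_integral_le_of_norm_le (Integrable.const_mul hφ C) (Eventually.of_forall fun x => ?_)
  rw [norm_mul]
  calc _ ≤ C * W.ω x * ‖φ.1 x‖ := mul_le_mul_of_nonneg_right (hf x) (norm_nonneg _)
    _ = _ := by ring

/-- The convolution of a compactly supported function with a reflected kernel. -/
def tconv (f : EuclideanSpace ℝ (Fin d) → ℂ) (χ : Smooth d) (t : EuclideanSpace ℝ (Fin d)) : ℂ :=
  ∫ x, f x * χ.1 (x - t)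

theorem continuous_tconv {f : EuclideanSpace ℝ (Fin d) → ℂ} (hf : Continuous f)
    (hf' : HasCompactSupport f) (χ : Smooth d) : Continuous (tconv f χ) := by
  have h2 := smooth_continuous χ
  have e : tconv f χ = fun t => ∫ x in tsupport f, f x * χ.1 (x - t) := by
    funext t
    refine (setIntegral_eq_integral_of_forall_compl_eq_zero fun x hx => ?_).symm
    rw [image_eq_zero_of_notMem_tsupport hx, zero_mul]
  rw [e]
  exact continuous_parametric_integral_of_continuous
    (by fun_prop : Continuous fun p : _ × _ => f p.2 * χ.1 (p.2 - p.1)) hf'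

theorem integrable_div_weight (W : Weights d) {f : EuclideanSpace ℝ (Fin d) → ℂ}
    (hf : Continuous f) (hf' : HasCompactSupport f) :
    Integrable fun x => ‖f x‖ * (W.ω x)⁻¹ := by
  obtain ⟨K, hK⟩ := W.isWeightFunction.locallyBounded _ hf'
  refine ((hf.norm.integrable_of_hasCompactSupport hf'.norm).const_mul K).mono' ?_
    (Eventually.of_forall fun x => ?_)
  · exact hf.norm.aestronglyMeasurable.mul W.isWeightFunction.aemeasurable.inv.aestronglyMeasurable
  · have hx := W.isWeightFunction.pos x
    rw [Real.norm_of_nonneg (by positivity), mul_comm]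
    by_cases h : x ∈ tsupport f
    · exact mul_le_mul_of_nonneg_right (hK x h).2 (norm_nonneg _)
    · simp [image_eq_zero_of_notMem_tsupport h]

theorem integral_mul_conv (hv : IsModerate W.ω v) (hφ : MemL1 W.ω φ) (hχ : IsKernel v χ)
    {f : EuclideanSpace ℝ (Fin d) → ℂ} (hf : Continuous f) (hf' : HasCompactSupport f) :
    ∫ x, f x * conv φ χ x = ∫ t, tconv f χ t * φ.1 t := by
  have h1 := smooth_continuous φ
  have h2 := smooth_continuous χ
  obtain ⟨C, hC0, hC⟩ := hχ.norm_sub_le' hv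
  have hint : Integrable (Function.uncurry fun x t => f x * (φ.1 t * χ.1 (x - t)))
      (volume.prod volume) := by
    refine (((integrable_div_weight W hf hf').const_mul C).mul_prod hφ).mono'
      (by fun_prop : Continuous fun p : _ × _ =>
        f p.1 * (φ.1 p.2 * χ.1 (p.1 - p.2))).aestronglyMeasurable
      (Eventually.of_forall fun p => ?_)
    simp only [Function.uncurry, norm_mul]
    calc _ ≤ ‖f p.1‖ * (‖φ.1 p.2‖ * (C * (W.ω p.1)⁻¹ * W.ω p.2)) := by
          gcongr
          exact hC _ _
      _ = _ := by ring
  unfold conv tconv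
  simp_rw [← integral_const_mul, ← integral_mul_const]
  rw [integral_integral_swap hint]
  refine integral_congr_ae (Eventually.of_forall fun t => ?_)
  refine integral_congr_ae (Eventually.of_forall fun x => ?_)
  simp only
  ring

/-- For x in the support of f one has ‖x - t‖ ≥ ‖t‖ - ρ, so the spare factor of the kernel decay
shows that the transposed convolution is o(ω) at infinity. -/
theorem norm_tconv_le (hv : IsModerate W.ω v) (hχ : IsKernel v χ)
    {f : EuclideanSpace ℝ (Fin d) → ℂ} (hf : Continuous f) (hf' : HasCompactSupport f) {ρ : ℝ}
    (hρ : tsupport f ⊆ Metric.closedBall 0 ρ) :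
    ∃ C, 0 ≤ C ∧ ∀ t, ρ ≤ ‖t‖ → ‖tconv f χ t‖ * (1 + ‖t‖ - ρ) ≤ C * W.ω t := by
  obtain ⟨C, hC0, hC⟩ := hχ.norm_sub_le hv
  have hi := integrable_div_weight W hf hf'
  have hi0 : 0 ≤ ∫ x, ‖f x‖ * (W.ω x)⁻¹ := integral_nonneg fun x => by
    have hx := W.isWeightFunction.pos x
    positivity
  refine ⟨C * ∫ x, ‖f x‖ * (W.ω x)⁻¹, by positivity, fun t ht => ?_⟩
  have hpos : 0 < 1 + ‖t‖ - ρ := by linarith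
  rw [← le_div_iff₀ hpos]
  have e : C * (∫ x, ‖f x‖ * (W.ω x)⁻¹) * W.ω t / (1 + ‖t‖ - ρ)
      = ∫ x, C * W.ω t / (1 + ‖t‖ - ρ) * (‖f x‖ * (W.ω x)⁻¹) := by
    rw [integral_const_mul]
    ring
  rw [e]
  refine norm_integral_le_of_norm_le (hi.const_mul _) (Eventually.of_forall fun x => ?_)
  by_cases h : x ∈ tsupport f
  · have hx := W.isWeightFunction.pos x
    have h3 : ‖x‖ ≤ ρ := by simpa using hρ h
    have h4 : 1 + ‖t‖ - ρ ≤ 1 + ‖x - t‖ := by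
      have := norm_sub_norm_le t x
      rw [norm_sub_rev] at this
      linarith
    have h5 : ‖χ.1 (x - t)‖ ≤ C * W.ω t / (1 + ‖t‖ - ρ) * (W.ω x)⁻¹ := by
      rw [← div_eq_mul_inv, div_div, le_div_iff₀ (by positivity)]
      refine le_trans ?_ (hC x t)
      rw [mul_assoc]
      gcongr
    rw [norm_mul]
    calc _ ≤ ‖f x‖ * (C * W.ω t / (1 + ‖t‖ - ρ) * (W.ω x)⁻¹) := by gcongr
      _ = _ := by ring
  · simp [image_eq_zero_of_notMem_tsupport h]

theorem convL_transpose (hv : IsModerate W.ω v) (hχ : IsKernel v χ)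
    {f : EuclideanSpace ℝ (Fin d) → ℂ} (hf : Continuous f) (hf' : HasCompactSupport f) {η : ℝ}
    (hη : 0 < η) : ∃ g : EuclideanSpace ℝ (Fin d) → ℂ, Continuous g ∧ HasCompactSupport g ∧
      ∀ φ : SobL1 W, ‖(∫ x, f x * (convL hv hχ φ).1 x) - ∫ x, g x * φ.1.1 x‖
        ≤ η * l1Norm W.ω φ.1 := by
  obtain ⟨ρ, hρ⟩ := hf'.isBounded.subset_closedBall (0 : EuclideanSpace ℝ (Fin d))
  obtain ⟨C, hC0, hC⟩ := norm_tconv_le hv hχ hf hf' hρ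
  have hc := continuous_tconv hf hf' χ
  -- Beyond this radius 1 + ‖x‖ - ρ ≥ C / η, so the part that is cut off is at most η ω.
  set r := ρ + C / η with hr
  have hg : Continuous fun x => (cutoff r x : ℂ) * tconv f χ x :=
    (Complex.continuous_ofReal.comp (continuous_cutoff r)).mul hc
  have hg' : HasCompactSupport fun x => (cutoff r x : ℂ) * tconv f χ x :=
    HasCompactSupport.mul_right ((hasCompactSupport_cutoff r).comp_left Complex.ofReal_zero)
  refine ⟨_, hg, hg', fun φ => ?_⟩
  have hφ := SobL1.memL1 φ.2
  have hb : ∀ x, ‖tconv f χ x - (cutoff r x : ℂ) * tconv f χ x‖ ≤ η * W.ω x := by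
    intro x
    have hx := W.isWeightFunction.pos x
    rcases le_or_gt ‖x‖ r with h | h
    · rw [cutoff_of_le h]
      simp only [Complex.ofReal_one, one_mul, sub_self, norm_zero]
      positivity
    · have h0 := cutoff_mem r x
      have hdiv : 0 ≤ C / η := by positivity
      have h1 : ‖tconv f χ x - (cutoff r x : ℂ) * tconv f χ x‖ ≤ ‖tconv f χ x‖ := by
        have e : tconv f χ x - (cutoff r x : ℂ) * tconv f χ x
            = ((1 - cutoff r x : ℝ) : ℂ) * tconv f χ x := by push_cast; ring
        rw [e, norm_mul, Complex.norm_real, Real.norm_of_nonneg (by linarith)]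
        exact mul_le_of_le_one_left (norm_nonneg _) (by linarith)
      have h2 := hC x (by linarith)
      have h3 : C / η ≤ 1 + ‖x‖ - ρ := by linarith
      have h4 : 0 < 1 + ‖x‖ - ρ := by linarith
      rw [div_le_iff₀ hη] at h3
      refine h1.trans (le_of_mul_le_mul_right (h2.trans ?_) h4)
      nlinarith
  have hi1 : Integrable fun x => ((cutoff r x : ℂ) * tconv f χ x) * φ.1.1 x :=
    (hg.mul (smooth_continuous φ.1)).integrable_of_hasCompactSupport hg'.mul_right
  have hw : Integrable fun x => tconv f χ x * φ.1.1 x := by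
    have hi2 : Integrable fun x => (tconv f χ x - (cutoff r x : ℂ) * tconv f χ x) * φ.1.1 x := by
      refine (Integrable.const_mul hφ η).mono'
        ((hc.sub hg).mul (smooth_continuous φ.1)).aestronglyMeasurable
        (Eventually.of_forall fun x => ?_)
      rw [norm_mul]
      calc _ ≤ η * W.ω x * ‖φ.1.1 x‖ := mul_le_mul_of_nonneg_right (hb x) (norm_nonneg _)
        _ = _ := by ring
    refine (hi1.add hi2).congr (Eventually.of_forall fun x => ?_)
    simp only [Pi.add_apply]
    ring
  rw [convL_apply, integral_mul_conv hv hφ hχ hf hf', ← integral_sub hw hi1]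
  simp only [← sub_mul]
  exact norm_integral_mul_le hb hφ

theorem exists_regularization (hM1 : CondM1 W.M) (hM2 : CondM2' W.M)
    (h : BeurlingAssumption W.M W.ω) : Nonempty (Regularization W) := by
  obtain ⟨v, hv, χ, hχ, hχ1⟩ :=
    exists_ultraKernel W.isWeightSequence hM1 W.isWeightFunction.pos h
  obtain ⟨C₀, H, hC₀, hH, hM⟩ := hM2
  obtain ⟨m, hm0, hm⟩ := exists_moment_dil_le hv hχ.isKernel
  have ha : ∀ k : ℕ, (1 : ℝ) ≤ k + 1 := fun k => by simp
  have hk := fun k => hχ.dil hv (ha k)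
  -- The k-th operator uses the kernel dilated by k + 1, whose first moment is at most m / (k + 1)
  -- and whose integral is still 1.
  exact ⟨{
    R := fun k => convL hv (hk k).isKernel
    H := H
    one_le := hH
    smoothing := fun k l hl => convL_smoothing hv (hk k) hl
    approx := fun l hl => by
      refine ⟨m * (d * (C₀ * l)), by positivity, fun k φ N hN α => ?_⟩
      refine (convL_approx hv (hk k).isKernel ?_ (by linarith) hM hH (m := m / (k + 1))
        (by positivity) (hm _ (ha k)) hl φ hN α).trans (le_of_eq (by ring))
      rw [integral_dil (zero_lt_one.trans_le (ha k)), hχ1]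
    transpose := fun k f hf hf' η hη => convL_transpose hv _ hf hf' hη }⟩

theorem RoumieuAssumption.beurling {M : ℕ → ℝ} {ω : EuclideanSpace ℝ (Fin d) → ℝ}
    (h : RoumieuAssumption M ω) : BeurlingAssumption M ω := by
  obtain ⟨A, h1, h2, h3, h4, h5⟩ := h
  exact ⟨A, h1, h2, h3, ⟨1, one_pos, h4 1 one_pos⟩, h5⟩

end

/-! ### Abstract part: (LB)-structure and completeness from regularizing operators -/

section

/-! ### Spaces with a single seminorm -/

section SingleSeminorm

variable {D : Type*} [AddCommGroup D] [Module ℂ D]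

/-- The space `D`, equipped with the seminorm `q`. -/
def WithSN (_q : Seminorm ℂ D) : Type _ := D

instance (q : Seminorm ℂ D) : SeminormedAddCommGroup (WithSN q) :=
  AddGroupSeminorm.toSeminormedAddCommGroup (E := D) q.toAddGroupSeminorm

instance (q : Seminorm ℂ D) : Module ℂ (WithSN q) := inferInstanceAs (Module ℂ D)

instance (q : Seminorm ℂ D) : NormedSpace ℂ (WithSN q) where
  norm_smul_le c x := le_of_eq (map_smul_eq_mul q c x)

theorem WithSN.norm_def (q : Seminorm ℂ D) (x : WithSN q) : ‖x‖ = q x := rfl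

/-- Although q need not separate points, a functional of operator norm zero vanishes, so the dual is
a genuine normed space. -/
instance (q : Seminorm ℂ D) : NormedAddCommGroup (StrongDual ℂ (WithSN q)) :=
  NormedAddCommGroup.ofSeparation fun f hf => ContinuousLinearMap.ext fun φ => by
    have h := f.le_opNorm φ
    rw [hf, zero_mul] at h
    simpa using h

/-- A linear functional on `D` which is bounded with respect to `q`. -/
def liftSN (q : Seminorm ℂ D) (f : D →ₗ[ℂ] ℂ) (K : ℝ) (h : ∀ φ, ‖f φ‖ ≤ K * q φ) :
    StrongDual ℂ (WithSN q) :=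
  LinearMap.mkContinuous (show WithSN q →ₗ[ℂ] ℂ from f) K h

theorem le_mul_of_forall_le_one {p q : Seminorm ℂ D} {a : ℝ}
    (h : ∀ φ, q φ ≤ 1 → p φ ≤ a) (φ : D) : p φ ≤ a * q φ := by
  have ha : 0 ≤ a := (apply_nonneg p 0).trans (h 0 (by simp))
  -- Since q φ may be 0, scale by numbers s > q φ and then let s decrease to q φ.
  have key : ∀ s, q φ < s → p φ ≤ a * s := fun s hs => by
    have hs0 : 0 < s := (apply_nonneg q φ).trans_lt hs
    have h1 := h ((s : ℂ)⁻¹ • φ) (by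
      rw [map_smul_eq_mul, norm_inv, Complex.norm_real, Real.norm_of_nonneg hs0.le,
        inv_mul_le_one₀ hs0]
      exact hs.le)
    rw [map_smul_eq_mul, norm_inv, Complex.norm_real, Real.norm_of_nonneg hs0.le,
      inv_mul_le_iff₀ hs0, mul_comm] at h1
    exact h1
  refine le_of_forall_pos_le_add fun ε hε => ?_
  have h2 := key (q φ + ε / (a + 1)) (by linarith [show 0 < ε / (a + 1) by positivity])
  have h3 : a * (ε / (a + 1)) ≤ ε := by
    rw [mul_div_assoc', div_le_iff₀ (by positivity)]
    nlinarith
  linarith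

theorem norm_le_of_forall_le_one (q : Seminorm ℂ D) (f : StrongDual ℂ (WithSN q)) {a : ℝ}
    (h : ∀ φ : D, q φ ≤ 1 → ‖f φ‖ ≤ a) : ‖f‖ ≤ a := by
  have ha : 0 ≤ a := (norm_nonneg _).trans (h 0 (by simp))
  exact f.opNorm_le_bound ha fun φ =>
    le_mul_of_forall_le_one (p := (normSeminorm ℂ ℂ).comp (show D →ₗ[ℂ] ℂ from f.toLinearMap)) h φ

end SingleSeminorm

theorem tendsto_const_div_add_one_atTop (K : ℝ) :
    Tendsto (fun n : ℕ => K / ((n : ℝ) + 1)) atTop (𝓝 0) := by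
  simpa [div_eq_mul_inv] using (tendsto_one_div_add_atTop_nhds_zero_nat (𝕜 := ℝ)).const_mul K

/-! ### Closures in duals of regularized Fréchet spaces -/

/-- A sequence of operators regularizing the space `D`, compatibly with the subspace `C` of the
dual. -/
structure IsRegularized {D : Type*} [AddCommGroup D] [Module ℂ D] [TopologicalSpace D]
    (q : SeminormFamily ℂ D ℕ) (C : Submodule ℂ (StrongDual ℂ D)) (R : ℕ → D →ₗ[ℂ] D) : Prop where
  withSeminorms : WithSeminorms q
  mono : Monotone q
  smoothing : ∀ k m, ∃ K, 0 ≤ K ∧ ∀ φ, q m (R k φ) ≤ K * q 0 φ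
  approx : ∀ m, ∃ K, 0 ≤ K ∧ ∀ (k : ℕ) φ, q m (φ - R k φ) ≤ K / (k + 1) * q (m + 1) φ
  transpose : ∀ k, ∀ T ∈ C, ∀ η : ℝ, 0 < η → ∃ S ∈ C, ∀ φ, ‖T (R k φ) - S φ‖ ≤ η * q 0 φ
  bound : ∀ T ∈ C, ∃ K, ∀ φ, ‖T φ‖ ≤ K * q 0 φ

namespace IsRegularized

variable {D : Type*} [AddCommGroup D] [Module ℂ D] [TopologicalSpace D]
  {q : SeminormFamily ℂ D ℕ} {C : Submodule ℂ (StrongDual ℂ D)} {R : ℕ → D →ₗ[ℂ] D}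

/-- The identity from `D` into the space with the `n`-th seminorm. -/
def toSN (h : IsRegularized q C R) (n : ℕ) : D →L[ℂ] WithSN (q n) where
  toFun φ := φ
  map_add' _ _ := rfl
  map_smul' _ _ := rfl
  cont := by
    have := h.withSeminorms.topologicalAddGroup
    exact WithSeminorms.continuous_of_continuous_comp (norm_withSeminorms ℂ (WithSN (q n)))
      (show D →ₗ[ℂ] WithSN (q n) from LinearMap.id)
      fun _ => h.withSeminorms.continuous_seminorm n

/-- The identity from the space with the `m`-th seminorm into the space with the `n`-th one. -/
def succSN (h : IsRegularized q C R) (n : ℕ) : WithSN (q (n + 1)) →L[ℂ] WithSN (q n) :=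
  LinearMap.mkContinuous (show WithSN (q (n + 1)) →ₗ[ℂ] WithSN (q n) from LinearMap.id (M := D)) 1
    fun φ => by rw [one_mul]; exact h.mono n.le_succ φ

theorem smoothing' (h : IsRegularized q C R) (k m n : ℕ) :
    ∃ K, 0 ≤ K ∧ ∀ φ, q m (R k φ) ≤ K * q n φ := by
  obtain ⟨K, hK, hb⟩ := h.smoothing k m
  exact ⟨K, hK, fun φ => (hb φ).trans (mul_le_mul_of_nonneg_left (h.mono n.zero_le φ) hK)⟩

/-- The regularizing operators as continuous operators. -/
def regSN (h : IsRegularized q C R) (n k : ℕ) : WithSN (q n) →L[ℂ] D where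
  toFun φ := R k φ
  map_add' φ ψ := map_add (R k) φ ψ
  map_smul' c φ := map_smul (R k) c φ
  cont := by
    refine WithSeminorms.continuous_normedSpace_dom (WithSN (q n)) h.withSeminorms
      (show WithSN (q n) →ₗ[ℂ] D from R k) fun m => ?_
    obtain ⟨K, hK, hb⟩ := h.smoothing' k m n
    exact ⟨⟨K, hK⟩, hb⟩

/-- The elements of `C`, as elements of the dual of the space with the `n`-th seminorm. -/
def stepC (_h : IsRegularized q C R) (n : ℕ) : Submodule ℂ (StrongDual ℂ (WithSN (q n))) where
  carrier := {f | ∃ T ∈ C, ∀ φ : D, f φ = T φ}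
  zero_mem' := ⟨0, C.zero_mem, fun _ => rfl⟩
  add_mem' := by
    rintro f g ⟨T, hT, hf⟩ ⟨S, hS, hg⟩
    exact ⟨T + S, C.add_mem hT hS, fun φ => congrArg₂ (· + ·) (hf φ) (hg φ)⟩
  smul_mem' := by
    rintro c f ⟨T, hT, hf⟩
    exact ⟨c • T, C.smul_mem c hT, fun φ => congrArg (c • ·) (hf φ)⟩

theorem exists_stepC (h : IsRegularized q C R) {T : StrongDual ℂ D} (hT : T ∈ C) (n : ℕ) :
    ∃ f ∈ h.stepC n, ∀ φ : D, f φ = T φ := by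
  obtain ⟨K, hK⟩ := h.bound T hT
  refine ⟨liftSN (q n) T.toLinearMap |K| fun φ => (hK φ).trans ?_, ⟨T, hT, fun _ => rfl⟩,
    fun _ => rfl⟩
  exact mul_le_mul (le_abs_self K) (h.mono n.zero_le φ) (apply_nonneg _ _) (abs_nonneg _)

/-- The Banach steps. -/
abbrev Step (h : IsRegularized q C R) (n : ℕ) : Type _ := (h.stepC n).topologicalClosure

theorem comp_toSN_mem (h : IsRegularized q C R) (n : ℕ) {f : StrongDual ℂ (WithSN (q n))}
    (hf : f ∈ (h.stepC n).topologicalClosure) :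
    ContinuousLinearMap.precomp ℂ (h.toSN n) f ∈ C.topologicalClosure :=
  map_mem_closure (ContinuousLinearMap.precomp ℂ (h.toSN n)).continuous hf
    (by
      rintro g ⟨T, hT, hg⟩
      have e : ContinuousLinearMap.precomp ℂ (h.toSN n) g = T :=
        ContinuousLinearMap.ext fun φ => hg φ
      rw [e]
      exact hT)

/-- The inclusion of the Banach steps. -/
def incl (h : IsRegularized q C R) (n : ℕ) : h.Step n →L[ℂ] C.topologicalClosure :=
  ((ContinuousLinearMap.precomp ℂ (h.toSN n)).comp (Submodule.subtypeL _)).codRestrict _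
    fun f => h.comp_toSN_mem n f.2

theorem comp_succSN_mem (h : IsRegularized q C R) (n : ℕ) {f : StrongDual ℂ (WithSN (q n))}
    (hf : f ∈ (h.stepC n).topologicalClosure) :
    ContinuousLinearMap.precomp ℂ (h.succSN n) f ∈ (h.stepC (n + 1)).topologicalClosure :=
  map_mem_closure (ContinuousLinearMap.precomp ℂ (h.succSN n)).continuous hf
    (by
      rintro g ⟨T, hT, hg⟩
      exact ⟨T, hT, hg⟩)

/-- The inclusions between the Banach steps. -/
def succ (h : IsRegularized q C R) (n : ℕ) : h.Step n →L[ℂ] h.Step (n + 1) :=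
  ((ContinuousLinearMap.precomp ℂ (h.succSN n)).comp (Submodule.subtypeL _)).codRestrict _
    fun f => h.comp_succSN_mem n f.2

/-- Precomposition with R_k is continuous from the strong dual into the Banach dual, so T may be
taken in C, where the transposition property gives norm approximation by elements of C. -/
theorem comp_regSN_mem (h : IsRegularized q C R) (n k : ℕ) {T : StrongDual ℂ D}
    (hT : T ∈ C.topologicalClosure) :
    ContinuousLinearMap.precomp ℂ (h.regSN n k) T ∈ (h.stepC n).topologicalClosure := by
  refine Submodule.topologicalClosure_minimal (s := C)
    (t := ((h.stepC n).topologicalClosure).comap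
      (ContinuousLinearMap.precomp ℂ (h.regSN n k)).toLinearMap) ?_
    ((h.stepC n).isClosed_topologicalClosure.preimage
      (ContinuousLinearMap.precomp ℂ (h.regSN n k)).continuous) hT
  intro T hT
  change _ ∈ closure _
  refine Metric.mem_closure_iff.2 fun ε hε => ?_
  obtain ⟨S, hS, hb⟩ := h.transpose k T hT (ε / 2) (by positivity)
  obtain ⟨f, hf, hfS⟩ := h.exists_stepC hS n
  refine ⟨f, hf, ?_⟩
  rw [dist_eq_norm]
  refine lt_of_le_of_lt (ContinuousLinearMap.opNorm_le_bound _ (by positivity) fun φ => ?_)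
    (half_lt_self hε)
  refine le_trans ?_ ((hb φ).trans (mul_le_mul_of_nonneg_left (h.mono n.zero_le φ) (by positivity)))
  exact le_of_eq (congrArg (fun z => ‖T (R k φ) - z‖) (hfS φ))

/-- The transposes of the regularizing operators. -/
def reg (h : IsRegularized q C R) (n k : ℕ) (T : C.topologicalClosure) : h.Step n :=
  ⟨ContinuousLinearMap.precomp ℂ (h.regSN n k) T.1, h.comp_regSN_mem n k T.2⟩

theorem exists_bound (h : IsRegularized q C R) (T : StrongDual ℂ D) :
    ∃ n K, 0 ≤ K ∧ ∀ φ, ‖T φ‖ ≤ K * q n φ := by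
  obtain ⟨s, K, -, hK⟩ := Seminorm.bound_of_continuous h.withSeminorms
    ((normSeminorm ℂ ℂ).comp T.toLinearMap) (by exact T.continuous.norm)
  refine ⟨s.sup id, K, K.2, fun φ => (hK φ).trans ?_⟩
  have h1 : s.sup q ≤ q (s.sup id) := Finset.sup_le fun i hi => h.mono (Finset.le_sup (f := id) hi)
  exact mul_le_mul_of_nonneg_left (h1 φ) K.2

/-- Every element of the closure of `C` lies in a step, and is approximated there by its
regularizations. -/
theorem exists_approx (h : IsRegularized q C R) (T : C.topologicalClosure) :
    ∃ n K, 0 ≤ K ∧ ∃ f : h.Step n, h.incl n f = T ∧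
      ∀ k : ℕ, ‖f - h.reg n k T‖ ≤ K / (k + 1) := by
  obtain ⟨m, K, hK, hT⟩ := h.exists_bound T.1
  obtain ⟨K', hK', happ⟩ := h.approx m
  have hT' : ∀ φ, ‖T.1 φ‖ ≤ K * q (m + 1) φ := fun φ =>
    (hT φ).trans (mul_le_mul_of_nonneg_left (h.mono m.le_succ φ) hK)
  -- T is bounded by the m-th seminorm, but its regularizations converge to it only in the dual norm
  -- for the (m+1)-st, because approximation loses one index.
  set f := liftSN (q (m + 1)) T.1.toLinearMap K hT'
  have hle : ∀ k : ℕ, ‖f - (h.reg (m + 1) k T).1‖ ≤ K * K' / (k + 1) := fun k => by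
    refine ContinuousLinearMap.opNorm_le_bound _ (by positivity) fun φ => ?_
    have e : (f - (h.reg (m + 1) k T).1) φ = T.1 ((show D from φ) - R k φ) :=
      (map_sub T.1 _ _).symm
    rw [e]
    calc _ ≤ K * q m ((show D from φ) - R k φ) := hT _
      _ ≤ K * (K' / (k + 1) * q (m + 1) φ) := mul_le_mul_of_nonneg_left (happ k φ) hK
      _ = _ := by rw [WithSN.norm_def]; ring
  have hf : f ∈ (h.stepC (m + 1)).topologicalClosure := by
    refine (h.stepC (m + 1)).isClosed_topologicalClosure.mem_of_tendsto
      (f := fun k : ℕ => (h.reg (m + 1) k T).1) (b := atTop) ?_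
      (Eventually.of_forall fun k => (h.reg (m + 1) k T).2)
    rw [tendsto_iff_norm_sub_tendsto_zero]
    refine squeeze_zero (fun _ => norm_nonneg _) (fun k => ?_)
      (tendsto_const_div_add_one_atTop (K * K'))
    rw [norm_sub_rev]
    exact hle k
  exact ⟨m + 1, K * K', by positivity, ⟨f, hf⟩, Subtype.ext (ContinuousLinearMap.ext fun _ => rfl),
    hle⟩

/-- A seminorm on the closure of `C` which is continuous on all steps is continuous. -/
theorem continuous_seminorm (h : IsRegularized q C R) [IsTopologicalAddGroup D]
    [ContinuousSMul ℂ D] (p : Seminorm ℂ C.topologicalClosure)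
    (hp : ∀ n, Continuous fun x => p (h.incl n x)) : Continuous p := by
  have hc : ∀ n, ∃ c : ℝ, 0 < c ∧ ∀ x : h.Step n, p (h.incl n x) ≤ c * ‖x‖ := fun n =>
    Seminorm.bound_of_continuous_normedSpace (F := h.Step n) (p.comp (h.incl n).toLinearMap) (hp n)
  choose c hc0 hc using hc
  -- The sum up to index n + 1 lets the choice of k n control c (n+1) both as k n and, one index
  -- later, as k (n+1); n ≤ k n forces k n → ∞.
  have hkex : ∀ n, ∃ k : ℕ, n ≤ k ∧ 2 ^ n * ∑ i ∈ Finset.range (n + 2), c i ≤ k + 1 := fun n => by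
    obtain ⟨k, hk⟩ := exists_nat_ge (2 ^ n * ∑ i ∈ Finset.range (n + 2), c i)
    exact ⟨max n k, le_max_left _ _, by push_cast; linarith [le_max_right (n : ℝ) k]⟩
  choose k hkn hk using hkex
  have hk1 : ∀ n, 2 ^ n * c (n + 1) / (k n + 1) ≤ 1 := fun n => by
    rw [div_le_one (by positivity)]
    refine le_trans (mul_le_mul_of_nonneg_left ?_ (by positivity)) (hk n)
    exact Finset.single_le_sum (fun i _ => (hc0 i).le) (Finset.mem_range.2 (by omega))
  have hk2 : ∀ n, 2 ^ n * c (n + 1) / (k (n + 1) + 1) ≤ 1 := fun n => by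
    rw [div_le_one (by positivity)]
    refine le_trans (mul_le_mul (pow_le_pow_right₀ one_le_two n.le_succ) ?_ (hc0 _).le
      (by positivity)) (hk (n + 1))
    exact Finset.single_le_sum (fun i _ => (hc0 i).le) (Finset.mem_range.2 (by omega))
  -- The scaling is such that |T| ≤ 1 on B bounds the first regularization of T by 1 / c 0 and the
  -- n-th increment by 1 / (2^n c (n+1)), each in the dual norm of its own step.
  set B : Set D := {ψ | ∃ φ, q 0 φ ≤ 1 ∧ ψ = (c 0 : ℂ) • R (k 0) φ} ∪
    {ψ | ∃ n φ, q (n + 1) φ ≤ 1 ∧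
      ψ = ((2 ^ n * c (n + 1) : ℝ) : ℂ) • (R (k (n + 1)) φ - R (k n) φ)} with hB
  have hBb : Bornology.IsVonNBounded ℂ B := by
    rw [h.withSeminorms.isVonNBounded_iff_seminorm_bddAbove]
    intro m
    rw [hB, Set.image_union, bddAbove_union]
    constructor
    · obtain ⟨K, hK, hb⟩ := h.smoothing (k 0) m
      refine ⟨c 0 * K, ?_⟩
      rintro _ ⟨_, ⟨φ, hφ, rfl⟩, rfl⟩
      rw [map_smul_eq_mul, Complex.norm_real, Real.norm_of_nonneg (hc0 0).le]
      exact mul_le_mul_of_nonneg_left ((hb φ).trans (mul_le_of_le_one_right hK hφ)) (hc0 0).le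
    · obtain ⟨K, hK, happ⟩ := h.approx m
      choose r hr0 hr using fun j => h.smoothing' (k j) m 0
      have hpos : ∀ n, 0 ≤ 2 ^ n * c (n + 1) := fun n => by have := (hc0 (n + 1)).le; positivity
      have hpos' : ∀ n, 0 ≤ 2 ^ n * c (n + 1) * (r (n + 1) + r n) := fun n =>
        mul_nonneg (hpos n) (add_nonneg (hr0 _) (hr0 _))
      refine ⟨2 * K + ∑ n ∈ Finset.range m, 2 ^ n * c (n + 1) * (r (n + 1) + r n), ?_⟩
      rintro _ ⟨_, ⟨n, φ, hφ, rfl⟩, rfl⟩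
      rw [map_smul_eq_mul, Complex.norm_real, Real.norm_of_nonneg (hpos n)]
      -- For n < m only the smoothing bound is available, but these are finitely many n. For n ≥ m
      -- the (m+1)-st seminorm is at most the (n+1)-st, so the approximation bound applies
      -- uniformly.
      rcases lt_or_ge n m with hn | hn
      · have h0 : q 0 φ ≤ 1 := (h.mono (Nat.zero_le _) φ).trans hφ
        have h1 : q m (R (k (n + 1)) φ - R (k n) φ) ≤ r (n + 1) + r n :=
          (map_sub_le_add _ _ _).trans (add_le_add
            ((hr _ φ).trans (mul_le_of_le_one_right (hr0 _) h0))
            ((hr _ φ).trans (mul_le_of_le_one_right (hr0 _) h0)))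
        calc _ ≤ 2 ^ n * c (n + 1) * (r (n + 1) + r n) :=
              mul_le_mul_of_nonneg_left h1 (hpos n)
          _ ≤ ∑ n ∈ Finset.range m, 2 ^ n * c (n + 1) * (r (n + 1) + r n) :=
              Finset.single_le_sum (f := fun n => 2 ^ n * c (n + 1) * (r (n + 1) + r n))
                (fun i _ => hpos' i) (Finset.mem_range.2 hn)
          _ ≤ _ := by linarith
      · have h0 : q (m + 1) φ ≤ 1 := (h.mono (by omega) φ).trans hφ
        have hj : ∀ j, q m (φ - R j φ) ≤ K / (j + 1) := fun j =>
          (happ j φ).trans (mul_le_of_le_one_right (by positivity) h0)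
        have h1 : q m (R (k (n + 1)) φ - R (k n) φ) ≤ K / (k n + 1) + K / (k (n + 1) + 1) := by
          have e : R (k (n + 1)) φ - R (k n) φ = (φ - R (k n) φ) - (φ - R (k (n + 1)) φ) := by abel
          rw [e]
          exact (map_sub_le_add _ _ _).trans (add_le_add (hj _) (hj _))
        calc _ ≤ 2 ^ n * c (n + 1) * (K / (k n + 1) + K / (k (n + 1) + 1)) :=
              mul_le_mul_of_nonneg_left h1 (hpos n)
          _ = K * (2 ^ n * c (n + 1) / (k n + 1)) + K * (2 ^ n * c (n + 1) / (k (n + 1) + 1)) := by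
              ring
          _ ≤ K * 1 + K * 1 := add_le_add (mul_le_mul_of_nonneg_left (hk1 n) hK)
              (mul_le_mul_of_nonneg_left (hk2 n) hK)
          _ ≤ _ := by
              have := Finset.sum_nonneg fun i (_ : i ∈ Finset.range m) => hpos' i
              linarith
  have key : ∀ T : C.topologicalClosure, (∀ ψ ∈ B, ‖T.1 ψ‖ ≤ 1) → p T ≤ 3 := by
    intro T hT
    have hn0 : ‖h.reg 0 (k 0) T‖ ≤ (c 0)⁻¹ := by
      refine norm_le_of_forall_le_one (q 0) _ fun φ hφ => ?_
      have := hT _ (Or.inl ⟨φ, hφ, rfl⟩)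
      rw [map_smul, norm_smul, Complex.norm_real, Real.norm_of_nonneg (hc0 0).le] at this
      change ‖T.1 (R (k 0) φ)‖ ≤ _
      rw [inv_eq_one_div, le_div_iff₀ (hc0 0), mul_comm]
      exact this
    have hn1 : ∀ n, ‖h.reg (n + 1) (k (n + 1)) T - h.reg (n + 1) (k n) T‖
        ≤ (2 ^ n * c (n + 1))⁻¹ := fun n => by
      have hpos : 0 < 2 ^ n * c (n + 1) := mul_pos (by positivity) (hc0 _)
      refine norm_le_of_forall_le_one (q (n + 1)) _ fun φ hφ => ?_
      have := hT _ (Or.inr ⟨n, φ, hφ, rfl⟩)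
      rw [map_smul, norm_smul, Complex.norm_real, Real.norm_of_nonneg hpos.le, map_sub] at this
      change ‖T.1 (R (k (n + 1)) φ) - T.1 (R (k n) φ)‖ ≤ _
      rw [inv_eq_one_div, le_div_iff₀ hpos, mul_comm]
      exact this
    have hincl : ∀ n m j, h.incl n (h.reg n j T) = h.incl m (h.reg m j T) := fun n m j =>
      Subtype.ext (ContinuousLinearMap.ext fun _ => rfl)
    -- The first term contributes at most 1 and the n-th increment at most 2^{-n}; the partial sums
    -- of these bounds are 3 - 2 / 2^N.
    have hQ : ∀ N, p (h.incl 0 (h.reg 0 (k N) T)) ≤ 3 - 2 / 2 ^ N := by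
      intro N
      induction N with
      | zero =>
        refine (hc 0 _).trans ((mul_le_mul_of_nonneg_left hn0 (hc0 0).le).trans ?_)
        rw [mul_inv_cancel₀ (hc0 0).ne']
        norm_num
      | succ N ih =>
        have e : h.incl 0 (h.reg 0 (k (N + 1)) T) = h.incl 0 (h.reg 0 (k N) T) +
            h.incl (N + 1) (h.reg (N + 1) (k (N + 1)) T - h.reg (N + 1) (k N) T) := by
          rw [map_sub, hincl 0 (N + 1), hincl 0 (N + 1)]
          abel
        have h1 := (hc (N + 1) _).trans (mul_le_mul_of_nonneg_left (hn1 N) (hc0 (N + 1)).le)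
        have h2 : c (N + 1) * (2 ^ N * c (N + 1))⁻¹ = 1 / 2 ^ N := by
          have := (hc0 (N + 1)).ne'
          field_simp
        rw [h2] at h1
        rw [e]
        refine (map_add_le_add p _ _).trans ((add_le_add ih h1).trans (le_of_eq ?_))
        rw [pow_succ]
        field_simp
        ring
    -- The step m containing T is fixed, so the remainder after N terms tends to 0 for p, although m
    -- depends on T.
    obtain ⟨m, K, hK, f, hf, hfk⟩ := h.exists_approx T
    have hlim : Tendsto (fun N : ℕ => 3 + c m * (K / ((N : ℝ) + 1))) atTop (𝓝 (3 + c m * 0)) :=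
      ((tendsto_const_div_add_one_atTop K).const_mul _).const_add _
    rw [mul_zero, add_zero] at hlim
    refine ge_of_tendsto' hlim fun N => ?_
    have e : T = h.incl 0 (h.reg 0 (k N) T) + h.incl m (f - h.reg m (k N) T) := by
      rw [map_sub, hf, hincl 0 m]
      abel
    have h1 : p (h.incl m (f - h.reg m (k N) T)) ≤ c m * (K / ((N : ℝ) + 1)) := by
      refine (hc m _).trans (mul_le_mul_of_nonneg_left ((hfk (k N)).trans ?_) (hc0 m).le)
      have : (N : ℝ) ≤ k N := by exact_mod_cast hkn N
      gcongr
    have h2 : (0 : ℝ) ≤ 2 / 2 ^ N := by positivity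
    calc p T ≤ p (h.incl 0 (h.reg 0 (k N) T)) + p (h.incl m (f - h.reg m (k N) T)) := by
          conv_lhs => rw [e]
          exact map_add_le_add p _ _
      _ ≤ _ := by linarith [hQ N]
  -- The polar of the bounded set B is a neighbourhood of 0 in the strong dual.
  refine Seminorm.continuous' (𝕜 := ℂ) (r := 3) ?_
  have hnhds : {T : StrongDual ℂ D | Set.MapsTo T B (Metric.closedBall 0 1)} ∈ 𝓝 0 :=
    ContinuousLinearMap.eventually_nhds_zero_mapsTo hBb (Metric.closedBall_mem_nhds 0 one_pos)
  have hpre := continuous_subtype_val (p := fun T => T ∈ C.topologicalClosure).tendsto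
    (0 : C.topologicalClosure) hnhds
  refine mem_of_superset hpre fun T hT => ?_
  rw [Seminorm.mem_closedBall, sub_zero]
  exact key T fun ψ hψ => by simpa using hT hψ

end IsRegularized

theorem IsRegularized.isLBSpace {D : Type u} [AddCommGroup D] [Module ℂ D] [TopologicalSpace D]
    [IsTopologicalAddGroup D] [ContinuousSMul ℂ D] {q : SeminormFamily ℂ D ℕ}
    {C : Submodule ℂ (StrongDual ℂ D)} {R : ℕ → D →ₗ[ℂ] D} (h : IsRegularized q C R) :
    IsLBSpace C.topologicalClosure where
  isTopologicalAddGroup := inferInstance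
  continuousSMul := inferInstance
  t2Space := inferInstance
  locallyConvexSpace :=
    inferInstanceAs (LocallyConvexSpace ℝ (C.topologicalClosure.restrictScalars ℝ))
  exists_steps := by
    refine ⟨h.Step, fun n => inferInstance, fun n => inferInstance, fun n => ?_, h.succ,
      fun n => (h.incl n).toLinearMap, fun n f g hfg => ?_, fun n x => ?_, fun T => ?_,
      fun p => ⟨fun hp n => hp.comp (h.incl n).continuous, h.continuous_seminorm p⟩⟩
    · exact (h.stepC n).isClosed_topologicalClosure.completeSpace_coe
    · refine Subtype.ext (ContinuousLinearMap.ext fun φ => ?_)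
      exact congrArg (fun T : C.topologicalClosure => T.1 φ) hfg
    · exact Subtype.ext (ContinuousLinearMap.ext fun _ => rfl)
    · obtain ⟨n, -, -, f, hf, -⟩ := h.exists_approx T
      exact ⟨n, f, hf⟩

/-- Countably many seminorms make D first countable, so its strong dual is complete; the closure of
C is closed in it. -/
theorem IsRegularized.completeSpace {D : Type*} [AddCommGroup D] [Module ℂ D] [TopologicalSpace D]
    [IsTopologicalAddGroup D] [ContinuousSMul ℂ D] {q : SeminormFamily ℂ D ℕ}
    {C : Submodule ℂ (StrongDual ℂ D)} {R : ℕ → D →ₗ[ℂ] D} (h : IsRegularized q C R) :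
    CompleteSpace C.topologicalClosure := by
  have := h.withSeminorms.firstCountableTopology
  exact C.isClosed_topologicalClosure.completeSpace_coe

end

/-! ### The Beurling space as a regularized space -/

section

variable {d : ℕ} {W : Weights d}

theorem stepNorm_le {l : {l : ℝ // 0 < l}} {φ : DStep W l} {N : ℝ}
    (h : ∀ α, quot W l φ.1 α ≤ N) : stepNorm W l φ ≤ N := ciSup_le h

theorem quot_le_stepNorm {l : {l : ℝ // 0 < l}} (φ : DStep W l) (α : Fin d → ℕ) :
    quot W l φ.1 α ≤ stepNorm W l φ := le_ciSup φ.2.2 α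

theorem l1Norm_le_stepNorm {l : {l : ℝ // 0 < l}} (φ : DStep W l) :
    l1Norm W.ω φ.1 ≤ W.M 0 * stepNorm W l φ := by
  have h := quot_le_stepNorm φ 0
  rw [quot, mderiv_zero, mlen_zero, pow_zero, one_mul, div_le_iff₀ (W.isWeightSequence.pos 0)] at h
  rwa [mul_comm]

theorem stepNorm_mono {l l' : {l : ℝ // 0 < l}} (h : l ≤ l') {φ : DStep W l} {ψ : DStep W l'}
    (e : ψ.1 = φ.1) : stepNorm W l' ψ ≤ stepNorm W l φ :=
  stepNorm_le fun α => by
    rw [e]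
    exact (quot_anti W l.2 h φ.1 α).trans (quot_le_stepNorm φ α)

/-- The functional given by a compactly supported continuous function. -/
def funL {D : Type*} [AddCommGroup D] [Module ℂ D] (incl : D →ₗ[ℂ] Smooth d)
    {g : EuclideanSpace ℝ (Fin d) → ℂ} (hg : Continuous g) (hg' : HasCompactSupport g) :
    D →ₗ[ℂ] ℂ where
  toFun φ := ∫ x, g x * (incl φ).1 x
  map_add' φ ψ := by
    have hi : ∀ φ : D, Integrable fun x => g x * (incl φ).1 x := fun φ =>
      (hg.mul (smooth_continuous (incl φ))).integrable_of_hasCompactSupport hg'.mul_right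
    rw [← integral_add (hi φ) (hi ψ), map_add]
    simp [mul_add]
  map_smul' c φ := by
    rw [map_smul, RingHom.id_apply, smul_eq_mul, ← integral_const_mul]
    simp [mul_left_comm]

theorem exists_funL_bound {D : Type*} [AddCommGroup D] [Module ℂ D] (incl : D →ₗ[ℂ] Smooth d)
    (hD : ∀ φ, MemL1 W.ω (incl φ))
    {g : EuclideanSpace ℝ (Fin d) → ℂ} (hg : Continuous g) (hg' : HasCompactSupport g) :
    ∃ K, 0 ≤ K ∧ ∀ φ, ‖funL incl hg hg' φ‖ ≤ K * l1Norm W.ω (incl φ) := by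
  obtain ⟨K, hK, h⟩ := exists_inv_weight_le W hg hg'
  exact ⟨K, hK, fun φ => norm_integral_mul_le h (hD φ)⟩

/-! ### The Beurling case -/

theorem DBeurling.mem (φ : DBeurling W) (l : {l : ℝ // 0 < l}) :
    DBeurling.incl W φ ∈ DStep W l := (DBeurling.toStep W l φ).2

/-- The inclusion into the space of functions with all derivatives in `L^1_ω`. -/
def DBeurling.toSob : DBeurling W →ₗ[ℂ] SobL1 W :=
  (DBeurling.incl W).codRestrict _ fun φ => (DBeurling.mem φ ⟨1, one_pos⟩).1

namespace Regularization

variable (𝓡 : Regularization W)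

theorem R_mem (k : ℕ) (φ : SobL1 W) (l : {l : ℝ // 0 < l}) : 𝓡.R k φ ∈ DStep W l := by
  obtain ⟨C, -, h⟩ := 𝓡.smoothing k l.1 l.2
  refine ⟨fun α => (h φ α).1, C * l1Norm W.ω φ.1, ?_⟩
  rintro _ ⟨α, rfl⟩
  exact (h φ α).2

/-- The regularization operators on `D^{(M_p)}_{L^1_ω}`. -/
def RB (k : ℕ) : DBeurling W →ₗ[ℂ] DBeurling W :=
  ((𝓡.R k).comp DBeurling.toSob).codRestrict (beurlingSubmodule W) fun _ =>
    (Submodule.mem_iInf _).2 fun l => 𝓡.R_mem k _ l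

/-- A decreasing sequence of parameters. -/
def lB (n : ℕ) : {l : ℝ // 0 < l} :=
  ⟨((𝓡.H + 1) ^ n)⁻¹, by have := 𝓡.one_le; positivity⟩

theorem lB_anti : Antitone 𝓡.lB := by
  intro m n h
  have := 𝓡.one_le
  exact inv_anti₀ (pow_pos (show 0 < 𝓡.H + 1 by linarith) m)
    (pow_le_pow_right₀ (by linarith) h)

theorem exists_lB_le (l : {l : ℝ // 0 < l}) : ∃ n, 𝓡.lB n ≤ l := by
  have := 𝓡.one_le
  obtain ⟨n, hn⟩ := pow_unbounded_of_one_lt (l.1)⁻¹ (show 1 < 𝓡.H + 1 by linarith)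
  refine ⟨n, ?_⟩
  change ((𝓡.H + 1) ^ n)⁻¹ ≤ l.1
  exact (inv_le_comm₀ l.2 (by positivity)).1 hn.le

/-- One index absorbs the loss from l to H l. The base H + 1, unlike H, also makes the parameters
tend to 0 when H = 1. -/
theorem lB_succ (n : ℕ) : 𝓡.H * (𝓡.lB (n + 1)).1 ≤ (𝓡.lB n).1 := by
  have := 𝓡.one_le
  change 𝓡.H * ((𝓡.H + 1) ^ (n + 1))⁻¹ ≤ ((𝓡.H + 1) ^ n)⁻¹
  rw [pow_succ, mul_inv, mul_left_comm]
  refine mul_le_of_le_one_right (by positivity) ?_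
  rw [← div_eq_mul_inv, div_le_one (by linarith)]
  linarith

/-- A fundamental sequence of seminorms. -/
def qB (n : ℕ) : Seminorm ℂ (DBeurling W) := beurlingSeminorms W (𝓡.lB n)

theorem beurlingSeminorms_anti {l l' : {l : ℝ // 0 < l}} (h : l ≤ l') :
    beurlingSeminorms W l' ≤ beurlingSeminorms W l := fun _ => stepNorm_mono h rfl

theorem withSeminorms_qB : WithSeminorms (𝓡.qB : SeminormFamily ℂ (DBeurling W) ℕ) := by
  refine (beurling_withSeminorms W).congr (fun n => ?_) (fun l => ?_)
  · refine ⟨{𝓡.lB n}, 1, ?_⟩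
    rw [one_smul, Finset.sup_singleton]
    exact le_rfl
  · obtain ⟨n, hn⟩ := 𝓡.exists_lB_le l
    refine ⟨{n}, 1, ?_⟩
    rw [one_smul, Finset.sup_singleton]
    exact beurlingSeminorms_anti hn

theorem memL1_incl (φ : DBeurling W) : MemL1 W.ω (DBeurling.incl W φ) :=
  SobL1.memL1 (DBeurling.toSob φ).2

theorem l1Norm_le_qB (n : ℕ) (φ : DBeurling W) :
    l1Norm W.ω (DBeurling.incl W φ) ≤ W.M 0 * 𝓡.qB n φ :=
  l1Norm_le_stepNorm (DBeurling.toStep W (𝓡.lB n) φ)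

theorem exists_funL_qB_bound {g : EuclideanSpace ℝ (Fin d) → ℂ} (hg : Continuous g)
    (hg' : HasCompactSupport g) :
    ∃ K, 0 ≤ K ∧ ∀ φ, ‖funL (DBeurling.incl W) hg hg' φ‖ ≤ K * 𝓡.qB 0 φ := by
  obtain ⟨K, hK, h⟩ := exists_funL_bound (W := W) (DBeurling.incl W) memL1_incl hg hg'
  have h0 := (W.isWeightSequence.pos 0).le
  refine ⟨K * W.M 0, by positivity, fun φ => (h φ).trans ?_⟩
  rw [mul_assoc]
  exact mul_le_mul_of_nonneg_left (𝓡.l1Norm_le_qB 0 φ) hK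

theorem isRegularized :
    IsRegularized (𝓡.qB : SeminormFamily ℂ (DBeurling W) ℕ)
      (compactlySupported (DBeurling.incl W)) 𝓡.RB where
  withSeminorms := 𝓡.withSeminorms_qB
  mono := fun _ _ h => beurlingSeminorms_anti (𝓡.lB_anti h)
  smoothing := fun k m => by
    obtain ⟨C, hC, h⟩ := 𝓡.smoothing k (𝓡.lB m).1 (𝓡.lB m).2
    have h0 := (W.isWeightSequence.pos 0).le
    refine ⟨C * W.M 0, by positivity, fun φ => ?_⟩
    refine stepNorm_le (φ := DBeurling.toStep W (𝓡.lB m) (𝓡.RB k φ)) fun α =>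
      (h (DBeurling.toSob φ) α).2.trans ?_
    rw [mul_assoc]
    exact mul_le_mul_of_nonneg_left (𝓡.l1Norm_le_qB 0 φ) hC
  approx := fun m => by
    -- Starting from the parameter of index m + 1, the error is controlled at H times it, which is
    -- at most the parameter of index m.
    obtain ⟨C, hC, h⟩ := 𝓡.approx (𝓡.lB (m + 1)).1 (𝓡.lB (m + 1)).2
    refine ⟨C, hC, fun k φ => ?_⟩
    refine stepNorm_le (φ := DBeurling.toStep W (𝓡.lB m) (φ - 𝓡.RB k φ)) fun α => ?_
    have hH := 𝓡.one_le
    refine (quot_anti W (mul_pos (by linarith) (𝓡.lB (m + 1)).2) (𝓡.lB_succ m) _ α).trans ?_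
    exact h k (DBeurling.toSob φ) _
      (fun α => quot_le_stepNorm (DBeurling.toStep W (𝓡.lB (m + 1)) φ) α) α
  transpose := by
    rintro k T ⟨f, hf, hf', hT⟩ η hη
    have h0 := W.isWeightSequence.pos 0
    obtain ⟨g, hg, hg', h⟩ := 𝓡.transpose k f hf hf' (η / W.M 0) (by positivity)
    obtain ⟨K, hK, hb⟩ := 𝓡.exists_funL_qB_bound hg hg'
    have hc : Continuous (funL (DBeurling.incl W) hg hg') := by
      refine WithSeminorms.continuous_normedSpace_rng ℂ 𝓡.withSeminorms_qB _ ⟨{0}, ⟨K, hK⟩, ?_⟩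
      rw [Finset.sup_singleton]
      exact hb
    refine ⟨⟨funL (DBeurling.incl W) hg hg', hc⟩, ⟨g, hg, hg', fun φ => rfl⟩, fun φ => ?_⟩
    rw [hT]
    refine (h (DBeurling.toSob φ)).trans ?_
    calc _ ≤ η / W.M 0 * (W.M 0 * 𝓡.qB 0 φ) :=
          mul_le_mul_of_nonneg_left (𝓡.l1Norm_le_qB 0 φ) (by positivity)
      _ = _ := by field_simp
  bound := by
    rintro T ⟨f, hf, hf', hT⟩
    obtain ⟨K, -, hb⟩ := 𝓡.exists_funL_qB_bound hf hf'
    exact ⟨K, fun φ => by rw [hT]; exact hb φ⟩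

end Regularization

end

/-! ### The Roumieu dual as a projective limit of Banach spaces; quasinormability -/

section

variable {d : ℕ} {W : Weights d}

theorem DRoumieu.mem (φ : DRoumieu W) : ∃ l, DRoumieu.incl W φ ∈ DStep W l := φ.2

/-- The inclusion into the space of functions with all derivatives in `L^1_ω`. -/
def DRoumieu.toSob : DRoumieu W →ₗ[ℂ] SobL1 W :=
  (DRoumieu.incl W).codRestrict _ fun φ => by
    obtain ⟨l, hl⟩ := DRoumieu.mem φ
    exact hl.1

/-- The continuous inclusion of a step. -/
def stepIncl (l : {l : ℝ // 0 < l}) : WithSN (stepNorm W l) →L[ℂ] DRoumieu W where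
  toFun φ := DRoumieu.ofStep W l φ
  map_add' φ ψ := map_add (DRoumieu.ofStep W l) φ ψ
  map_smul' c φ := map_smul (DRoumieu.ofStep W l) c φ
  cont := by
    refine WithSeminorms.continuous_normedSpace_dom (WithSN (stepNorm W l))
      (roumieu_withSeminorms W)
      (show WithSN (stepNorm W l) →ₗ[ℂ] DRoumieu W from DRoumieu.ofStep W l) fun p => ?_
    obtain ⟨C, hC⟩ := p.2 l
    exact ⟨C.toNNReal, fun φ => (hC φ).trans
      (mul_le_mul_of_nonneg_right (Real.le_coe_toNNReal C) (apply_nonneg (stepNorm W l) _))⟩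

theorem continuous_roumieuSeminorm (p : Seminorm ℂ (DRoumieu W))
    (hp : ∀ l, ∃ C : ℝ, ∀ φ : DStep W l, p (DRoumieu.ofStep W l φ) ≤ C * stepNorm W l φ) :
    Continuous p :=
  (roumieu_withSeminorms W).continuous_seminorm (⟨p, hp⟩ : RoumieuSeminorm W)

/-- A linear functional which is continuous on all steps. -/
def mkRoumieu (f : DRoumieu W →ₗ[ℂ] ℂ)
    (hf : ∀ l, ∃ C : ℝ, ∀ φ : DStep W l, ‖f (DRoumieu.ofStep W l φ)‖ ≤ C * stepNorm W l φ) :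
    StrongDual ℂ (DRoumieu W) where
  toLinearMap := f
  cont := by
    refine WithSeminorms.continuous_of_continuous_comp (norm_withSeminorms ℂ ℂ) f fun _ => ?_
    exact continuous_roumieuSeminorm ((normSeminorm ℂ ℂ).comp f) hf

/-- A pointwise continuous linear map from a Baire space into a strong dual is continuous. -/
theorem continuous_of_pointwise_of_baire {E F : Type*} [AddCommGroup E] [Module ℂ E]
    [UniformSpace E] [IsUniformAddGroup E] [ContinuousSMul ℂ E] [BaireSpace E] [AddCommGroup F]
    [Module ℂ F] [TopologicalSpace F] [IsTopologicalAddGroup F] [ContinuousSMul ℂ F]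
    (f : E →ₗ[ℂ] StrongDual ℂ F) (hf : ∀ x, Continuous fun S => f S x) : Continuous f := by
  refine continuous_of_continuousAt_zero f ?_
  rw [ContinuousAt, map_zero, ContinuousLinearMap.hasBasis_nhds_zero.tendsto_right_iff]
  rintro ⟨B, U⟩ ⟨hB, hU⟩
  -- The evaluations at points of the bounded set B are pointwise bounded, since each f S is bounded
  -- on B; Banach–Steinhaus upgrades this to equicontinuity, which is continuity for uniform
  -- convergence on B.
  let ev : B → E →L[ℂ] ℂ := fun x =>
    { toFun := fun S => f S x.1
      map_add' := fun S S' => by rw [map_add]; rfl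
      map_smul' := fun c S => by rw [map_smul]; rfl
      cont := hf x.1 }
  have H : ∀ S, Bornology.IsVonNBounded ℂ (Set.range fun x : B => ev x S) := fun S => by
    have h1 := hB.image (f S)
    rw [Set.image_eq_range] at h1
    exact h1
  have hbs := PolynormableSpace.banach_steinhaus (𝓕 := ev) H
  have h2 := hbs.equicontinuous 0 {p : ℂ × ℂ | p.2 - p.1 ∈ U} (by
    rw [uniformity_eq_comap_nhds_zero]
    exact preimage_mem_comap hU)
  filter_upwards [h2] with S hS x hx
  have := hS ⟨x, hx⟩
  simpa [ev] using this

namespace Regularization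

variable (𝓡 : Regularization W)

/-- An increasing sequence of parameters. -/
def lR (n : ℕ) : {l : ℝ // 0 < l} := ⟨(𝓡.H + 1) ^ n, by have := 𝓡.one_le; positivity⟩

theorem lR_mono : Monotone 𝓡.lR := by
  intro m n h
  have := 𝓡.one_le
  exact pow_le_pow_right₀ (show 1 ≤ 𝓡.H + 1 by linarith) h

theorem exists_le_lR (l : {l : ℝ // 0 < l}) : ∃ n, l ≤ 𝓡.lR n := by
  have := 𝓡.one_le
  obtain ⟨n, hn⟩ := pow_unbounded_of_one_lt l.1 (show 1 < 𝓡.H + 1 by linarith)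
  exact ⟨n, hn.le⟩

theorem lR_succ (n : ℕ) : 𝓡.H * (𝓡.lR n).1 ≤ (𝓡.lR (n + 1)).1 := by
  have := 𝓡.one_le
  change 𝓡.H * (𝓡.H + 1) ^ n ≤ (𝓡.H + 1) ^ (n + 1)
  rw [pow_succ, mul_comm]
  exact mul_le_mul_of_nonneg_left (by linarith) (by positivity)

/-- The steps of the inductive limit. -/
abbrev StepR (n : ℕ) : Type := WithSN (stepNorm W (𝓡.lR n))

/-- The inclusions between steps. -/
def inclR {m n : ℕ} (h : m ≤ n) : DStep W (𝓡.lR m) →ₗ[ℂ] DStep W (𝓡.lR n) :=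
  Submodule.inclusion (DStep_mono W (𝓡.lR_mono h))

theorem ofStep_inclR {m n : ℕ} (h : m ≤ n) (φ : DStep W (𝓡.lR m)) :
    DRoumieu.ofStep W _ (𝓡.inclR h φ) = DRoumieu.ofStep W _ φ := rfl

theorem stepNorm_inclR_le {m n : ℕ} (h : m ≤ n) (φ : DStep W (𝓡.lR m)) :
    stepNorm W _ (𝓡.inclR h φ) ≤ stepNorm W _ φ := stepNorm_mono (𝓡.lR_mono h) rfl

theorem exists_ofStep (φ : DRoumieu W) : ∃ n, ∃ ψ : DStep W (𝓡.lR n),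
    DRoumieu.ofStep W _ ψ = φ := by
  obtain ⟨l, hl⟩ := DRoumieu.mem φ
  obtain ⟨n, hn⟩ := 𝓡.exists_le_lR l
  exact ⟨n, ⟨_, DStep_mono W hn hl⟩, rfl⟩

/-- The restriction of functionals to a step. -/
def restr (n : ℕ) : StrongDual ℂ (DRoumieu W) →L[ℂ] StrongDual ℂ (𝓡.StepR n) :=
  ContinuousLinearMap.precomp ℂ (stepIncl (𝓡.lR n))

theorem norm_apply_le (T : StrongDual ℂ (DRoumieu W)) (n : ℕ) (φ : DStep W (𝓡.lR n)) :
    ‖T (DRoumieu.ofStep W _ φ)‖ ≤ ‖𝓡.restr n T‖ * stepNorm W _ φ :=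
  (𝓡.restr n T).le_opNorm φ

theorem norm_restr_le {T : StrongDual ℂ (DRoumieu W)} {n : ℕ} {K : ℝ} (hK : 0 ≤ K)
    (h : ∀ φ : DStep W (𝓡.lR n), ‖T (DRoumieu.ofStep W _ φ)‖ ≤ K * stepNorm W _ φ) :
    ‖𝓡.restr n T‖ ≤ K := ContinuousLinearMap.opNorm_le_bound _ hK h

theorem norm_restr_mono (T : StrongDual ℂ (DRoumieu W)) {m n : ℕ} (h : m ≤ n) :
    ‖𝓡.restr m T‖ ≤ ‖𝓡.restr n T‖ :=
  𝓡.norm_restr_le (norm_nonneg _) fun φ => (𝓡.norm_apply_le T n (𝓡.inclR h φ)).trans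
    (mul_le_mul_of_nonneg_left (𝓡.stepNorm_inclR_le h φ) (norm_nonneg _))

/-- The compatible families of functionals on the steps. -/
def Glue : Submodule ℂ (∀ n, StrongDual ℂ (𝓡.StepR n)) where
  carrier := {S | ∀ (m n : ℕ) (h : m ≤ n) (φ : DStep W (𝓡.lR m)),
    S n (show 𝓡.StepR n from 𝓡.inclR h φ) = S m (show 𝓡.StepR m from φ)}
  zero_mem' := fun _ _ _ _ => rfl
  add_mem' := fun hS hT m n h φ => congrArg₂ (· + ·) (hS m n h φ) (hT m n h φ)
  smul_mem' := fun c _ hS m n h φ => congrArg (c • ·) (hS m n h φ)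

theorem isClosed_glue : IsClosed (𝓡.Glue : Set (∀ n, StrongDual ℂ (𝓡.StepR n))) := by
  have e : (𝓡.Glue : Set (∀ n, StrongDual ℂ (𝓡.StepR n))) =
      ⋂ (m : ℕ) (n : ℕ) (h : m ≤ n) (φ : DStep W (𝓡.lR m)),
        {S | S n (show 𝓡.StepR n from 𝓡.inclR h φ) = S m (show 𝓡.StepR m from φ)} := by
    ext S
    simp only [Set.mem_iInter]
    rfl
  rw [e]
  refine isClosed_iInter fun m => isClosed_iInter fun n => isClosed_iInter fun h =>
    isClosed_iInter fun φ => isClosed_eq ?_ ?_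
  · exact (continuous_eval_const _).comp (continuous_apply n)
  · exact (continuous_eval_const _).comp (continuous_apply m)

instance : CompleteSpace 𝓡.Glue := 𝓡.isClosed_glue.completeSpace_coe

instance : (uniformity 𝓡.Glue).IsCountablyGenerated := by
  have h : (uniformity (∀ n, StrongDual ℂ (𝓡.StepR n))).IsCountablyGenerated := by
    rw [Pi.uniformity]
    infer_instance
  exact Filter.comap.isCountablyGenerated _ _

/-- A closed subspace of a countable product of Banach spaces is completely metrizable. -/
instance : BaireSpace 𝓡.Glue :=
  have : TopologicalSpace.IsCompletelyPseudoMetrizableSpace 𝓡.Glue :=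
    𝓡.isClosed_glue.isClosedEmbedding_subtypeVal.IsCompletelyPseudoMetrizableSpace
  BaireSpace.of_completelyPseudoMetrizable

instance : IsUniformAddGroup 𝓡.Glue := 𝓡.Glue.toAddSubgroup.isUniformAddGroup

theorem Glue.apply_eq (S : 𝓡.Glue) {m n : ℕ} {φ : DStep W (𝓡.lR m)} {ψ : DStep W (𝓡.lR n)}
    (h : DRoumieu.ofStep W _ φ = DRoumieu.ofStep W _ ψ) :
    S.1 m (show 𝓡.StepR m from φ) = S.1 n (show 𝓡.StepR n from ψ) := by
  have h' : φ.1 = ψ.1 := congrArg (DRoumieu.incl W) h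
  rw [← S.2 m (max m n) (le_max_left _ _) φ, ← S.2 n (max m n) (le_max_right _ _) ψ]
  have e : 𝓡.inclR (le_max_left m n) φ = 𝓡.inclR (le_max_right m n) ψ := Subtype.ext h'
  rw [e]

/-- The value of a compatible family. -/
def glueFun (S : 𝓡.Glue) (φ : DRoumieu W) : ℂ :=
  S.1 (𝓡.exists_ofStep φ).choose
    (show 𝓡.StepR _ from (𝓡.exists_ofStep φ).choose_spec.choose)

theorem glueFun_ofStep (S : 𝓡.Glue) (n : ℕ) (φ : DStep W (𝓡.lR n)) :
    𝓡.glueFun S (DRoumieu.ofStep W _ φ) = S.1 n (show 𝓡.StepR n from φ) :=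
  Glue.apply_eq 𝓡 S (𝓡.exists_ofStep (DRoumieu.ofStep W _ φ)).choose_spec.choose_spec

/-- The functional defined by a compatible family. -/
def glueL (S : 𝓡.Glue) : DRoumieu W →ₗ[ℂ] ℂ where
  toFun := 𝓡.glueFun S
  map_add' φ ψ := by
    obtain ⟨m, φ, rfl⟩ := 𝓡.exists_ofStep φ
    obtain ⟨n, ψ, rfl⟩ := 𝓡.exists_ofStep ψ
    rw [← 𝓡.ofStep_inclR (le_max_left m n) φ, ← 𝓡.ofStep_inclR (le_max_right m n) ψ, ← map_add,
      glueFun_ofStep, glueFun_ofStep, glueFun_ofStep]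
    exact map_add (S.1 (max m n)) _ _
  map_smul' c φ := by
    obtain ⟨m, φ, rfl⟩ := 𝓡.exists_ofStep φ
    rw [← map_smul, glueFun_ofStep, glueFun_ofStep]
    exact map_smul (S.1 m) _ _

theorem glueL_ofStep (S : 𝓡.Glue) (n : ℕ) (φ : DStep W (𝓡.lR n)) :
    𝓡.glueL S (DRoumieu.ofStep W _ φ) = S.1 n (show 𝓡.StepR n from φ) := 𝓡.glueFun_ofStep S n φ

theorem norm_glueL_le (S : 𝓡.Glue) {l : {l : ℝ // 0 < l}} {n : ℕ} (hn : l ≤ 𝓡.lR n)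
    (φ : DStep W l) : ‖𝓡.glueL S (DRoumieu.ofStep W l φ)‖ ≤ ‖S.1 n‖ * stepNorm W l φ := by
  have e := 𝓡.glueL_ofStep S n (Submodule.inclusion (DStep_mono W hn) φ)
  have h1 := (S.1 n).le_opNorm
    (show 𝓡.StepR n from Submodule.inclusion (DStep_mono W hn) φ)
  rw [← e] at h1
  have h2 : stepNorm W (𝓡.lR n) (Submodule.inclusion (DStep_mono W hn) φ) ≤ stepNorm W l φ :=
    stepNorm_mono hn rfl
  exact h1.trans (mul_le_mul_of_nonneg_left h2 (norm_nonneg _))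

/-- The continuous functional defined by a compatible family. -/
def glue : 𝓡.Glue →ₗ[ℂ] StrongDual ℂ (DRoumieu W) where
  toFun S := mkRoumieu (𝓡.glueL S) fun l =>
    (𝓡.exists_le_lR l).elim fun n hn => ⟨‖S.1 n‖, 𝓡.norm_glueL_le S hn⟩
  map_add' S S' := by
    refine ContinuousLinearMap.ext fun φ => ?_
    obtain ⟨m, φ, rfl⟩ := 𝓡.exists_ofStep φ
    change 𝓡.glueL (S + S') _ = 𝓡.glueL S _ + 𝓡.glueL S' _
    rw [glueL_ofStep, glueL_ofStep, glueL_ofStep]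
    rfl
  map_smul' c S := by
    refine ContinuousLinearMap.ext fun φ => ?_
    obtain ⟨m, φ, rfl⟩ := 𝓡.exists_ofStep φ
    change 𝓡.glueL (c • S) _ = c • 𝓡.glueL S _
    rw [glueL_ofStep, glueL_ofStep]
    rfl

theorem glue_ofStep (S : 𝓡.Glue) (n : ℕ) (φ : DStep W (𝓡.lR n)) :
    𝓡.glue S (DRoumieu.ofStep W _ φ) = S.1 n (show 𝓡.StepR n from φ) := 𝓡.glueL_ofStep S n φ

theorem continuous_glue_apply (φ : DRoumieu W) : Continuous fun S => 𝓡.glue S φ := by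
  obtain ⟨n, φ, rfl⟩ := 𝓡.exists_ofStep φ
  rw [show (fun S => 𝓡.glue S (DRoumieu.ofStep W _ φ)) =
    fun S => S.1 n (show 𝓡.StepR n from φ) from funext fun S => 𝓡.glue_ofStep S n φ]
  exact (continuous_eval_const _).comp ((continuous_apply n).comp continuous_subtype_val)

/-- The substantial half of the isomorphism. The Baire argument avoids having to know that bounded
sets of the inductive limit are contained and bounded in a step. -/
theorem continuous_glue : Continuous 𝓡.glue :=
  continuous_of_pointwise_of_baire (E := 𝓡.Glue) (F := DRoumieu W) 𝓡.glue
    𝓡.continuous_glue_apply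

/-- The strong dual as a projective limit of Banach spaces. -/
def glueEquiv : 𝓡.Glue ≃L[ℂ] StrongDual ℂ (DRoumieu W) where
  toLinearMap := 𝓡.glue
  invFun T := ⟨fun n => 𝓡.restr n T, fun m n h φ => rfl⟩
  left_inv S := Subtype.ext <| funext fun n => ContinuousLinearMap.ext fun φ => 𝓡.glue_ofStep S n φ
  right_inv T := ContinuousLinearMap.ext fun φ => by
    obtain ⟨n, φ, rfl⟩ := 𝓡.exists_ofStep φ
    exact 𝓡.glue_ofStep _ n φ
  continuous_toFun := 𝓡.continuous_glue
  continuous_invFun := by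
    exact Continuous.subtype_mk (continuous_pi fun n => (𝓡.restr n).continuous) _

theorem completeSpace_strongDual (𝓡 : Regularization W) :
    CompleteSpace (StrongDual ℂ (DRoumieu W)) := by
  have h : IsUniformEmbedding 𝓡.glueEquiv :=
    ContinuousLinearEquiv.isUniformEmbedding (E₁ := 𝓡.Glue) (E₂ := StrongDual ℂ (DRoumieu W))
      𝓡.glueEquiv
  exact (h.completeSpace_congr 𝓡.glueEquiv.surjective).1 inferInstance

theorem metrizableSpace_strongDual (𝓡 : Regularization W) :
    TopologicalSpace.MetrizableSpace (StrongDual ℂ (DRoumieu W)) :=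
  𝓡.glueEquiv.symm.toHomeomorph.isEmbedding.metrizableSpace

/-- A product neighbourhood restricts finitely many coordinates; as the restricted norms increase
with the index, the largest one controls them all. -/
theorem exists_restr_subset {U : Set (StrongDual ℂ (DRoumieu W))} (hU : U ∈ 𝓝 0) :
    ∃ n r, 0 < r ∧ ∀ T, ‖𝓡.restr n T‖ < r → T ∈ U := by
  have h1 : 𝓡.glueEquiv ⁻¹' U ∈ 𝓝 (0 : 𝓡.Glue) :=
    𝓡.glueEquiv.continuous.continuousAt.preimage_mem_nhds (by rwa [map_zero])
  rw [nhds_subtype_eq_comap, mem_comap] at h1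
  obtain ⟨t, ht, htU⟩ := h1
  rw [nhds_pi, mem_pi] at ht
  obtain ⟨I, hI, s, hs, hst⟩ := ht
  have h2 : ∀ᶠ r in 𝓝[>] (0 : ℝ), ∀ i ∈ I, Metric.ball 0 r ⊆ s i := by
    rw [eventually_all_finite hI]
    intro i _
    obtain ⟨ε, hε, hb⟩ := Metric.mem_nhds_iff.1 (hs i)
    filter_upwards [Ioc_mem_nhdsGT hε] with r hr
    exact (Metric.ball_subset_ball hr.2).trans hb
  obtain ⟨r, hr, hr0⟩ := (h2.and self_mem_nhdsWithin).exists
  refine ⟨hI.toFinset.sup id, r, hr0, fun T hT => ?_⟩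
  have h3 := @htU (𝓡.glueEquiv.symm T) (hst fun i hi => hr i hi ?_)
  · simpa using h3
  · rw [mem_ball_zero_iff]
    refine lt_of_le_of_lt (𝓡.norm_restr_mono T ?_) hT
    exact Finset.le_sup (f := id) (hI.mem_toFinset.2 hi)

/-! ### Regularization of functionals -/

/-- The regularizing operators, with values in a step. -/
def regR (k n : ℕ) : DRoumieu W →L[ℂ] 𝓡.StepR n where
  toLinearMap := show DRoumieu W →ₗ[ℂ] DStep W (𝓡.lR n) from
    ((𝓡.R k).comp DRoumieu.toSob).codRestrict _ fun _ => 𝓡.R_mem k _ _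
  cont := by
    refine WithSeminorms.continuous_of_continuous_comp (norm_withSeminorms ℂ (𝓡.StepR n))
      _ fun _ => ?_
    refine continuous_roumieuSeminorm _ fun l => ?_
    obtain ⟨C, hC, h⟩ := 𝓡.smoothing k (𝓡.lR n).1 (𝓡.lR n).2
    refine ⟨C * W.M 0, fun φ => ?_⟩
    refine stepNorm_le (φ := ⟨𝓡.R k (DRoumieu.toSob (DRoumieu.ofStep W l φ)), 𝓡.R_mem k _ _⟩)
      fun α => (h _ α).2.trans ?_
    rw [mul_assoc]
    exact mul_le_mul_of_nonneg_left (l1Norm_le_stepNorm φ) hC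

/-- The transposes of the regularizing operators, on the dual of a step. -/
def transp (k n : ℕ) : StrongDual ℂ (𝓡.StepR n) →L[ℂ] StrongDual ℂ (DRoumieu W) :=
  ContinuousLinearMap.precomp ℂ (𝓡.regR k n)

/-- This dualizes the approximation property: id - R_k maps step n into step n + 1 with norm at most
C / (k + 1). -/
theorem exists_approx (n : ℕ) : ∃ C, 0 ≤ C ∧ ∀ (k : ℕ) (T : StrongDual ℂ (DRoumieu W)),
    ‖𝓡.restr n (T - 𝓡.transp k (n + 1) (𝓡.restr (n + 1) T))‖
      ≤ C / (k + 1) * ‖𝓡.restr (n + 1) T‖ := by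
  obtain ⟨C, hC, h⟩ := 𝓡.approx (𝓡.lR n).1 (𝓡.lR n).2
  have hH := 𝓡.one_le
  refine ⟨C, hC, fun k T => 𝓡.norm_restr_le (by positivity) fun φ => ?_⟩
  set ψ : DStep W (𝓡.lR (n + 1)) := 𝓡.inclR n.le_succ φ -
    ⟨𝓡.R k (DRoumieu.toSob (DRoumieu.ofStep W _ φ)), 𝓡.R_mem k _ _⟩
  have e : (T - 𝓡.transp k (n + 1) (𝓡.restr (n + 1) T)) (DRoumieu.ofStep W _ φ)
      = T (DRoumieu.ofStep W _ ψ) := (map_sub T _ _).symm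
  rw [e]
  have hψ : stepNorm W _ ψ ≤ C / (k + 1) * stepNorm W _ φ := by
    refine stepNorm_le fun α => ?_
    refine (quot_anti W (mul_pos (by linarith) (𝓡.lR n).2) (𝓡.lR_succ n) _ α).trans ?_
    exact h k (DRoumieu.toSob (DRoumieu.ofStep W _ φ)) _ (fun α => quot_le_stepNorm φ α) α
  calc _ ≤ ‖𝓡.restr (n + 1) T‖ * stepNorm W _ ψ := 𝓡.norm_apply_le T _ ψ
    _ ≤ ‖𝓡.restr (n + 1) T‖ * (C / (k + 1) * stepNorm W _ φ) :=
        mul_le_mul_of_nonneg_left hψ (norm_nonneg _)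
    _ = _ := by ring

/-- By continuity T may be taken compactly supported. The cutoff error is then measured by the
L^1_ω-norm, which every step norm dominates, so any neighbourhood of 0 can be reached. -/
theorem transp_mem (k n : ℕ) {T : StrongDual ℂ (DRoumieu W)} (hT : T ∈ BDotRoumieu W) :
    𝓡.transp k n (𝓡.restr n T) ∈ BDotRoumieu W := by
  refine Submodule.topologicalClosure_minimal (s := compactlySupported (DRoumieu.incl W))
    (t := (BDotRoumieu W).comap ((𝓡.transp k n).comp (𝓡.restr n)).toLinearMap) ?_
    ((Submodule.isClosed_topologicalClosure _).preimage
      ((𝓡.transp k n).comp (𝓡.restr n)).continuous) hT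
  rintro T ⟨f, hf, hf', hT⟩
  change _ ∈ closure _
  rw [mem_closure_iff_nhds_zero]
  intro U hU
  obtain ⟨m, r, hr, hU⟩ := 𝓡.exists_restr_subset hU
  have h0 := W.isWeightSequence.pos 0
  obtain ⟨g, hg, hg', h⟩ := 𝓡.transpose k f hf hf' (r / 2 / W.M 0) (by positivity)
  have hD : ∀ φ, MemL1 W.ω (DRoumieu.incl W φ) := fun φ => SobL1.memL1 (DRoumieu.toSob φ).2
  obtain ⟨K, hK, hb⟩ := exists_funL_bound (DRoumieu.incl W) hD hg hg'
  set S := mkRoumieu (funL (DRoumieu.incl W) hg hg') fun l => ⟨K * W.M 0, fun φ => by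
    refine (hb _).trans ?_
    rw [mul_assoc]
    exact mul_le_mul_of_nonneg_left (l1Norm_le_stepNorm φ) hK⟩ with hS
  refine ⟨S, ⟨g, hg, hg', fun φ => rfl⟩, hU _ (lt_of_le_of_lt ?_ (half_lt_self hr))⟩
  refine 𝓡.norm_restr_le (by positivity) fun φ => ?_
  set ψ := DRoumieu.ofStep W _ φ
  have e : (S - 𝓡.transp k n (𝓡.restr n T)) ψ
      = (∫ x, g x * (DRoumieu.incl W ψ).1 x) - ∫ x, f x * (𝓡.R k (DRoumieu.toSob ψ)).1 x :=
    congrArg (fun z => (∫ x, g x * (DRoumieu.incl W ψ).1 x) - z)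
      (hT (stepIncl _ (𝓡.regR k n ψ)))
  change ‖(S - 𝓡.transp k n (𝓡.restr n T)) ψ‖ ≤ _
  rw [e, norm_sub_rev]
  refine (h (DRoumieu.toSob ψ)).trans ?_
  calc _ ≤ r / 2 / W.M 0 * (W.M 0 * stepNorm W _ φ) :=
        mul_le_mul_of_nonneg_left (l1Norm_le_stepNorm φ) (by positivity)
    _ = _ := by field_simp

theorem isFrechetSpace (𝓡 : Regularization W) : IsFrechetSpace (BDotRoumieu W) where
  isUniformAddGroup := (BDotRoumieu W).toAddSubgroup.isUniformAddGroup
  continuousSMul := inferInstance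
  locallyConvexSpace :=
    inferInstanceAs (LocallyConvexSpace ℝ ((BDotRoumieu W).restrictScalars ℝ))
  metrizableSpace := by
    have := 𝓡.metrizableSpace_strongDual
    exact Topology.IsEmbedding.subtypeVal.metrizableSpace
  completeSpace := by
    have := 𝓡.completeSpace_strongDual
    exact (Submodule.isClosed_topologicalClosure _).completeSpace_coe

theorem isVonNBounded_subtype {E : Type*} [AddCommGroup E] [Module ℂ E] [TopologicalSpace E]
    {p : Submodule ℂ E} {B : Set p} {B' : Set E} (hB' : Bornology.IsVonNBounded ℂ B')
    (h : ∀ x ∈ B, x.1 ∈ B') : Bornology.IsVonNBounded ℂ B := by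
  intro V hV
  rw [nhds_subtype_eq_comap, mem_comap] at hV
  obtain ⟨t, ht, htV⟩ := hV
  have h1 := hB' ht
  rw [absorbs_iff_eventually_cobounded_mapsTo] at h1 ⊢
  filter_upwards [h1] with a ha x hx
  exact htV (ha (h x hx))

theorem isQuasinormable (𝓡 : Regularization W) : IsQuasinormable (BDotRoumieu W) := by
  intro U hU
  rw [nhds_subtype_eq_comap, mem_comap] at hU
  obtain ⟨U', hU', hUU⟩ := hU
  obtain ⟨n, r, hr, hUr⟩ := 𝓡.exists_restr_subset hU'
  obtain ⟨C, hC, happ⟩ := 𝓡.exists_approx n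
  -- V lives one index above U and does not depend on ε; only k, and with it the bounded set, does.
  refine ⟨{T | ‖𝓡.restr (n + 1) T.1‖ < 1}, ?_, fun ε hε => ?_⟩
  · have hc : Continuous fun T : BDotRoumieu W => ‖𝓡.restr (n + 1) T.1‖ :=
      ((𝓡.restr (n + 1)).continuous.comp continuous_subtype_val).norm
    exact (isOpen_lt hc continuous_const).mem_nhds (by simp)
  obtain ⟨k, hk⟩ := ((tendsto_const_div_add_one_atTop C).eventually_lt_const
    (show 0 < ε * r by positivity)).exists
  refine ⟨{T | ∃ f : StrongDual ℂ (𝓡.StepR (n + 1)), ‖f‖ < 1 ∧ 𝓡.transp k (n + 1) f = T.1}, ?_,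
    fun T hT => ?_⟩
  · have hb : Bornology.IsVonNBounded ℂ (𝓡.transp k (n + 1) '' Metric.ball 0 1) :=
      (NormedSpace.isVonNBounded_ball ℂ _ _).image _
    refine isVonNBounded_subtype hb ?_
    rintro T ⟨f, hf, hfT⟩
    exact ⟨f, by simpa using hf, hfT⟩
  set b : BDotRoumieu W := ⟨_, 𝓡.transp_mem k (n + 1) T.2⟩ with hb
  have hε' : (ε : ℂ) ≠ 0 := by exact_mod_cast hε.ne'
  refine ⟨b, ⟨_, hT, rfl⟩, (ε : ℂ)⁻¹ • (T - b), hUU (hUr _ ?_), ?_⟩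
  · have e : ((ε : ℂ)⁻¹ • (T - b)).1
        = (ε : ℂ)⁻¹ • (T.1 - 𝓡.transp k (n + 1) (𝓡.restr (n + 1) T.1)) := rfl
    rw [e, map_smul, norm_smul, norm_inv, Complex.norm_real, Real.norm_of_nonneg hε.le,
      inv_mul_lt_iff₀ hε]
    refine lt_of_le_of_lt ((happ k T.1).trans ?_) hk
    exact mul_le_of_le_one_right (by positivity) (le_of_lt hT)
  · rw [smul_inv_smul₀ hε']
    abel

end Regularization

end

end Ultra

end

theorem corollary3p9 (d : ℕ) (W : Ultra.Weights d)
    (hM1 : Ultra.CondM1 W.M) (hM2 : Ultra.CondM2' W.M) :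
    (Ultra.BeurlingAssumption W.M W.ω →
      CompleteSpace (Ultra.BDotBeurling W) ∧ Ultra.IsLBSpace (Ultra.BDotBeurling W)) ∧
    (Ultra.RoumieuAssumption W.M W.ω →
      Ultra.IsFrechetSpace (Ultra.BDotRoumieu W) ∧
        Ultra.IsQuasinormable (Ultra.BDotRoumieu W)) := by
  refine ⟨fun h => ?_, fun h => ?_⟩
  · obtain ⟨𝓡⟩ := Ultra.exists_regularization hM1 hM2 h
    exact ⟨𝓡.isRegularized.completeSpace, 𝓡.isRegularized.isLBSpace⟩
  -- Admissibility for a single parameter already gives the regularizing operators used for both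
  -- spaces.
  · obtain ⟨𝓡⟩ := Ultra.exists_regularization hM1 hM2 h.beurling
    exact ⟨𝓡.isFrechetSpace, 𝓡.isQuasinormable⟩
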